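/- Let $n\ge 0$ and let $(t_k)_{k\ge 1}$ be complex numbers with $t_1=0$, $|t_2|<\tfrac12$ and $t_k=0$ for $k>n+1$. Let $D\subset\mathbb C$ be a compact set containing $0$ in its interior, and suppose that $U(z)=|z|^2-2\,\mathrm{Re}\sum_{k=1}^{n+1}t_kz^k$ is positive for all $z\in D\setminus\{0\}$. For $t_0>0$ put $V=U/t_0$. A polynomial curve is a smooth simple closed curve $\gamma=h(S^1)$ parametrized by an embedding of the unit circle of the form $h(w)=rw+a_0+a_1w^{-1}+\dots+a_mw^{-m}$, $|w|=1$, with $m\ge 0$, $r>0$ and $a_j\in\mathbb C$; its degree is the largest $j$ with $a_j\ne0$ (and $0$ if there is none). It is positively oriented if its tangent vector $iwh'(w)$ makes one full counterclockwise turn as $w$ runs once counterclockwise around the unit circle. Its interior domain $D_+$ is the bounded connected component of $\mathbb C\setminus\gamma$, and $\gamma$ encircles the origin if $0\in D_+$. In that case its exterior harmonic moments are $\frac1{2\pi i j}\oint_\gamma \bar z z^{-j}\,dz$, $j\ge1$. An equilibrium measure for $V$ on $D$ is a Borel probability measure $\mu$ on $D$ without point masses at which the infimum over all such measures of $$I(\mu)=\int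 V\,d\mu+\iint_{z\ne\zeta}\log|z-\zeta|^{-1}\,d\mu(\zeta)\,d\mu(z)\in(-\infty,+\infty]$$ is attained. Then there exists $\delta>0$ such that for all $0<t_0<\delta$: there is exactly one positively oriented polynomial curve $\gamma$ encircling the origin whose interior domain $D_+$ has area $\pi t_0$ and whose exterior harmonic moments are $(t_j)_{j\ge1}$; it has degree at most $n$; and $V$ has exactly one equilibrium measure on $D$, namely $$\mu=\frac1{\pi t_0}\,\chi_{D_+}\,\lambda,$$ where $\lambda$ is Lebesgue measure on $\mathbb C$. -/

import Mathlib

open MeasureTheory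
open scoped ENNReal

noncomputable section

/-! ### Weighted logarithmic energy and equilibrium measures -/

/-- The Borel probability measures on `D` (measures on `ℂ` carried by `D`) without point masses. -/
def admissibleMeasures (D : Set ℂ) : Set (Measure ℂ) :=
  {μ | IsProbabilityMeasure μ ∧ (∀ z : ℂ, μ {z} = 0) ∧ μ Dᶜ = 0}

/-- The double integral of `log |z - ζ|⁻¹` over `z ≠ ζ`, with values in the extended reals, as the
integral of the positive part minus the integral of the negative part. (The inner integrals run
over `ζ ≠ z`.) For a finite measure carried by a bounded set the second integral is finite, so that
the difference is the integral, a real number or `+∞`. -/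
def logEnergy (μ : Measure ℂ) : EReal :=
  ((∫⁻ z, ∫⁻ ζ in {z}ᶜ, ENNReal.ofReal (Real.log ‖z - ζ‖⁻¹) ∂μ ∂μ : ℝ≥0∞) : EReal) -
    ((∫⁻ z, ∫⁻ ζ in {z}ᶜ, ENNReal.ofReal (-Real.log ‖z - ζ‖⁻¹) ∂μ ∂μ : ℝ≥0∞) : EReal)

/-- `I(μ) = ∫ V dμ + ∬_{z ≠ ζ} log |z - ζ|⁻¹ dμ(ζ) dμ(z)`. -/
def weightedEnergy (V : ℂ → ℝ) (μ : Measure ℂ) : EReal :=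
  ((∫ z, V z ∂μ : ℝ) : EReal) + logEnergy μ

/-- `μ` is an equilibrium measure for `V` on `D`: it is a Borel probability measure on `D` without
point masses at which the infimum of the weighted energy over all such measures is attained. -/
def IsEquilibriumMeasure (V : ℂ → ℝ) (D : Set ℂ) (μ : Measure ℂ) : Prop :=
  μ ∈ admissibleMeasures D ∧
    weightedEnergy V μ = ⨅ ν ∈ admissibleMeasures D, weightedEnergy V ν

/-! ### Polynomial curves -/

/-- The map `h(w) = r w + a₀ + a₁ w⁻¹ + ⋯ + aₙ w⁻ⁿ`, the coefficients `a_j` being those of the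
polynomial `a`. -/
def curveMap (r : ℝ) (a : Polynomial ℂ) (w : ℂ) : ℂ :=
  (r : ℂ) * w + a.eval w⁻¹

/-- A polynomial curve, given by its parametrization `h` of the above form with `r > 0`: the map `h`
embeds the unit circle (it is injective with nowhere vanishing derivative), so that its image is a
smooth simple closed curve. Its degree is that of the polynomial `a`. -/
structure PolynomialCurve where
  r : ℝ
  a : Polynomial ℂ
  r_pos : 0 < r
  injOn : Set.InjOn (curveMap r a) (Metric.sphere 0 1)
  deriv_ne_zero : ∀ w ∈ Metric.sphere (0 : ℂ) 1, deriv (curveMap r a) w ≠ 0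

namespace PolynomialCurve

/-- The parametrization. -/
def h (γ : PolynomialCurve) : ℂ → ℂ := curveMap γ.r γ.a

/-- The curve as a subset of the plane. -/
def image (γ : PolynomialCurve) : Set ℂ := γ.h '' Metric.sphere 0 1

/-- The interior domain `D₊`: the bounded connected component of the complement of the curve. -/
def interiorDomain (γ : PolynomialCurve) : Set ℂ :=
  {z | z ∉ γ.image ∧ Bornology.IsBounded (connectedComponentIn γ.imageᶜ z)}

/-- The tangent vector `d/dθ h(e^{iθ}) = i w h'(w)` at `w = e^{iθ}`. -/
def tangent (γ : PolynomialCurve) (w : ℂ) : ℂ := Complex.I * w * deriv γ.h w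

/-- The tangent vector makes one full turn in counterclockwise direction around the circle. -/
def PositivelyOriented (γ : PolynomialCurve) : Prop :=
  (2 * (Real.pi : ℂ) * Complex.I)⁻¹ *
    (∮ w in C(0, 1), deriv γ.tangent w / γ.tangent w) = 1

/-- The exterior harmonic moment `t_j = (2πij)⁻¹ ∮_γ z̄ z⁻ʲ dz`, for `j ≥ 1`. -/
def harmonicMoment (γ : PolynomialCurve) (j : ℕ) : ℂ :=
  (2 * (Real.pi : ℂ) * Complex.I * (j : ℂ))⁻¹ *
    ∮ w in C(0, 1), (starRingEnd ℂ) (γ.h w) * (γ.h w ^ j)⁻¹ * deriv γ.h w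

/-- `γ` is a positively oriented polynomial curve encircling the origin, whose interior domain has
area `π t₀` and whose exterior harmonic moments are `t₁, t₂, …`. (The value `t 0` is not used.) -/
def HasMoments (γ : PolynomialCurve) (t₀ : ℝ) (t : ℕ → ℂ) : Prop :=
  γ.PositivelyOriented ∧ 0 ∈ γ.interiorDomain ∧
    volume γ.interiorDomain = ENNReal.ofReal (Real.pi * t₀) ∧
    ∀ j : ℕ, 1 ≤ j → γ.harmonicMoment j = t j

/-- The measure `(1 / (π t₀)) χ_{D₊} λ`. -/
def uniformMeasure (γ : PolynomialCurve) (t₀ : ℝ) : Measure ℂ :=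
  ENNReal.ofReal (1 / (Real.pi * t₀)) • (volume : Measure ℂ).restrict γ.interiorDomain

end PolynomialCurve

/-! ### The potential -/

/-- `U(z) = |z|² - 2 Re ∑_{k=1}^{n+1} t_k z^k`, which is `t₀ V(z)`. -/
def scaledPotential (n : ℕ) (t : ℕ → ℂ) (z : ℂ) : ℝ :=
  ‖z‖ ^ 2 - 2 * (∑ k ∈ Finset.Icc 1 (n + 1), t k * z ^ k).re

/-- `V(z) = (1 / t₀) (|z|² - 2 Re ∑_{k=1}^{n+1} t_k z^k)`. -/
def potential (n : ℕ) (t₀ : ℝ) (t : ℕ → ℂ) (z : ℂ) : ℝ :=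
  1 / t₀ * scaledPotential n t z

end

section
open Metric Set Filter Topology

noncomputable section

/-! ### Circle integrals and zero-free families -/

/-! Write h(w) = r w + a(1/w), and let h̄(1/w) = r/w + ā(w) be the Laurent polynomial that agrees
with the conjugate of h on the unit circle. The argument has three components.

Geometry. Since the tangent turns exactly once, the polynomial r - u² a'(u), which is h' at 1/u, has
winding number zero and hence no zeros in the disc. With injectivity on the circle, Hurwitz'
principle spreads this to all difference quotients of h on the exterior of the disc
(`isExteriorUnivalent`). So D₊ is the complement of h({|w| ≥ 1}), and Green's formula on D₊ can be
proved by pulling the exterior back to a strip (`integral_interiorDomain_dbar`).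

Curves. Let P = ∑ k t_k z^(k-1). The moments are the t_k exactly when h̄(1/w) = P(h(w)) + O(1/w) at
infinity. Comparing the coefficients of nonnegative powers of w, with a_j = r b_j, gives a fixed
point equation for b. At r = 0 it has contraction constant at most 2|t₂| < 1, and its solution is
the ellipse w + 2 t̄₂/w. For small r there remains one bounded solution, Lipschitz in r, and the
area π r²(1 - ∑ j|b_j|²) increases strictly with r, so t₀ determines r (`exists_parameters`). To
apply this to every competing curve an a priori bound is needed: the Cauchy transform of D₊ is
O(√t₀) by its area alone, whence |z̄ - P(z)| ≤ 3√t₀ on the curve. Because 2|t₂| < 1, the curve lies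
within O(√t₀) of the origin or beyond a fixed distance, and the area excludes the second case
(`exists_norm_curveMap_le`).

Equilibrium. Let E = U - (2/π)∫_{D₊} log|z-ζ|. The Cauchy transform of D₊ is π(z̄ - P) inside, so E
is constant there. Outside, at z = h(w), the gradient of E is governed by the conjugate of h(w) -
h(1/w̄), a difference quotient times w - 1/w̄. Near the ellipse this makes E nondecreasing along
rays in the w-plane up to a large fixed |w|, and beyond that the bound U ≥ c|z|² on D wins
(`exists_effectivePotential_le`). These are the Euler-Lagrange conditions. They characterize the
minimizer because the logarithmic kernel is a superposition of Gaussians, hence strictly positive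
definite on measures of equal mass (`two_mul_mutualEnergy_le`, `isEquilibriumMeasure_iff`). -/

lemma circleIntegral_inv_comp (F : ℂ → ℂ) :
    ∮ w in C(0, 1), F w = ∮ u in C(0, 1), (u ^ 2)⁻¹ * F u⁻¹ := by
  have key : ∀ θ : ℝ, deriv (circleMap 0 1) (2 * Real.pi - θ) • F (circleMap 0 1 (2 * Real.pi - θ))
      = deriv (circleMap 0 1) θ • (((circleMap 0 1 θ) ^ 2)⁻¹ * F (circleMap 0 1 θ)⁻¹) := by
    intro θ
    have h1 : circleMap 0 1 (2 * Real.pi - θ) = (circleMap 0 1 θ)⁻¹ := by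
      simp only [circleMap, Complex.ofReal_one, one_mul, zero_add, ← Complex.exp_neg]
      rw [← Complex.exp_periodic (-(↑θ * Complex.I))]
      congr 1; push_cast; ring
    have h2 : circleMap 0 1 θ ≠ 0 := by simp [circleMap]
    simp only [deriv_circleMap, smul_eq_mul, h1]
    field_simp
  have h := intervalIntegral.integral_comp_sub_left (a := 0) (b := 2 * Real.pi)
    (fun θ => deriv (circleMap 0 1) θ • F (circleMap 0 1 θ)) (2 * Real.pi)
  simp only [sub_self, sub_zero] at h
  rw [circleIntegral, circleIntegral, ← h]
  exact intervalIntegral.integral_congr fun θ _ => key θ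

lemma circleIntegral_eq_zero_of_differentiableOn {f : ℂ → ℂ}
    (hf : ∀ z ∈ closedBall (0 : ℂ) 1, DifferentiableAt ℂ f z) : ∮ z in C(0, 1), f z = 0 :=
  Complex.circleIntegral_eq_zero_of_differentiable_on_off_countable zero_le_one
    Set.countable_empty (fun z hz => (hf z hz).continuousAt.continuousWithinAt)
    (fun z hz => hf z (ball_subset_closedBall hz.1))

lemma circleIntegrable_inv_sub {α : ℂ} (h : ‖α‖ ≠ 1) :
    CircleIntegrable (fun z => (z - α)⁻¹) 0 1 := by
  refine ContinuousOn.circleIntegrable zero_le_one (ContinuousOn.inv₀ (by fun_prop) ?_)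
  intro z hz h0
  rw [sub_eq_zero] at h0
  subst h0
  exact h (by simpa using hz)

lemma circleIntegral_inv_sub_outside {α : ℂ} (h : 1 < ‖α‖) :
    ∮ z in C(0, 1), (z - α)⁻¹ = 0 := by
  refine circleIntegral_eq_zero_of_differentiableOn fun z hz => ?_
  have : z - α ≠ 0 := by
    intro h0
    rw [sub_eq_zero] at h0
    subst h0
    simp at hz
    linarith
  exact DifferentiableAt.inv (by fun_prop) this

lemma circleIntegral_sum_inv_sub (s : Multiset ℂ) (hs : ∀ α ∈ s, ‖α‖ ≠ 1) :
    CircleIntegrable (fun z => (s.map fun α => 1 / (z - α)).sum) 0 1 ∧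
    ∮ z in C(0, 1), (s.map fun α => 1 / (z - α)).sum =
      2 * Real.pi * Complex.I * (s.countP fun α => ‖α‖ < 1 : ℕ) := by
  induction s using Multiset.induction_on with
  | empty =>
    refine ⟨?_, ?_⟩ <;> simp [circleIntegral]
  | cons α s ih =>
    obtain ⟨h1, h2⟩ := ih fun β hβ => hs β (Multiset.mem_cons_of_mem hβ)
    have hα := hs α (Multiset.mem_cons_self α s)
    have h3 := circleIntegrable_inv_sub hα
    simp only [Multiset.map_cons, Multiset.sum_cons, one_div] at *
    refine ⟨h3.add h1, ?_⟩
    rw [circleIntegral.integral_add h3 h1, h2, Multiset.countP_cons]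
    split_ifs with hlt
    · rw [circleIntegral.integral_sub_inv_of_mem_ball (by simpa using hlt)]
      push_cast; ring
    · rw [circleIntegral_inv_sub_outside (lt_of_le_of_ne (not_lt.1 hlt) (Ne.symm hα))]
      simp

/-- Argument principle: p'/p is the sum of 1/(z - α) over the roots, so its integral counts the
roots in the open disc. -/
lemma Polynomial.eval_ne_zero_of_circleIntegral_eq_zero (p : Polynomial ℂ)
    (hp : ∀ z ∈ sphere (0 : ℂ) 1, p.eval z ≠ 0)
    (h0 : ∮ z in C(0, 1), p.derivative.eval z / p.eval z = 0) :
    ∀ z ∈ ball (0 : ℂ) 1, p.eval z ≠ 0 := by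
  intro z hz hz0
  have hp0 : p ≠ 0 := by
    rintro rfl
    exact hp 1 (by simp) (by simp)
  have hroots : ∀ α ∈ p.roots, ‖α‖ ≠ 1 := fun α hα h =>
    hp α (by simpa using h) ((Polynomial.mem_roots hp0).1 hα)
  have h1 := (circleIntegral_sum_inv_sub p.roots hroots).2
  rw [circleIntegral.integral_congr zero_le_one (g := fun z => p.derivative.eval z / p.eval z)
    (fun z hz => ((IsAlgClosed.splits p).eval_derivative_div_eval_of_ne_zero (hp z hz)).symm),
    h0] at h1
  have h2 : 0 < p.roots.countP fun α => ‖α‖ < 1 :=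
    Multiset.countP_pos.2 ⟨z, (Polynomial.mem_roots hp0).2 hz0, by simpa using hz⟩
  have h3 : (2 * Real.pi * Complex.I : ℂ) ≠ 0 := by simp [Real.pi_ne_zero]
  have := (mul_eq_zero.1 h1.symm).resolve_left h3
  rw [Nat.cast_eq_zero] at this
  omega

/-- Hurwitz' principle for a connected family of functions without zeros on the unit circle. -/
lemma forall_ne_zero_of_family {X : Type*} [TopologicalSpace X] [PreconnectedSpace X]
    (f : X → ℂ → ℂ) (hc : Continuous fun p : X × ℂ => f p.1 p.2)
    (hd : ∀ x, Differentiable ℂ (f x))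
    (hne : ∀ x, ∀ w ∈ sphere (0 : ℂ) 1, f x w ≠ 0) (x₀ : X)
    (h0 : ∀ w ∈ ball (0 : ℂ) 1, f x₀ w ≠ 0) :
    ∀ x, ∀ w ∈ closedBall (0 : ℂ) 1, f x w ≠ 0 := by
  set T : Set X := {x | ∀ w ∈ closedBall (0 : ℂ) 1, f x w ≠ 0} with hT
  have hx₀ : x₀ ∈ T := by
    intro w hw
    rcases (mem_closedBall.1 hw).lt_or_eq with h | h
    · exact h0 w h
    · exact hne x₀ w h
  have hopen : IsOpen T := by
    rw [isOpen_iff_mem_nhds]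
    intro x hx
    obtain ⟨u, v, hu, -, hxu, hv, huv⟩ := generalized_tube_lemma (isCompact_singleton (x := x))
      (isCompact_closedBall (0 : ℂ) 1) (isOpen_ne_fun hc (continuous_const (y := (0 : ℂ))))
      (by rintro ⟨y, w⟩ ⟨hy, hw⟩; obtain rfl : y = x := hy; exact hx w hw)
    filter_upwards [hu.mem_nhds (hxu rfl)] with y hy w hw
    exact huv (Set.mk_mem_prod hy (hv hw))
  -- Near `x` all members are bounded below by one δ on the circle. For a member without zeros in
  -- the disc the maximum principle for the reciprocal carries this bound inside, and there it
  -- passes to the limit.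
  have hclosed : IsClosed T := by
    rw [isClosed_iff_clusterPt]
    intro x hx
    obtain ⟨δ, hδ, hδ'⟩ : ∃ δ > 0, ∀ᶠ y in 𝓝 x, ∀ w ∈ sphere (0 : ℂ) 1, δ < ‖f y w‖ := by
      obtain ⟨w₀, hw₀, hmin⟩ := (isCompact_sphere (0 : ℂ) 1).exists_isMinOn ⟨1, by simp⟩
        ((hd x).continuous.norm.continuousOn)
      refine ⟨‖f x w₀‖ / 2, by have := norm_pos_iff.2 (hne x w₀ hw₀); positivity, ?_⟩
      obtain ⟨u, v, hu, -, hxu, hv, huv⟩ := generalized_tube_lemma (isCompact_singleton (x := x))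
        (isCompact_sphere (0 : ℂ) 1) (isOpen_lt (continuous_const (y := ‖f x w₀‖ / 2)) hc.norm)
        (by
          rintro ⟨y, w⟩ ⟨hy, hw⟩
          obtain rfl : y = x := hy
          have h1 := hmin hw
          have h2 := norm_pos_iff.2 (hne y w₀ hw₀)
          simp only [mem_ofPred_eq] at h1 ⊢
          linarith)
      filter_upwards [hu.mem_nhds (hxu rfl)] with y hy w hw
      exact huv (Set.mk_mem_prod hy (hv hw))
    have hbound : ∀ y ∈ T, (∀ w ∈ sphere (0 : ℂ) 1, δ < ‖f y w‖) →
        ∀ w ∈ closedBall (0 : ℂ) 1, δ ≤ ‖f y w‖ := by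
      intro y hy hδy w hw
      have hdiff : DiffContOnCl ℂ (fun w => (f y w)⁻¹) (ball 0 1) := by
        refine DifferentiableOn.diffContOnCl fun z hz => ?_
        rw [closure_ball _ one_ne_zero] at hz
        exact ((hd y z).inv (hy z hz)).differentiableWithinAt
      have := Complex.norm_le_of_forall_mem_frontier_norm_le isBounded_ball hdiff (C := δ⁻¹)
        (fun z hz => by
          rw [frontier_ball _ one_ne_zero] at hz
          rw [norm_inv]
          exact inv_anti₀ hδ (hδy z hz).le)
        (by rwa [closure_ball _ one_ne_zero])
      rw [norm_inv] at this
      exact (inv_le_inv₀ (norm_pos_iff.2 (hy w hw)) hδ).1 this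
    intro w hw hfw
    have h1 : ∀ᶠ y in 𝓝 x, ‖f y w‖ < δ := by
      have hcw : Continuous fun y => ‖f y w‖ := (hc.comp (Continuous.prodMk_left w)).norm
      exact hcw.continuousAt.eventually_lt_const (by simpa [hfw] using hδ)
    obtain ⟨y, hyT, hy1, hy2⟩ :=
      ((clusterPt_principal_iff_frequently.1 hx).and_eventually (hδ'.and h1)).exists
    exact absurd (hbound y hyT hy1 w hw) (not_le.2 hy2)
  have := (isClopen_iff.1 ⟨hclosed, hopen⟩).resolve_left (Set.nonempty_iff_ne_empty.1 ⟨x₀, hx₀⟩)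
  intro x
  have hx : x ∈ T := this ▸ mem_univ x
  exact hx

/-! ### The secant function and univalence in the exterior of the disc -/

/-- In terms of `u = 1 / w` and `v = 1 / ω`, this is the difference quotient
`(h(w) - h(ω)) / (w - ω)` of `h(w) = r w + a(1 / w)`. -/
def secant (r : ℝ) (a : Polynomial ℂ) (u v : ℂ) : ℂ :=
  r - u * v * ∑ j ∈ Finset.range (a.natDegree + 1),
    a.coeff j * ∑ i ∈ Finset.range j, u ^ i * v ^ (j - 1 - i)

lemma curveMap_inv (r : ℝ) (a : Polynomial ℂ) (u : ℂ) :
    curveMap r a u⁻¹ = r * u⁻¹ + a.eval u := by simp [curveMap]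

lemma secant_comm (r : ℝ) (a : Polynomial ℂ) (u v : ℂ) : secant r a u v = secant r a v u := by
  unfold secant
  rw [mul_comm u v]
  congr 2
  refine Finset.sum_congr rfl fun j _ => ?_
  congr 1
  rw [← Finset.sum_range_reflect]
  refine Finset.sum_congr rfl fun i hi => ?_
  rw [Finset.mem_range] at hi
  rw [mul_comm]
  congr 2
  omega

lemma secant_self (r : ℝ) (a : Polynomial ℂ) (u : ℂ) :
    secant r a u u = r - u ^ 2 * a.derivative.eval u := by
  unfold secant
  rw [Polynomial.derivative_eval, Polynomial.sum_over_range' _ _ (a.natDegree + 1) (by omega)]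
  · congr 1
    rw [sq]
    congr 1
    refine Finset.sum_congr rfl fun j _ => ?_
    rw [geom_sum₂_self]
    ring
  · simp

lemma curveMap_sub_curveMap (r : ℝ) (a : Polynomial ℂ) {u v : ℂ} (hu : u ≠ 0) (hv : v ≠ 0) :
    curveMap r a u⁻¹ - curveMap r a v⁻¹ = (u⁻¹ - v⁻¹) * secant r a u v := by
  have h1 : a.eval u - a.eval v = (u - v) * ∑ j ∈ Finset.range (a.natDegree + 1),
      a.coeff j * ∑ i ∈ Finset.range j, u ^ i * v ^ (j - 1 - i) := by
    rw [Polynomial.eval_eq_sum_range, Polynomial.eval_eq_sum_range, ← Finset.sum_sub_distrib,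
      Finset.mul_sum]
    refine Finset.sum_congr rfl fun j _ => ?_
    have := geom_sum₂_mul u v j
    linear_combination (-a.coeff j) * this
  rw [curveMap_inv, curveMap_inv]
  unfold secant
  have h2 : (u⁻¹ - v⁻¹) * (u * v) = v - u := by field_simp
  linear_combination h1 + (∑ j ∈ Finset.range (a.natDegree + 1),
      a.coeff j * ∑ i ∈ Finset.range j, u ^ i * v ^ (j - 1 - i)) * h2

lemma hasDerivAt_curveMap (r : ℝ) (a : Polynomial ℂ) {w : ℂ} (hw : w ≠ 0) :
    HasDerivAt (curveMap r a) (secant r a w⁻¹ w⁻¹) w := by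
  have h1 : HasDerivAt (fun w : ℂ => a.eval w⁻¹) _ w :=
    (a.hasDerivAt w⁻¹).comp w (hasDerivAt_inv hw)
  refine (((hasDerivAt_id w).const_mul (r : ℂ)).add h1).congr_deriv ?_
  rw [secant_self]
  ring

lemma deriv_curveMap (r : ℝ) (a : Polynomial ℂ) {w : ℂ} (hw : w ≠ 0) :
    deriv (curveMap r a) w = secant r a w⁻¹ w⁻¹ := (hasDerivAt_curveMap r a hw).deriv

lemma continuous_secant (r : ℝ) (a : Polynomial ℂ) :
    Continuous fun p : ℂ × ℂ => secant r a p.1 p.2 := by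
  unfold secant
  fun_prop

lemma differentiable_secant (r : ℝ) (a : Polynomial ℂ) (f g : ℂ → ℂ) (hf : Differentiable ℂ f)
    (hg : Differentiable ℂ g) : Differentiable ℂ fun z => secant r a (f z) (g z) := by
  unfold secant
  fun_prop

/-- The difference quotients and the derivative of `h` do not vanish on the closed exterior of the
unit disc. -/
def IsExteriorUnivalent (r : ℝ) (a : Polynomial ℂ) : Prop :=
  ∀ u ∈ closedBall (0 : ℂ) 1, ∀ v ∈ closedBall (0 : ℂ) 1, secant r a u v ≠ 0

lemma secant_zero_right (r : ℝ) (a : Polynomial ℂ) (u : ℂ) : secant r a u 0 = r := by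
  simp [secant]

namespace PolynomialCurve

variable (γ : PolynomialCurve)

lemma secant_ne_zero_sphere {u v : ℂ} (hu : u ∈ sphere (0 : ℂ) 1) (hv : v ∈ sphere (0 : ℂ) 1) :
    secant γ.r γ.a u v ≠ 0 := by
  have hu1 : ‖u‖ = 1 := by simpa using hu
  have hv1 : ‖v‖ = 1 := by simpa using hv
  have hu0 : u ≠ 0 := by rintro rfl; simp at hu1
  have hv0 : v ≠ 0 := by rintro rfl; simp at hv1
  have hui : u⁻¹ ∈ sphere (0 : ℂ) 1 := by simp [hu1]
  have hvi : v⁻¹ ∈ sphere (0 : ℂ) 1 := by simp [hv1]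
  by_cases huv : u = v
  · subst huv
    have := γ.deriv_ne_zero _ hui
    rwa [deriv_curveMap _ _ (inv_ne_zero hu0), inv_inv] at this
  · intro h
    have h1 := curveMap_sub_curveMap γ.r γ.a hu0 hv0
    rw [h, mul_zero, sub_eq_zero] at h1
    exact huv (inv_injective (γ.injOn hui hvi h1))

lemma tangent_eq {w : ℂ} (hw : w ≠ 0) :
    γ.tangent w = Complex.I * w * secant γ.r γ.a w⁻¹ w⁻¹ := by
  rw [tangent, h, deriv_curveMap _ _ hw]

/-- The polynomial `r - X² a'`. -/
def derivPoly (r : ℝ) (a : Polynomial ℂ) : Polynomial ℂ :=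
  Polynomial.C (r : ℂ) - Polynomial.X ^ 2 * a.derivative

lemma eval_derivPoly (r : ℝ) (a : Polynomial ℂ) (u : ℂ) :
    (derivPoly r a).eval u = secant r a u u := by
  simp [derivPoly, secant_self]

lemma deriv_tangent_div {w : ℂ} (hw : w ∈ sphere (0 : ℂ) 1) :
    deriv γ.tangent w / γ.tangent w = w⁻¹ - (w ^ 2)⁻¹ *
      ((derivPoly γ.r γ.a).derivative.eval w⁻¹ / (derivPoly γ.r γ.a).eval w⁻¹) := by
  have hw1 : ‖w‖ = 1 := by simpa using hw
  have hw0 : w ≠ 0 := by rintro rfl; simp at hw1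
  have hs : secant γ.r γ.a w⁻¹ w⁻¹ ≠ 0 :=
    γ.secant_ne_zero_sphere (by simp [hw1]) (by simp [hw1])
  have hev : γ.tangent =ᶠ[𝓝 w] fun w => Complex.I * w * (derivPoly γ.r γ.a).eval w⁻¹ := by
    filter_upwards [isOpen_ne.mem_nhds hw0] with z hz
    rw [γ.tangent_eq hz, eval_derivPoly]
  have h1 : HasDerivAt (fun w : ℂ => (derivPoly γ.r γ.a).eval w⁻¹) _ w :=
    ((derivPoly γ.r γ.a).hasDerivAt w⁻¹).comp w (hasDerivAt_inv hw0)
  have h2 : HasDerivAt (fun w => Complex.I * w * (derivPoly γ.r γ.a).eval w⁻¹) _ w :=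
    ((hasDerivAt_id w).const_mul Complex.I).mul h1
  rw [hev.deriv_eq, h2.deriv, hev.self_of_nhds]
  simp only [eval_derivPoly, id, mul_one]
  have hI := Complex.I_ne_zero
  generalize secant γ.r γ.a w⁻¹ w⁻¹ = s at hs ⊢
  generalize Polynomial.eval w⁻¹ (Polynomial.derivative (derivPoly γ.r γ.a)) = d
  field_simp
  ring

/-- The factor w of the tangent contributes 2πi; the remaining factor is a polynomial in u = 1/w,
and inversion changes the sign of its winding. Turning number one therefore means winding number
zero for that polynomial. -/
lemma circleIntegral_deriv_tangent_div :
    ∮ w in C(0, 1), deriv γ.tangent w / γ.tangent w = 2 * Real.pi * Complex.I -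
      ∮ u in C(0, 1), (derivPoly γ.r γ.a).derivative.eval u / (derivPoly γ.r γ.a).eval u := by
  have hne : ∀ w ∈ sphere (0 : ℂ) 1, w ≠ 0 := by
    rintro w hw rfl; simp at hw
  rw [circleIntegral.integral_congr zero_le_one fun w hw => γ.deriv_tangent_div hw]
  rw [circleIntegral.integral_sub, circleIntegral_inv_comp (fun w => (w ^ 2)⁻¹ * _)]
  · have := circleIntegral.integral_sub_inv_of_mem_ball (c := 0) (w := 0) (R := 1) (by simp)
    simp only [sub_zero] at this
    rw [this]
    congr 1
    refine circleIntegral.integral_congr zero_le_one fun u hu => ?_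
    have := hne u hu
    simp only [inv_inv]
    field_simp
  · exact ContinuousOn.circleIntegrable zero_le_one (continuousOn_id.inv₀ hne)
  · refine ContinuousOn.circleIntegrable zero_le_one ?_
    have hinv : ContinuousOn (fun w : ℂ => w⁻¹) (sphere 0 1) := continuousOn_id.inv₀ hne
    refine ((continuousOn_id.pow 2).inv₀ fun w hw => pow_ne_zero 2 (hne w hw)).mul (.div ?_ ?_ ?_)
    · exact (Polynomial.continuous _).comp_continuousOn hinv
    · exact (Polynomial.continuous _).comp_continuousOn hinv
    · intro w hw
      have hw1 : ‖w‖ = 1 := by simpa using hw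
      rw [eval_derivPoly]
      exact γ.secant_ne_zero_sphere (by simp [hw1]) (by simp [hw1])

/-- The embedding excludes zeros of the secant function on the torus |u| = |v| = 1, and the
orientation excludes zeros on the diagonal. Hurwitz' principle, used twice, fills the bidisc. -/
lemma isExteriorUnivalent (hγ : γ.PositivelyOriented) : IsExteriorUnivalent γ.r γ.a := by
  have hpi : (2 * Real.pi * Complex.I : ℂ) ≠ 0 := by simp [Real.pi_ne_zero]
  have h0 : ∮ u in C(0, 1), (derivPoly γ.r γ.a).derivative.eval u / (derivPoly γ.r γ.a).eval u
      = 0 := by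
    rw [PositivelyOriented, circleIntegral_deriv_tangent_div, mul_sub, inv_mul_cancel₀ hpi] at hγ
    simpa [hpi, Real.pi_ne_zero] using hγ
  have hr : (γ.r : ℂ) ≠ 0 := by exact_mod_cast γ.r_pos.ne'
  have hdiag := Polynomial.eval_ne_zero_of_circleIntegral_eq_zero _ (fun z hz => by
    rw [eval_derivPoly]; exact γ.secant_ne_zero_sphere hz hz) h0
  have hsph : PreconnectedSpace (sphere (0 : ℂ) 1) :=
    isPreconnected_iff_preconnectedSpace.1 (isPreconnected_sphere (by simp) 0 1)
  have hball : PreconnectedSpace (closedBall (0 : ℂ) 1) :=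
    isPreconnected_iff_preconnectedSpace.1 (convex_closedBall 0 1).isPreconnected
  have hcont1 : Continuous fun p : sphere (0 : ℂ) 1 × ℂ =>
      secant γ.r γ.a ((p.1 : ℂ) * p.2) p.2 :=
    (continuous_secant γ.r γ.a).comp (f := fun p : sphere (0 : ℂ) 1 × ℂ => ((p.1 : ℂ) * p.2, p.2))
      (by fun_prop)
  have hcont2 : Continuous fun p : closedBall (0 : ℂ) 1 × ℂ =>
      secant γ.r γ.a (p.2 * (p.1 : ℂ)) p.1 :=
    (continuous_secant γ.r γ.a).comp
      (f := fun p : closedBall (0 : ℂ) 1 × ℂ => (p.2 * (p.1 : ℂ), (p.1 : ℂ))) (by fun_prop)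
  -- Rotation: the diagonal is the member u = 1 of the family v ↦ `secant` (u v) v with |u| = 1.
  have step1 := forall_ne_zero_of_family (X := sphere (0 : ℂ) 1)
    (fun u v => secant γ.r γ.a (u * v) v) hcont1
    (fun u => differentiable_secant _ _ _ _ (by fun_prop) (by fun_prop))
    (fun u v hv => γ.secant_ne_zero_sphere (by
      have h2 : ‖v‖ = 1 := by simpa using hv
      simp [h2]) hv)
    ⟨1, by simp⟩ (fun v hv => by
      have := hdiag v hv
      rw [eval_derivPoly] at this
      simpa using this)
  -- The roles change: `v` is now the parameter, the previous step controls |u| = 1, and for `v = 0`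
  -- the function is the constant r.
  have step2 := forall_ne_zero_of_family (X := closedBall (0 : ℂ) 1)
    (fun v u => secant γ.r γ.a (u * v) v) hcont2
    (fun v => differentiable_secant _ _ _ _ (by fun_prop) (by fun_prop))
    (fun v u hu => step1 ⟨u, hu⟩ v v.2)
    ⟨0, by simp⟩ (fun u hu => by simp [secant_zero_right, γ.r_pos.ne'])
  have step3 : ∀ u ∈ closedBall (0 : ℂ) 1, ∀ v ∈ closedBall (0 : ℂ) 1, ‖u‖ ≤ ‖v‖ →
      secant γ.r γ.a u v ≠ 0 := by
    intro u hu v hv huv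
    by_cases hv0 : v = 0
    · subst hv0
      rwa [secant_zero_right]
    · have := step2 ⟨v, hv⟩ (u / v) (by
        rw [mem_closedBall_zero_iff, norm_div]
        exact div_le_one_of_le₀ huv (norm_nonneg _))
      simpa [div_mul_cancel₀ _ hv0] using this
  intro u hu v hv
  rcases le_total ‖u‖ ‖v‖ with h | h
  · exact step3 u hu v hv h
  · rw [secant_comm]
    exact step3 v hv u hu h

lemma positivelyOriented_of_isExteriorUnivalent (hγ : IsExteriorUnivalent γ.r γ.a) :
    γ.PositivelyOriented := by
  have hpi : (2 * Real.pi * Complex.I : ℂ) ≠ 0 := by simp [Real.pi_ne_zero]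
  rw [PositivelyOriented, circleIntegral_deriv_tangent_div,
    circleIntegral_eq_zero_of_differentiableOn, sub_zero, inv_mul_cancel₀ hpi]
  intro z hz
  refine DifferentiableAt.div (Polynomial.differentiableAt _) (Polynomial.differentiableAt _) ?_
  rw [eval_derivPoly]
  exact hγ z hz z hz

end PolynomialCurve

/-! ### The interior domain of a univalent polynomial curve -/

lemma isPreconnected_norm_gt (R : ℝ) (hR : 0 < R) : IsPreconnected {z : ℂ | R < ‖z‖} := by
  have : {z : ℂ | R < ‖z‖} = Complex.exp '' {z : ℂ | Real.log R < z.re} := by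
    ext z
    constructor
    · intro hz
      have hz0 : z ≠ 0 := by
        rintro rfl
        simp only [mem_ofPred_eq, norm_zero] at hz
        linarith
      refine ⟨Complex.log z, ?_, Complex.exp_log hz0⟩
      simp only [mem_ofPred_eq, Complex.log_re]
      exact Real.log_lt_log hR hz
    · rintro ⟨w, hw, rfl⟩
      simp only [mem_ofPred_eq, Complex.norm_exp] at hw ⊢
      exact (Real.log_lt_iff_lt_exp hR).1 hw
  rw [this]
  exact (convex_halfSpace_re_gt _).isPreconnected.image _ Complex.continuous_exp.continuousOn

lemma continuousOn_curveMap (r : ℝ) (a : Polynomial ℂ) :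
    ContinuousOn (curveMap r a) {w | 1 ≤ ‖w‖} := by
  intro w hw
  have hw0 : w ≠ 0 := by
    rintro rfl
    simp at hw
    linarith
  exact (hasDerivAt_curveMap r a hw0).continuousAt.continuousWithinAt

lemma exists_norm_eval_inv_le (a : Polynomial ℂ) :
    ∃ M : ℝ, 0 ≤ M ∧ ∀ w : ℂ, 1 ≤ ‖w‖ → ‖a.eval w⁻¹‖ ≤ M := by
  obtain ⟨M, hM⟩ := (isCompact_closedBall (0 : ℂ) 1).exists_bound_of_continuousOn
    (f := fun u => a.eval u) a.continuous.continuousOn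
  refine ⟨M, (norm_nonneg _).trans (hM 0 (by simp)), fun w hw => hM _ ?_⟩
  rw [mem_closedBall_zero_iff, norm_inv]
  exact inv_le_one_of_one_le₀ hw

lemma ne_zero_of_one_le_norm {w : ℂ} (hw : 1 ≤ ‖w‖) : w ≠ 0 := by
  rintro rfl
  simp at hw
  linarith

namespace IsExteriorUnivalent

variable {r : ℝ} {a : Polynomial ℂ}

lemma injOn (hU : IsExteriorUnivalent r a) : InjOn (curveMap r a) {w | 1 ≤ ‖w‖} := by
  intro w hw z hz hwz
  have h1 := curveMap_sub_curveMap r a (inv_ne_zero (ne_zero_of_one_le_norm hw))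
    (inv_ne_zero (ne_zero_of_one_le_norm hz))
  rw [inv_inv, inv_inv, hwz, sub_self, eq_comm, mul_eq_zero] at h1
  refine sub_eq_zero.1 (h1.resolve_right (hU _ ?_ _ ?_))
  all_goals
    rw [mem_closedBall_zero_iff, norm_inv]
    exact inv_le_one_of_one_le₀ ‹_›

lemma secant_inv_ne_zero (hU : IsExteriorUnivalent r a) {w : ℂ} (hw : 1 ≤ ‖w‖) : secant r a w⁻¹ w⁻¹ ≠ 0 := by
  have : w⁻¹ ∈ closedBall (0 : ℂ) 1 := by
    rw [mem_closedBall_zero_iff, norm_inv]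
    exact inv_le_one_of_one_le₀ hw
  exact hU _ this _ this

lemma isOpen_image_ext (hU : IsExteriorUnivalent r a) :
    IsOpen (curveMap r a '' {w | 1 < ‖w‖}) := by
  rw [isOpen_iff_mem_nhds]
  rintro _ ⟨w, hw, rfl⟩
  have hw1 : 1 ≤ ‖w‖ := le_of_lt hw
  have hw0 := ne_zero_of_one_le_norm hw1
  have han : AnalyticAt ℂ (curveMap r a) w := by
    unfold curveMap
    have : AnalyticAt ℂ (fun w : ℂ => w⁻¹) w := analyticAt_inv hw0
    exact (analyticAt_const.mul analyticAt_id).add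
      (((Polynomial.differentiable a).analyticAt _).comp this)
  have hstrict : HasStrictDerivAt (curveMap r a) (secant r a w⁻¹ w⁻¹) w := by
    rw [← deriv_curveMap r a hw0]
    exact han.hasStrictDerivAt
  rw [← hstrict.map_nhds_eq (hU.secant_inv_ne_zero hw1)]
  exact image_mem_map ((isOpen_lt continuous_const continuous_norm).mem_nhds hw)

end IsExteriorUnivalent

lemma norm_curveMap_ge {r : ℝ} (hr : 0 < r) {a : Polynomial ℂ} {M : ℝ}
    (hM : ∀ w : ℂ, 1 ≤ ‖w‖ → ‖a.eval w⁻¹‖ ≤ M) {w : ℂ} (hw : 1 ≤ ‖w‖) :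
    r * ‖w‖ - M ≤ ‖curveMap r a w‖ := by
  have h1 := norm_sub_le_norm_add ((r : ℂ) * w) (a.eval w⁻¹)
  rw [norm_mul, Complex.norm_real, Real.norm_of_nonneg hr.le] at h1
  have := hM w hw
  unfold curveMap
  linarith

/-- Properness: |h(w)| ≥ r|w| - M, so the part of the image near a given point comes from a compact
annulus. -/
lemma isClosed_image_curveMap {r : ℝ} (hr : 0 < r) (a : Polynomial ℂ) :
    IsClosed (curveMap r a '' {w | 1 ≤ ‖w‖}) := by
  obtain ⟨M, -, hM⟩ := exists_norm_eval_inv_le a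
  refine isClosed_of_closure_subset fun z hz => ?_
  set R := (‖z‖ + 1 + M) / r
  have hK : IsCompact (curveMap r a '' ({w | 1 ≤ ‖w‖} ∩ closedBall 0 R)) := by
    refine IsCompact.image_of_continuousOn ?_ ((continuousOn_curveMap r a).mono inter_subset_left)
    exact (isCompact_closedBall _ _).inter_left (isClosed_le continuous_const continuous_norm)
  have hsub : ball z 1 ∩ curveMap r a '' {w | 1 ≤ ‖w‖} ⊆
      curveMap r a '' ({w | 1 ≤ ‖w‖} ∩ closedBall 0 R) := by
    rintro _ ⟨hb, w, hw, rfl⟩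
    refine ⟨w, ⟨hw, ?_⟩, rfl⟩
    have h1 := norm_curveMap_ge hr hM hw
    have h2 : ‖curveMap r a w‖ < ‖z‖ + 1 := by
      have := norm_sub_norm_le (curveMap r a w) z
      rw [mem_ball, dist_eq_norm] at hb
      linarith
    rw [mem_closedBall_zero_iff, le_div_iff₀ hr]
    linarith
  have h3 : z ∈ closure (ball z 1 ∩ curveMap r a '' {w | 1 ≤ ‖w‖}) :=
    isOpen_ball.inter_closure ⟨mem_ball_self one_pos, hz⟩
  have h4 := closure_mono hsub h3
  rw [hK.isClosed.closure_eq] at h4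
  exact image_mono inter_subset_left h4

namespace PolynomialCurve

variable (γ : PolynomialCurve)

lemma sphere_subset : sphere (0 : ℂ) 1 ⊆ {w | 1 ≤ ‖w‖} := by
  intro w hw
  simp only [mem_sphere_iff_norm, sub_zero] at hw
  simp [hw]

lemma isCompact_image : IsCompact γ.image :=
  (isCompact_sphere 0 1).image_of_continuousOn
    ((continuousOn_curveMap γ.r γ.a).mono sphere_subset)

/-- The exterior domain of a univalent polynomial curve. -/
def exteriorDomain : Set ℂ := γ.h '' {w | 1 < ‖w‖}

lemma image_curveMap_eq : curveMap γ.r γ.a '' {w | 1 ≤ ‖w‖} = γ.image ∪ γ.exteriorDomain := by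
  rw [image, exteriorDomain, ← image_union]
  congr 1
  ext w
  simp [le_iff_eq_or_lt, eq_comm]

/-- Off the curve the plane is the disjoint union of two open sets, the exterior image and the
complement of the closed image. A connected neighbourhood of infinity that avoids the curve meets
the first one, hence lies in it. -/
lemma exists_exteriorDomain_of_gt (hU : IsExteriorUnivalent γ.r γ.a) :
    ∃ R : ℝ, 0 < R ∧ {z | R < ‖z‖} ⊆ γ.exteriorDomain := by
  obtain ⟨M, hM0, hM⟩ := exists_norm_eval_inv_le γ.a
  have hr := γ.r_pos
  refine ⟨γ.r + M, by linarith, ?_⟩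
  refine IsPreconnected.subset_left_of_subset_union (v := (curveMap γ.r γ.a '' {w | 1 ≤ ‖w‖})ᶜ)
    hU.isOpen_image_ext (isClosed_image_curveMap hr _).isOpen_compl ?_ ?_ ?_
    (isPreconnected_norm_gt _ (by linarith))
  · rw [image_curveMap_eq]
    exact disjoint_compl_right.mono_left subset_union_right
  · intro z hz
    by_cases h : z ∈ curveMap γ.r γ.a '' {w | 1 ≤ ‖w‖}
    · left
      rw [image_curveMap_eq] at h
      refine h.resolve_left ?_
      rintro ⟨w, hw, rfl⟩
      have hw1 : ‖w‖ = 1 := by simpa using hw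
      have h1 := norm_add_le ((γ.r : ℂ) * w) (γ.a.eval w⁻¹)
      rw [norm_mul, Complex.norm_real, Real.norm_of_nonneg hr.le, hw1] at h1
      have h2 := hM w hw1.ge
      have h3 : γ.r + M < ‖γ.h w‖ := hz
      have h4 : γ.h w = (γ.r : ℂ) * w + γ.a.eval w⁻¹ := rfl
      rw [h4] at h3
      linarith
    · exact Or.inr h
  · set t : ℝ := 2 + 2 * M / γ.r
    have ht : 1 < t := by
      have : 0 ≤ 2 * M / γ.r := by positivity
      simp only [t]
      linarith
    have htn : ‖(t : ℂ)‖ = t := by rw [Complex.norm_real, Real.norm_of_nonneg (by linarith)]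
    refine ⟨curveMap γ.r γ.a t, ?_, t, by rw [mem_ofPred_eq, htn]; exact ht, rfl⟩
    have h1 := norm_curveMap_ge hr hM (w := t) (by rw [htn]; exact ht.le)
    rw [htn] at h1
    have h2 : γ.r * t = 2 * γ.r + 2 * M := by
      simp only [t]
      field_simp
    simp only [mem_ofPred_eq]
    linarith

lemma isPreconnected_exteriorDomain : IsPreconnected γ.exteriorDomain :=
  (isPreconnected_norm_gt 1 one_pos).image _ ((continuousOn_curveMap γ.r γ.a).mono
    fun w (hw : 1 < ‖w‖) => hw.le)

lemma disjoint_image_exteriorDomain (hU : IsExteriorUnivalent γ.r γ.a) :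
    Disjoint γ.image γ.exteriorDomain := by
  rw [Set.disjoint_left]
  rintro _ ⟨w, hw, rfl⟩ ⟨z, hz, hzw⟩
  have hw1 : ‖w‖ = 1 := by simpa using hw
  have hz1 : 1 < ‖z‖ := hz
  have := hU.injOn hz1.le hw1.ge hzw
  subst this
  linarith

/-- The exterior image is connected and contains a neighbourhood of infinity, so its points lie in
an unbounded component. The component of any other point off the curve cannot cross into it and
stays bounded. -/
lemma interiorDomain_eq (hU : IsExteriorUnivalent γ.r γ.a) :
    γ.interiorDomain = (γ.image ∪ γ.exteriorDomain)ᶜ := by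
  obtain ⟨R, hR0, hR⟩ := γ.exists_exteriorDomain_of_gt hU
  ext z
  simp only [interiorDomain, mem_ofPred_eq, mem_compl_iff, mem_union, not_or]
  refine and_congr_right fun hz => ⟨fun hb hext => ?_, fun hext => ?_⟩
  · have h1 : γ.exteriorDomain ⊆ connectedComponentIn γ.imageᶜ z :=
      γ.isPreconnected_exteriorDomain.subset_connectedComponentIn hext
        (subset_compl_iff_disjoint_left.2 (γ.disjoint_image_exteriorDomain hU))
    obtain ⟨M, hM⟩ := ((hb.subset h1).subset hR).exists_norm_le
    have h2 : ‖((max R M + 1 : ℝ) : ℂ)‖ = max R M + 1 := by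
      rw [Complex.norm_real, Real.norm_of_nonneg]
      have := le_max_left R M
      linarith
    have := hM ((max R M + 1 : ℝ) : ℂ) (by
      simp only [mem_ofPred_eq, h2]
      have := le_max_left R M
      linarith)
    rw [h2] at this
    have := le_max_right R M
    linarith
  · refine (isBounded_closedBall (x := (0 : ℂ)) (r := R)).subset ?_
    have h1 : connectedComponentIn γ.imageᶜ z ⊆ (curveMap γ.r γ.a '' {w | 1 ≤ ‖w‖})ᶜ := by
      refine IsPreconnected.subset_right_of_subset_union (u := γ.exteriorDomain)
        hU.isOpen_image_ext (isClosed_image_curveMap γ.r_pos _).isOpen_compl ?_ ?_ ?_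
        isPreconnected_connectedComponentIn
      · rw [image_curveMap_eq]
        exact disjoint_compl_right.mono_left subset_union_right
      · intro y hy
        have hy' := connectedComponentIn_subset _ _ hy
        by_cases h : y ∈ γ.exteriorDomain
        · exact Or.inl h
        · right
          rw [image_curveMap_eq]
          simpa [h] using hy'
      · refine ⟨z, mem_connectedComponentIn hz, ?_⟩
        rw [image_curveMap_eq]
        simp [hz, hext]
    intro y hy
    by_contra hyR
    have h2 := h1 hy
    rw [image_curveMap_eq] at h2
    exact h2 (Or.inr (hR (by simpa using hyR)))

lemma isOpen_interiorDomain (hU : IsExteriorUnivalent γ.r γ.a) : IsOpen γ.interiorDomain := by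
  rw [γ.interiorDomain_eq hU, ← image_curveMap_eq]
  exact (isClosed_image_curveMap γ.r_pos _).isOpen_compl

lemma isBounded_interiorDomain (hU : IsExteriorUnivalent γ.r γ.a) :
    Bornology.IsBounded γ.interiorDomain := by
  obtain ⟨R, -, hR⟩ := γ.exists_exteriorDomain_of_gt hU
  refine (isBounded_closedBall (x := (0 : ℂ)) (r := R)).subset fun z hz => ?_
  rw [γ.interiorDomain_eq hU] at hz
  by_contra h
  exact hz (Or.inr (hR (by simpa using h)))

lemma closure_interiorDomain_subset (hU : IsExteriorUnivalent γ.r γ.a) :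
    closure γ.interiorDomain ⊆ γ.interiorDomain ∪ γ.image := by
  have h1 : closure γ.interiorDomain ⊆ γ.exteriorDomainᶜ := by
    refine closure_minimal ?_ hU.isOpen_image_ext.isClosed_compl
    rw [γ.interiorDomain_eq hU]
    exact compl_subset_compl.2 subset_union_right
  intro z hz
  by_cases h : z ∈ γ.image
  · exact Or.inr h
  · left
    rw [γ.interiorDomain_eq hU]
    simp only [mem_compl_iff, mem_union, not_or]
    exact ⟨h, h1 hz⟩

end PolynomialCurve

/-! ### Green's formula -/

/-- Twice the Wirtinger derivative `∂ψ/∂z̄`. -/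
def dbar (ψ : ℂ → ℂ) (z : ℂ) : ℂ := fderiv ℝ ψ z 1 + Complex.I * fderiv ℝ ψ z Complex.I

lemma continuous_dbar {ψ : ℂ → ℂ} (hψ : ContDiff ℝ 1 ψ) : Continuous (dbar ψ) := by
  have h := hψ.continuous_fderiv one_ne_zero
  unfold dbar
  fun_prop

lemma dbar_eq_zero_of_notMem_tsupport {ψ : ℂ → ℂ} {z : ℂ} (hz : z ∉ tsupport ψ) :
    dbar ψ z = 0 := by
  have : fderiv ℝ ψ z = 0 := by
    by_contra h
    exact hz (support_fderiv_subset ℝ h)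
  simp [dbar, this]

lemma hasCompactSupport_dbar {ψ : ℂ → ℂ} (hc : HasCompactSupport ψ) :
    HasCompactSupport (dbar ψ) :=
  HasCompactSupport.intro hc fun _ hz => dbar_eq_zero_of_notMem_tsupport hz

lemma integral_fderiv_apply_eq_zero {ψ : ℂ → ℂ} (hψ : ContDiff ℝ 1 ψ)
    (hc : HasCompactSupport ψ) (v : ℂ) : ∫ z, fderiv ℝ ψ z v = 0 := by
  have h1 : Integrable fun z => fderiv ℝ ψ z v :=
    ((hψ.continuous_fderiv one_ne_zero).clm_apply continuous_const).integrable_of_hasCompactSupport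
      ((hc.fderiv ℝ).comp_left (g := fun L : ℂ →L[ℝ] ℂ => L v) (by simp))
  have h2 : Integrable ψ := hψ.continuous.integrable_of_hasCompactSupport hc
  have := integral_mul_fderiv_eq_neg_fderiv_mul_of_integrable (μ := volume) (f := fun _ : ℂ => (1 : ℂ))
    (g := ψ) (v := v) (by simp) (by simpa using h1) (by simpa using h2)
    (fun _ _ => differentiableAt_const _) (fun x _ => hψ.differentiable one_ne_zero x)
  simpa using this

lemma integral_dbar_eq_zero {ψ : ℂ → ℂ} (hψ : ContDiff ℝ 1 ψ) (hc : HasCompactSupport ψ) :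
    ∫ z, dbar ψ z = 0 := by
  have h1 : ∀ v : ℂ, Integrable fun z => fderiv ℝ ψ z v := fun v =>
    ((hψ.continuous_fderiv one_ne_zero).clm_apply continuous_const).integrable_of_hasCompactSupport
      ((hc.fderiv ℝ).comp_left (g := fun L : ℂ →L[ℝ] ℂ => L v) (by simp))
  unfold dbar
  rw [integral_add (h1 _) ((h1 _).const_mul _), integral_const_mul,
    integral_fderiv_apply_eq_zero hψ hc, integral_fderiv_apply_eq_zero hψ hc]
  simp

/-- The curve map in the logarithmic coordinate `w = exp ζ`. -/
def logCurve (r : ℝ) (a : Polynomial ℂ) (ζ : ℂ) : ℂ :=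
  r * Complex.exp ζ + a.eval (Complex.exp (-ζ))

/-- The derivative of `logCurve`. -/
def logCurveDeriv (r : ℝ) (a : Polynomial ℂ) (ζ : ℂ) : ℂ :=
  r * Complex.exp ζ - a.derivative.eval (Complex.exp (-ζ)) * Complex.exp (-ζ)

lemma logCurve_eq (r : ℝ) (a : Polynomial ℂ) (ζ : ℂ) :
    logCurve r a ζ = curveMap r a (Complex.exp ζ) := by
  simp [logCurve, curveMap, Complex.exp_neg]

lemma logCurveDeriv_eq (r : ℝ) (a : Polynomial ℂ) (ζ : ℂ) :
    logCurveDeriv r a ζ = deriv (curveMap r a) (Complex.exp ζ) * Complex.exp ζ := by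
  rw [deriv_curveMap _ _ (Complex.exp_ne_zero ζ), secant_self, logCurveDeriv, Complex.exp_neg]
  have := Complex.exp_ne_zero ζ
  generalize Polynomial.eval (Complex.exp ζ)⁻¹ (Polynomial.derivative a) = d
  field_simp

lemma hasDerivAt_logCurve (r : ℝ) (a : Polynomial ℂ) (ζ : ℂ) :
    HasDerivAt (logCurve r a) (logCurveDeriv r a ζ) ζ := by
  have h1 : HasDerivAt (fun ζ : ℂ => Complex.exp (-ζ)) (Complex.exp (-ζ) * (-1)) ζ :=
    (hasDerivAt_neg ζ).cexp
  have h2 : HasDerivAt (fun ζ : ℂ => a.eval (Complex.exp (-ζ))) _ ζ :=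
    (a.hasDerivAt _).comp ζ h1
  refine (((Complex.hasDerivAt_exp ζ).const_mul (r : ℂ)).add h2).congr_deriv ?_
  rw [logCurveDeriv]
  ring

lemma differentiable_logCurveDeriv (r : ℝ) (a : Polynomial ℂ) :
    Differentiable ℂ (logCurveDeriv r a) := by
  unfold logCurveDeriv
  have : Differentiable ℂ fun ζ : ℂ => a.derivative.eval (Complex.exp (-ζ)) :=
    (Polynomial.differentiable _).comp (g := fun z => a.derivative.eval z)
      (f := fun ζ : ℂ => Complex.exp (-ζ)) (by fun_prop)
  fun_prop

lemma abs_det_restrictScalars_smulRight (c : ℂ) :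
    |((ContinuousLinearMap.toSpanSingleton ℂ c).restrictScalars ℝ).det| = ‖c‖ ^ 2 := by
  have h1 : ((ContinuousLinearMap.toSpanSingleton ℂ c).restrictScalars ℝ).det =
      Algebra.norm ℝ c := by
    rw [Algebra.norm_apply, ContinuousLinearMap.det]
    congr 1
    ext
    simp [mul_comm]
  rw [h1, Algebra.norm_complex_apply, Complex.normSq_eq_norm_sq, abs_of_nonneg (by positivity)]

/-- Change of variables in Green's formula: with L = Dψ, c = H' and d = ψ H'', the integrand
belonging to (ψ ∘ H) H' is the Jacobian |H'|² times `dbar` ψ. The second derivative of H cancels. -/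
lemma dbar_identity (L : ℂ →L[ℝ] ℂ) (c d : ℂ) :
    Complex.I * (L c * c + d) - (L (Complex.I * c) * c + d * Complex.I) =
      Complex.I * ((‖c‖ ^ 2 : ℝ) * (L 1 + Complex.I * L Complex.I)) := by
  have h1 : L c = c.re * L 1 + c.im * L Complex.I := by
    conv_lhs => rw [show c = c.re • (1 : ℂ) + c.im • Complex.I by simp [Complex.re_add_im]]
    rw [map_add, map_smul, map_smul, Complex.real_smul, Complex.real_smul]
  have h2 : L (Complex.I * c) = -c.im * L 1 + c.re * L Complex.I := by
    conv_lhs => rw [show Complex.I * c = (-c.im) • (1 : ℂ) + c.re • Complex.I by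
      apply Complex.ext <;> simp]
    rw [map_add, map_smul, map_smul, Complex.real_smul, Complex.real_smul]
    push_cast; ring
  rw [h1, h2, ← Complex.normSq_eq_norm_sq, Complex.normSq_eq_conj_mul_self]
  have h3 : (starRingEnd ℂ) c = c.re - c.im * Complex.I := by
    apply Complex.ext <;> simp
  rw [h3]
  linear_combination (c * c.im * L 1 - c * c.re * L Complex.I + c * c.im * L Complex.I * Complex.I) * Complex.I_sq
    
namespace PolynomialCurve

variable (γ : PolynomialCurve)

lemma volume_image : volume γ.image = 0 := by
  refine addHaar_image_eq_zero_of_differentiableOn_of_addHaar_eq_zero volume ?_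
    (Measure.addHaar_sphere volume 0 1)
  intro w hw
  have hw0 : w ≠ 0 := ne_zero_of_one_le_norm (sphere_subset hw)
  exact ((hasDerivAt_curveMap γ.r γ.a hw0).differentiableAt.restrictScalars ℝ
    ).differentiableWithinAt

/-- The substitution z = h(exp ζ) unrolls the exterior into a half-strip, cut off where ψ vanishes.
In Green's formula on the rectangle the horizontal sides cancel by 2πi-periodicity, the right side
vanishes, and the left side is the curve. -/
lemma integral_exteriorDomain_dbar (hU : IsExteriorUnivalent γ.r γ.a) {ψ : ℂ → ℂ}
    (hψ : ContDiff ℝ 1 ψ) (hc : HasCompactSupport ψ) :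
    ∫ z in γ.exteriorDomain, dbar ψ z =
      Complex.I * ∮ w in C(0, 1), ψ (γ.h w) * deriv γ.h w := by
  obtain ⟨M, hM0, hM⟩ := exists_norm_eval_inv_le γ.a
  obtain ⟨R, hR⟩ := hc.isCompact.isBounded.exists_norm_le
  have hr := γ.r_pos
  have hR0 : 0 < |R| + M + 1 := by positivity
  set L : ℝ := max 1 (Real.log ((|R| + M + 1) / γ.r)) with hL
  have hL1 : 1 ≤ L := le_max_left _ _
  have hfar : ∀ ζ : ℂ, L ≤ ζ.re → logCurve γ.r γ.a ζ ∉ tsupport ψ := by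
    intro ζ hζ hmem
    have h1 := hR _ hmem
    have h2 : (|R| + M + 1) / γ.r ≤ ‖Complex.exp ζ‖ := by
      rw [Complex.norm_exp, ← Real.log_le_iff_le_exp (by positivity)]
      exact (le_max_right _ _).trans hζ
    have h3 : 1 ≤ ‖Complex.exp ζ‖ := by
      rw [Complex.norm_exp]
      exact Real.one_le_exp (by linarith)
    have h4 := norm_curveMap_ge hr hM h3
    rw [div_le_iff₀ hr] at h2
    rw [logCurve_eq] at h1
    have := le_abs_self R
    linarith
  -- The imaginary part runs through the range of the principal logarithm, so `exp` is injective on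
  -- `S`.
  set S : Set ℂ := Ioc 0 L ×ℂ Ioc (-Real.pi) Real.pi with hS
  have hSm : MeasurableSet S := (measurableSet_Ioc.preimage Complex.measurable_re).inter
    (measurableSet_Ioc.preimage Complex.measurable_im)
  have hinj : InjOn (logCurve γ.r γ.a) S := by
    intro ζ hζ ξ hξ h
    rw [Complex.mem_reProdIm] at hζ hξ
    rw [logCurve_eq, logCurve_eq] at h
    have h1 : ∀ η : ℂ, 0 < η.re → 1 ≤ ‖Complex.exp η‖ := fun η hη => by
      rw [Complex.norm_exp]
      exact Real.one_le_exp hη.le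
    have h2 := hU.injOn (h1 _ hζ.1.1) (h1 _ hξ.1.1) h
    exact Complex.exp_inj_of_neg_pi_lt_of_le_pi hζ.2.1 hζ.2.2 hξ.2.1 hξ.2.2 h2
  have himage : logCurve γ.r γ.a '' S ⊆ γ.exteriorDomain := by
    rintro _ ⟨ζ, hζ, rfl⟩
    rw [Complex.mem_reProdIm] at hζ
    refine ⟨Complex.exp ζ, ?_, (logCurve_eq _ _ _).symm⟩
    rw [mem_ofPred_eq, Complex.norm_exp]
    exact Real.one_lt_exp_iff.2 hζ.1.1
  have hrest : ∀ z ∈ γ.exteriorDomain \ (logCurve γ.r γ.a '' S), dbar ψ z = 0 := by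
    rintro _ ⟨⟨w, hw, rfl⟩, hz⟩
    have hw1 : 1 < ‖w‖ := hw
    have hw0 := ne_zero_of_one_le_norm hw1.le
    have he : γ.h w = logCurve γ.r γ.a (Complex.log w) := by
      rw [logCurve_eq, Complex.exp_log hw0]; rfl
    rw [he]
    refine dbar_eq_zero_of_notMem_tsupport (hfar _ ?_)
    by_contra hlt
    refine hz ⟨Complex.log w, ?_, he.symm⟩
    rw [Complex.mem_reProdIm]
    refine ⟨⟨?_, (not_le.1 hlt).le⟩, Complex.neg_pi_lt_log_im w, Complex.log_im_le_pi w⟩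
    rw [Complex.log_re]
    exact Real.log_pos hw1
  set H := logCurve γ.r γ.a with hH
  set H' := logCurveDeriv γ.r γ.a with hH'
  have hHd : ∀ ζ, HasDerivAt H (H' ζ) ζ := hasDerivAt_logCurve γ.r γ.a
  have hHc : Continuous H := continuous_iff_continuousAt.2 fun ζ => (hHd ζ).continuousAt
  have hH'c : Continuous H' := (differentiable_logCurveDeriv γ.r γ.a).continuous
  rw [setIntegral_eq_of_subset_of_forall_sdiff_eq_zero (show MeasurableSet γ.exteriorDomain from
    hU.isOpen_image_ext.measurableSet) himage
    hrest, integral_image_eq_integral_abs_det_fderiv_smul volume hSm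
    (f' := fun ζ => (ContinuousLinearMap.toSpanSingleton ℂ (H' ζ)).restrictScalars ℝ)
    (fun ζ _ => ((hHd ζ).hasFDerivAt.restrictScalars ℝ).hasFDerivWithinAt) hinj]
  simp only [abs_det_restrictScalars_smulRight]
  -- Green's formula on the rectangle
  set F : ℂ → ℂ := fun ζ => ψ (H ζ) * H' ζ with hF
  set d : ℂ → ℂ := fun ζ => ψ (H ζ) * deriv H' ζ with hd
  have hFd : ∀ ζ, HasFDerivAt F (ψ (H ζ) • (ContinuousLinearMap.toSpanSingleton ℂ (deriv H' ζ)
      ).restrictScalars ℝ + H' ζ • (fderiv ℝ ψ (H ζ)).comp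
        ((ContinuousLinearMap.toSpanSingleton ℂ (H' ζ)).restrictScalars ℝ)) ζ := by
    intro ζ
    have h1 := (hψ.differentiable one_ne_zero (H ζ)).hasFDerivAt.comp ζ
      ((hHd ζ).hasFDerivAt.restrictScalars ℝ)
    have h2 := ((differentiable_logCurveDeriv γ.r γ.a ζ).hasDerivAt.hasFDerivAt.restrictScalars ℝ)
    exact h1.mul h2
  have hgreen := Complex.integral_boundary_rect_of_hasFDerivAt_real_off_countable F _
    (-Real.pi * Complex.I) (L + Real.pi * Complex.I) ∅ countable_empty
    (fun ζ _ => (hFd ζ).continuousAt.continuousWithinAt) (fun ζ _ => hFd ζ)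
  have hform : ∀ ζ, Complex.I • ((ψ (H ζ) • (ContinuousLinearMap.toSpanSingleton ℂ (deriv H' ζ)
      ).restrictScalars ℝ + H' ζ • (fderiv ℝ ψ (H ζ)).comp
        ((ContinuousLinearMap.toSpanSingleton ℂ (H' ζ)).restrictScalars ℝ)) 1) -
      ((ψ (H ζ) • (ContinuousLinearMap.toSpanSingleton ℂ (deriv H' ζ)
      ).restrictScalars ℝ + H' ζ • (fderiv ℝ ψ (H ζ)).comp
        ((ContinuousLinearMap.toSpanSingleton ℂ (H' ζ)).restrictScalars ℝ)) Complex.I) =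
      Complex.I * ((‖H' ζ‖ ^ 2 : ℝ) • dbar ψ (H ζ)) := by
    intro ζ
    rw [Complex.real_smul, dbar, ← dbar_identity (fderiv ℝ ψ (H ζ)) (H' ζ) (ψ (H ζ) * deriv H' ζ)]
    simp
    ring
  simp only [hform] at hgreen
  set G : ℂ → ℂ := fun ζ => (‖H' ζ‖ ^ 2 : ℝ) • dbar ψ (H ζ) with hG
  have hGc : Continuous G := by
    have := (continuous_dbar hψ).comp hHc
    simp only [hG]
    exact (hH'c.norm.pow 2).smul this
  have hpi := Real.pi_pos
  have hint : IntegrableOn (fun ζ => Complex.I * G ζ)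
      (uIcc 0 L ×ℂ uIcc (-Real.pi) Real.pi) volume :=
    (continuous_const.mul hGc).continuousOn.integrableOn_compact
      (isCompact_uIcc.reProdIm isCompact_uIcc)
  have hper : ∀ x : ℝ, F (x + -(Real.pi * Complex.I)) = F (x + Real.pi * Complex.I) := by
    intro x
    have h1 : ∀ ζ, F (ζ + 2 * Real.pi * Complex.I) = F ζ := by
      intro ζ
      simp only [hF, hH, hH', logCurve, logCurveDeriv, neg_add, Complex.exp_add]
      simp [Complex.exp_neg]
    rw [← h1]
    congr 1
    ring
  have hside : ∀ y : ℝ, F (L + y * Complex.I) = 0 := by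
    intro y
    have h1 : ψ (H (L + y * Complex.I)) = 0 :=
      image_eq_zero_of_notMem_tsupport (hfar _ (by simp))
    simp only [hF, h1, zero_mul]
  have hcirc : ∮ w in C(0, 1), ψ (γ.h w) * deriv γ.h w =
      Complex.I * ∫ y : ℝ in -Real.pi..Real.pi, F (y * Complex.I) := by
    have h1 : Function.Periodic (fun y : ℝ => F (y * Complex.I)) (2 * Real.pi) := by
      intro y
      simp only [hF, hH, hH', logCurve, logCurveDeriv, Complex.ofReal_add, add_mul, neg_add,
        Complex.exp_add, Complex.ofReal_mul, Complex.ofReal_ofNat]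
      simp [Complex.exp_neg]
    have h2 := h1.intervalIntegral_add_eq (-Real.pi) 0
    rw [show -Real.pi + 2 * Real.pi = Real.pi by ring, zero_add] at h2
    rw [h2, circleIntegral, ← intervalIntegral.integral_const_mul]
    refine intervalIntegral.integral_congr fun y _ => ?_
    simp only [deriv_circleMap, circleMap, hF, hH, hH', logCurve_eq, logCurveDeriv_eq,
      smul_eq_mul, Complex.ofReal_one, one_mul, zero_add, h]
    ring
  have hfubini : ∫ ζ in S, G ζ = ∫ x : ℝ in 0..L, ∫ y : ℝ in -Real.pi..Real.pi,
      G (x + y * Complex.I) := by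
    have h1 := (Complex.volume_preserving_equiv_real_prod.symm).setIntegral_preimage_emb
      Complex.measurableEquivRealProd.symm.measurableEmbedding G S
    rw [← h1]
    have h2 : Complex.measurableEquivRealProd.symm ⁻¹' S =
        Ioc 0 L ×ˢ Ioc (-Real.pi) Real.pi := by
      ext ⟨x, y⟩
      simp [hS, Complex.mem_reProdIm, Complex.measurableEquivRealProd]
    rw [h2, Measure.volume_eq_prod, setIntegral_prod]
    · rw [intervalIntegral.integral_of_le (by linarith)]
      refine setIntegral_congr_fun measurableSet_Ioc fun x _ => ?_
      rw [intervalIntegral.integral_of_le (by linarith)]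
      refine setIntegral_congr_fun measurableSet_Ioc fun y _ => ?_
      simp only [Complex.measurableEquivRealProd_symm_apply]
      congr 1
      apply Complex.ext <;> simp
    · have h3 : Continuous fun p : ℝ × ℝ => G (Complex.measurableEquivRealProd.symm p) := by
        refine hGc.comp ?_
        exact Complex.equivRealProdCLM.symm.continuous
      exact (h3.continuousOn.integrableOn_compact (isCompact_Icc.prod isCompact_Icc)).mono_set
        (prod_mono Ioc_subset_Icc_self Ioc_subset_Icc_self)
  rw [hfubini, hcirc]
  have hz := hgreen (by simpa [hG] using hint)
  simp only [Complex.add_re, Complex.mul_re, Complex.neg_re, Complex.ofReal_re, Complex.I_re,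
    Complex.add_im, Complex.mul_im, Complex.neg_im, Complex.ofReal_im, Complex.I_im, mul_zero,
    mul_one, neg_zero, add_zero, zero_add, Complex.ofReal_neg,
    Complex.ofReal_zero, neg_mul, hper, hside, sub_self, intervalIntegral.integral_zero,
    zero_sub, smul_eq_mul, intervalIntegral.integral_const_mul] at hz
  have hzz : (∫ x : ℝ in 0..L, ∫ y : ℝ in -Real.pi..Real.pi, G (x + y * Complex.I)) =
      -∫ y : ℝ in -Real.pi..Real.pi, F (y * Complex.I) := by
    refine mul_left_cancel₀ Complex.I_ne_zero ?_
    rw [mul_neg]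
    exact hz.symm
  rw [hzz, ← mul_assoc, Complex.I_mul_I, neg_one_mul]

/-- Green's formula for the interior domain of a univalent polynomial curve. -/
theorem integral_interiorDomain_dbar (hU : IsExteriorUnivalent γ.r γ.a) {ψ : ℂ → ℂ}
    (hψ : ContDiff ℝ 1 ψ) :
    ∫ z in γ.interiorDomain, dbar ψ z =
      -Complex.I * ∮ w in C(0, 1), ψ (γ.h w) * deriv γ.h w := by
  -- the case of compact support
  have hcomp : ∀ {φ : ℂ → ℂ}, ContDiff ℝ 1 φ → HasCompactSupport φ →
      ∫ z in γ.interiorDomain, dbar φ z =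
        -Complex.I * ∮ w in C(0, 1), φ (γ.h w) * deriv γ.h w := by
    intro φ hφ hc
    have h1 := γ.integral_exteriorDomain_dbar hU hφ hc
    have hi : Integrable (dbar φ) :=
      (continuous_dbar hφ).integrable_of_hasCompactSupport (hasCompactSupport_dbar hc)
    have h2 := integral_add_compl (γ.isOpen_interiorDomain hU).measurableSet hi
    rw [integral_dbar_eq_zero hφ hc] at h2
    have h3 : ∫ z in γ.interiorDomainᶜ, dbar φ z = ∫ z in γ.exteriorDomain, dbar φ z := by
      refine setIntegral_congr_set ?_
      rw [γ.interiorDomain_eq hU, compl_compl]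
      have : γ.image =ᵐ[volume] (∅ : Set ℂ) := ae_eq_empty.2 γ.volume_image
      simpa using this.union (ae_eq_refl γ.exteriorDomain)
    rw [h3, h1] at h2
    rw [neg_mul]
    exact eq_neg_of_add_eq_zero_left h2
  obtain ⟨R, hR0, hR⟩ : ∃ R : ℝ, 0 < R ∧ ∀ z ∈ γ.interiorDomain ∪ γ.image, ‖z‖ ≤ R := by
    obtain ⟨R, hR0, hR⟩ :=
      ((γ.isBounded_interiorDomain hU).union γ.isCompact_image.isBounded).exists_pos_norm_le
    exact ⟨R, hR0, hR⟩
  -- A cutoff that equals 1 near the domain and the curve reduces the statement to compact support.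
  let χ : ContDiffBump (0 : ℂ) := ⟨R + 1, R + 2, by linarith, by linarith⟩
  have hχ : ∀ z : ℂ, ‖z‖ ≤ R → (fun z => (χ z : ℂ) * ψ z) =ᶠ[𝓝 z] ψ := by
    intro z hz
    have : ball (0 : ℂ) (R + 1) ∈ 𝓝 z := isOpen_ball.mem_nhds (by simpa using by linarith)
    filter_upwards [this] with y hy
    rw [χ.one_of_mem_closedBall (ball_subset_closedBall hy)]
    simp
  have hφ : ContDiff ℝ 1 fun z => (χ z : ℂ) * ψ z :=
    (Complex.ofRealCLM.contDiff.comp χ.contDiff).mul hψ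
  have hc : HasCompactSupport fun z => (χ z : ℂ) * ψ z := by
    refine HasCompactSupport.mul_right ?_
    exact χ.hasCompactSupport.comp_left (g := fun x : ℝ => (x : ℂ)) (by simp)
  have h := hcomp hφ hc
  have h1 : ∫ z in γ.interiorDomain, dbar (fun z => (χ z : ℂ) * ψ z) z =
      ∫ z in γ.interiorDomain, dbar ψ z := by
    refine setIntegral_congr_fun (γ.isOpen_interiorDomain hU).measurableSet fun z hz => ?_
    simp only [dbar, (hχ z (hR z (Or.inl hz))).fderiv_eq]
  rw [h1] at h
  rw [h]
  congr 1
  refine circleIntegral.integral_congr zero_le_one fun w hw => ?_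
  have := (hχ (γ.h w) (hR _ (Or.inr ⟨w, hw, rfl⟩))).self_of_nhds
  simp only at this ⊢
  rw [this]

end PolynomialCurve

/-! ### The area -/

/-- The Laurent polynomial `r w⁻¹ + ā(w)`, equal to the conjugate of `h` on the unit circle. -/
def conjCurve (r : ℝ) (a : Polynomial ℂ) (w : ℂ) : ℂ :=
  r * w⁻¹ + (a.map (starRingEnd ℂ)).eval w

lemma eval_map_conj (a : Polynomial ℂ) (w : ℂ) :
    (a.map (starRingEnd ℂ)).eval w = (starRingEnd ℂ) (a.eval ((starRingEnd ℂ) w)) := by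
  conv_lhs => rw [← Complex.conj_conj w]
  rw [Polynomial.eval_map, Polynomial.eval₂_hom]

lemma conj_eq_inv_of_mem_sphere {w : ℂ} (hw : w ∈ sphere (0 : ℂ) 1) :
    (starRingEnd ℂ) w = w⁻¹ := by
  have hw1 : ‖w‖ = 1 := by simpa using hw
  rw [Complex.inv_def, Complex.normSq_eq_norm_sq, hw1]
  simp

lemma conj_curveMap (r : ℝ) (a : Polynomial ℂ) {w : ℂ} (hw : w ∈ sphere (0 : ℂ) 1) :
    (starRingEnd ℂ) (curveMap r a w) = conjCurve r a w := by
  rw [conjCurve, eval_map_conj, conj_eq_inv_of_mem_sphere hw, curveMap, map_add, map_mul,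
    Complex.conj_ofReal, conj_eq_inv_of_mem_sphere hw]

lemma ne_zero_of_mem_circle {w : ℂ} (hw : w ∈ sphere (0 : ℂ) 1) : w ≠ 0 := by
  rintro rfl; simp at hw

lemma circleIntegrable_of_continuousOn_ne_zero {f : ℂ → ℂ} (hf : ContinuousOn f {w | w ≠ 0}) :
    CircleIntegrable f 0 1 :=
  (hf.mono fun _ hw => ne_zero_of_mem_circle hw).circleIntegrable zero_le_one

lemma circleIntegral_inv : ∮ w in C(0, 1), w⁻¹ = 2 * Real.pi * Complex.I := by
  have := circleIntegral.integral_sub_inv_of_mem_ball (c := 0) (w := 0) (R := 1) (by simp)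
  simpa using this

lemma continuousOn_eval_inv (q : Polynomial ℂ) :
    ContinuousOn (fun w : ℂ => q.eval w⁻¹) {w | w ≠ 0} :=
  q.continuous.comp_continuousOn (continuousOn_id.inv₀ fun _ h => h)

lemma continuousOn_inv_ne_zero : ContinuousOn (fun w : ℂ => w⁻¹) {w | w ≠ 0} :=
  continuousOn_id.inv₀ fun _ h => h

lemma circleIntegral_pow_mul_eval_inv (q : Polynomial ℂ) (j : ℕ) :
    ∮ w in C(0, 1), w ^ j * q.eval w⁻¹ * w⁻¹ = 2 * Real.pi * Complex.I * q.coeff j := by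
  have hci : ∀ q : Polynomial ℂ, CircleIntegrable (fun w => w ^ j * q.eval w⁻¹ * w⁻¹) 0 1 :=
    fun q => circleIntegrable_of_continuousOn_ne_zero
      (((continuousOn_id.pow j).mul (continuousOn_eval_inv q)).mul continuousOn_inv_ne_zero)
  induction q using Polynomial.induction_on' with
  | add p q hp hq =>
    simp only [Polynomial.eval_add, mul_add, add_mul, Polynomial.coeff_add]
    rw [circleIntegral.integral_add (hci p) (hci q), hp, hq]
  | monomial k c =>
    have h1 : ∀ w ∈ sphere (0 : ℂ) 1, w ^ j * (Polynomial.monomial k c).eval w⁻¹ * w⁻¹ =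
        c * (w - 0) ^ ((j : ℤ) - k - 1) := by
      intro w hw
      have hw0 := ne_zero_of_mem_circle hw
      rw [Polynomial.eval_monomial, sub_zero, zpow_sub₀ hw0, zpow_sub₀ hw0]
      simp
      field_simp
    rw [circleIntegral.integral_congr zero_le_one h1, circleIntegral.integral_const_mul,
      Polynomial.coeff_monomial]
    by_cases hjk : k = j
    · subst hjk
      simp [circleIntegral_inv, mul_comm]
    · rw [circleIntegral.integral_sub_zpow_of_ne (by omega)]
      simp [hjk]

lemma circleIntegral_eval_mul_eval_inv (p q : Polynomial ℂ) :
    ∮ w in C(0, 1), p.eval w * q.eval w⁻¹ * w⁻¹ =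
      2 * Real.pi * Complex.I * ∑ j ∈ Finset.range (p.natDegree + 1), p.coeff j * q.coeff j := by
  have hci : ∀ j, CircleIntegrable (fun w => p.coeff j * (w ^ j * q.eval w⁻¹ * w⁻¹)) 0 1 :=
    fun j => circleIntegrable_of_continuousOn_ne_zero (continuousOn_const.mul
      (((continuousOn_id.pow j).mul (continuousOn_eval_inv q)).mul continuousOn_inv_ne_zero))
  have h1 : (fun w : ℂ => p.eval w * q.eval w⁻¹ * w⁻¹) = fun w =>
      ∑ j ∈ Finset.range (p.natDegree + 1), p.coeff j * (w ^ j * q.eval w⁻¹ * w⁻¹) := by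
    ext w
    rw [Polynomial.eval_eq_sum_range, Finset.sum_mul, Finset.sum_mul]
    exact Finset.sum_congr rfl fun j _ => by ring
  rw [h1, circleIntegral.integral_fun_sum fun j _ => hci j, Finset.mul_sum]
  refine Finset.sum_congr rfl fun j _ => ?_
  rw [circleIntegral.integral_const_mul, circleIntegral_pow_mul_eval_inv]
  ring

lemma continuousOn_conjCurve (r : ℝ) (a : Polynomial ℂ) :
    ContinuousOn (conjCurve r a) {w | w ≠ 0} :=
  (continuousOn_const.mul continuousOn_inv_ne_zero).add (Polynomial.continuous _).continuousOn

lemma continuousOn_curveMap_ne_zero (r : ℝ) (a : Polynomial ℂ) :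
    ContinuousOn (curveMap r a) {w | w ≠ 0} :=
  fun _ hw => (hasDerivAt_curveMap r a hw).continuousAt.continuousWithinAt

lemma continuousOn_deriv_curveMap (r : ℝ) (a : Polynomial ℂ) :
    ContinuousOn (deriv (curveMap r a)) {w | w ≠ 0} := by
  have h1 : ContinuousOn (fun w : ℂ => secant r a w⁻¹ w⁻¹) {w | w ≠ 0} :=
    (continuous_secant r a).comp_continuousOn (f := fun w : ℂ => (w⁻¹, w⁻¹))
      (continuousOn_inv_ne_zero.prodMk continuousOn_inv_ne_zero)
  exact h1.congr fun w hw => deriv_curveMap r a hw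

lemma circleIntegral_conjCurve_mul_deriv (r : ℝ) (a : Polynomial ℂ) :
    ∮ w in C(0, 1), conjCurve r a w * deriv (curveMap r a) w = 2 * Real.pi * Complex.I *
      (r ^ 2 - ∑ j ∈ Finset.range (a.natDegree + 1), j * ‖a.coeff j‖ ^ 2 : ℝ) := by
  set b := a.map (starRingEnd ℂ) with hb
  set d : Polynomial ℂ := Polynomial.X * a.derivative with hd
  have h1 : ∀ w ∈ sphere (0 : ℂ) 1, conjCurve r a w * deriv (curveMap r a) w =
      ((r : ℂ) ^ 2 * w⁻¹ + r * b.eval w) - ((r : ℂ) * (w ^ 0 * (d * Polynomial.X).eval w⁻¹ * w⁻¹) +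
        b.eval w * d.eval w⁻¹ * w⁻¹) := by
    intro w hw
    have hw0 := ne_zero_of_mem_circle hw
    rw [conjCurve, deriv_curveMap _ _ hw0, secant_self, hd]
    simp only [Polynomial.eval_mul, Polynomial.eval_X, pow_zero, one_mul, ← hb]
    ring
  have hc1 : CircleIntegrable (fun w => (r : ℂ) ^ 2 * w⁻¹) 0 1 :=
    circleIntegrable_of_continuousOn_ne_zero (continuousOn_const.mul continuousOn_inv_ne_zero)
  have hc2 : CircleIntegrable (fun w => (r : ℂ) * b.eval w) 0 1 :=
    circleIntegrable_of_continuousOn_ne_zero (by fun_prop)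
  have hc3 : CircleIntegrable (fun w => (r : ℂ) * (w ^ 0 * (d * Polynomial.X).eval w⁻¹ * w⁻¹)) 0 1 :=
    circleIntegrable_of_continuousOn_ne_zero (continuousOn_const.mul (((continuousOn_id.pow 0).mul
      (continuousOn_eval_inv _)).mul continuousOn_inv_ne_zero))
  have hc4 : CircleIntegrable (fun w => b.eval w * d.eval w⁻¹ * w⁻¹) 0 1 :=
    circleIntegrable_of_continuousOn_ne_zero (((Polynomial.continuous _).continuousOn.mul
      (continuousOn_eval_inv _)).mul continuousOn_inv_ne_zero)
  have hc12 : CircleIntegrable (fun w => (r : ℂ) ^ 2 * w⁻¹ + r * b.eval w) 0 1 := hc1.add hc2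
  have hc34 : CircleIntegrable (fun w => (r : ℂ) * (w ^ 0 * (d * Polynomial.X).eval w⁻¹ * w⁻¹) +
      b.eval w * d.eval w⁻¹ * w⁻¹) 0 1 := hc3.add hc4
  rw [circleIntegral.integral_congr zero_le_one h1, circleIntegral.integral_sub hc12 hc34, circleIntegral.integral_add hc1 hc2,
    circleIntegral.integral_add hc3 hc4, circleIntegral.integral_const_mul,
    circleIntegral.integral_const_mul, circleIntegral.integral_const_mul, circleIntegral_inv,
    circleIntegral_pow_mul_eval_inv, circleIntegral_eval_mul_eval_inv,
    circleIntegral_eq_zero_of_differentiableOn fun z _ => Polynomial.differentiableAt _]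
  have h2 : b.natDegree = a.natDegree :=
    Polynomial.natDegree_map_eq_of_injective (RingHom.injective _) _
  have h3 : ∑ j ∈ Finset.range (b.natDegree + 1), b.coeff j * d.coeff j =
      ((∑ j ∈ Finset.range (a.natDegree + 1), j * ‖a.coeff j‖ ^ 2 : ℝ) : ℂ) := by
    rw [h2]
    push_cast
    refine Finset.sum_congr rfl fun j _ => ?_
    have h4 : d.coeff j = j * a.coeff j := by
      cases j with
      | zero => simp [hd]
      | succ j => rw [hd, Polynomial.coeff_X_mul, Polynomial.coeff_derivative]; push_cast; ring
    rw [h4, hb, Polynomial.coeff_map, ← Complex.ofReal_pow, ← Complex.normSq_eq_norm_sq,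
      Complex.normSq_eq_conj_mul_self]
    ring
  rw [h3]
  simp
  ring

namespace PolynomialCurve

variable (γ : PolynomialCurve)

/-- Green's formula for ψ = z̄, whose `dbar` is 2; on the circle z̄ is a Laurent polynomial in w and
only residues survive. -/
lemma volume_interiorDomain_toReal (hU : IsExteriorUnivalent γ.r γ.a) :
    (volume γ.interiorDomain).toReal =
      Real.pi * (γ.r ^ 2 - ∑ j ∈ Finset.range (γ.a.natDegree + 1), j * ‖γ.a.coeff j‖ ^ 2) := by
  have h1 := γ.integral_interiorDomain_dbar hU (ψ := fun z => (starRingEnd ℂ) z)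
    Complex.conjCLE.contDiff
  have h2 : ∀ z : ℂ, dbar (fun z => (starRingEnd ℂ) z) z = 2 := by
    intro z
    have : fderiv ℝ (fun z => (starRingEnd ℂ) z) z = (Complex.conjCLE : ℂ →L[ℝ] ℂ) :=
      Complex.conjCLE.fderiv
    simp [dbar, this]
    norm_num
  have h3 : ∮ w in C(0, 1), (starRingEnd ℂ) (γ.h w) * deriv γ.h w =
      ∮ w in C(0, 1), conjCurve γ.r γ.a w * deriv (curveMap γ.r γ.a) w :=
    circleIntegral.integral_congr zero_le_one fun w hw => by
      simp only [h, conj_curveMap _ _ hw]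
  simp only [h2] at h1
  rw [h3, circleIntegral_conjCurve_mul_deriv, setIntegral_const] at h1
  have h4 : ((volume.real γ.interiorDomain * 2 : ℝ) : ℂ) = ((2 * (Real.pi *
      (γ.r ^ 2 - ∑ j ∈ Finset.range (γ.a.natDegree + 1), j * ‖γ.a.coeff j‖ ^ 2)) : ℝ) : ℂ) := by
    rw [Complex.real_smul] at h1
    rw [Complex.ofReal_mul, Complex.ofReal_ofNat, h1]
    push_cast
    linear_combination (-2 * (Real.pi : ℂ) * ((γ.r : ℂ) ^ 2 -
      ∑ j ∈ Finset.range (γ.a.natDegree + 1), j * (‖γ.a.coeff j‖ : ℂ) ^ 2)) * Complex.I_sq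
  have h5 := Complex.ofReal_injective h4
  rw [← measureReal_def]
  linarith

end PolynomialCurve

/-! ### Integrals against `h' / (h - z)` -/

/-- The polynomial `u (h(1/u) - z)`. -/
def shiftPoly (r : ℝ) (a : Polynomial ℂ) (z : ℂ) : Polynomial ℂ :=
  Polynomial.C (r : ℂ) + Polynomial.X * (a - Polynomial.C z)

lemma eval_shiftPoly (r : ℝ) (a : Polynomial ℂ) (z u : ℂ) :
    (shiftPoly r a z).eval u = r + u * (a.eval u - z) := by simp [shiftPoly]

lemma eval_shiftPoly_of_ne_zero (r : ℝ) (a : Polynomial ℂ) (z : ℂ) {u : ℂ} (hu : u ≠ 0) :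
    (shiftPoly r a z).eval u = u * (curveMap r a u⁻¹ - z) := by
  rw [eval_shiftPoly, curveMap_inv]
  field_simp
  ring

lemma eval_derivative_shiftPoly (r : ℝ) (a : Polynomial ℂ) (z u : ℂ) :
    (shiftPoly r a z).derivative.eval u = a.eval u - z + u * a.derivative.eval u := by
  simp [shiftPoly]

/-- In the coordinate u = 1/w the Cauchy kernel h' dw/(h - z) becomes a logarithmic derivative of a
polynomial together with a simple pole at u = 0, the trace of the pole of h at infinity. -/
lemma kernel_eq (r : ℝ) (a : Polynomial ℂ) (z : ℂ) {u : ℂ} (hu : u ≠ 0)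
    (hs : (shiftPoly r a z).eval u ≠ 0) :
    (u ^ 2)⁻¹ * (deriv (curveMap r a) u⁻¹ / (curveMap r a u⁻¹ - z)) =
      u⁻¹ - (shiftPoly r a z).derivative.eval u / (shiftPoly r a z).eval u := by
  have h1 := eval_shiftPoly_of_ne_zero r a z hu
  have h2 : curveMap r a u⁻¹ - z = (shiftPoly r a z).eval u / u := by
    rw [h1]; field_simp
  rw [deriv_curveMap _ _ (inv_ne_zero hu), inv_inv, secant_self, h2]
  have h3 : (shiftPoly r a z).eval u - u * (shiftPoly r a z).derivative.eval u =
      r - u ^ 2 * a.derivative.eval u := by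
    rw [eval_shiftPoly, eval_derivative_shiftPoly]; ring
  rw [← h3]
  field_simp

lemma circleIntegral_mul_kernel_of_forall_ne_zero (r : ℝ) (a : Polynomial ℂ) (z : ℂ)
    (hs : ∀ u ∈ closedBall (0 : ℂ) 1, (shiftPoly r a z).eval u ≠ 0) (F : Polynomial ℂ) :
    ∮ w in C(0, 1), F.eval w⁻¹ * (deriv (curveMap r a) w / (curveMap r a w - z)) =
      2 * Real.pi * Complex.I * F.eval 0 := by
  rw [circleIntegral_inv_comp]
  set s := shiftPoly r a z
  have h1 : ∀ u ∈ sphere (0 : ℂ) 1, (u ^ 2)⁻¹ * (F.eval u⁻¹⁻¹ *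
      (deriv (curveMap r a) u⁻¹ / (curveMap r a u⁻¹ - z))) =
      (u - 0)⁻¹ • F.eval u - F.eval u * (s.derivative.eval u / s.eval u) := by
    intro u hu
    have := kernel_eq r a z (ne_zero_of_mem_circle hu) (hs u (sphere_subset_closedBall hu))
    rw [inv_inv, mul_left_comm, this, smul_eq_mul, sub_zero]
    ring
  have hd : ∀ u ∈ closedBall (0 : ℂ) 1,
      DifferentiableAt ℂ (fun u => F.eval u * (s.derivative.eval u / s.eval u)) u :=
    fun u hu => F.differentiableAt.mul (.div (Polynomial.differentiableAt _)
      (Polynomial.differentiableAt _) (hs u hu))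
  have hc1 : CircleIntegrable (fun u => (u - 0)⁻¹ • F.eval u) 0 1 := by
    refine circleIntegrable_of_continuousOn_ne_zero ?_
    simp only [sub_zero]
    exact continuousOn_inv_ne_zero.smul F.continuous.continuousOn
  have hc2 : CircleIntegrable (fun u => F.eval u * (s.derivative.eval u / s.eval u)) 0 1 :=
    ContinuousOn.circleIntegrable zero_le_one fun u hu =>
      (hd u (sphere_subset_closedBall hu)).continuousAt.continuousWithinAt
  rw [circleIntegral.integral_congr zero_le_one h1, circleIntegral.integral_sub hc1 hc2,
    circleIntegral_eq_zero_of_differentiableOn hd,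
    F.differentiable.diffContOnCl.circleIntegral_sub_inv_smul (mem_ball_self one_pos)]
  simp

/-- For z = h(w₀) the polynomial u(h(1/u) - z) has exactly one zero in the closed disc, at u₀ =
1/w₀, and univalence makes it simple. It adds one residue to that at u = 0. -/
lemma circleIntegral_mul_kernel_of_exterior {r : ℝ} {a : Polynomial ℂ} (hr : 0 < r)
    (hU : IsExteriorUnivalent r a) {w₀ : ℂ} (hw₀ : 1 < ‖w₀‖) (F : Polynomial ℂ) :
    ∮ w in C(0, 1), F.eval w⁻¹ * (deriv (curveMap r a) w / (curveMap r a w - curveMap r a w₀)) =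
      2 * Real.pi * Complex.I * (F.eval 0 - F.eval w₀⁻¹) := by
  rw [circleIntegral_inv_comp]
  set u₀ := w₀⁻¹ with hu₀
  have hw0 : w₀ ≠ 0 := ne_zero_of_one_le_norm hw₀.le
  have hu0 : u₀ ≠ 0 := inv_ne_zero hw0
  have hun : ‖u₀‖ < 1 := by rw [hu₀, norm_inv]; exact inv_lt_one_of_one_lt₀ hw₀
  set z := curveMap r a w₀ with hz
  have hzu : z = curveMap r a u₀⁻¹ := by rw [hu₀, inv_inv]
  set s := shiftPoly r a z with hs
  have hroot : s.IsRoot u₀ := by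
    rw [Polynomial.IsRoot, hs, eval_shiftPoly_of_ne_zero _ _ _ hu0, hzu, sub_self, mul_zero]
  obtain ⟨s₁, hs₁⟩ := Polynomial.dvd_iff_isRoot.2 hroot
  have hsne : ∀ u ∈ closedBall (0 : ℂ) 1, u ≠ u₀ → s.eval u ≠ 0 := by
    intro u hu hne
    by_cases h0 : u = 0
    · rw [h0, hs, eval_shiftPoly]
      simpa using hr.ne'
    · rw [hs, eval_shiftPoly_of_ne_zero _ _ _ h0, hzu, curveMap_sub_curveMap r a h0 hu0]
      refine mul_ne_zero h0 (mul_ne_zero ?_ (hU _ hu _ (by simpa using hun.le)))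
      exact sub_ne_zero.2 fun h => hne (inv_injective h)
  have hs₁ne : ∀ u ∈ closedBall (0 : ℂ) 1, s₁.eval u ≠ 0 := by
    intro u hu
    by_cases h : u = u₀
    -- At `u₀` itself: a double zero of `s` would be a zero of h' at `w₀`.
    · have h1 : s.derivative.eval u₀ = s₁.eval u₀ := by
        rw [hs₁]; simp
      have h2 := hU _ hu _ hu
      rw [secant_self, h] at h2
      have h3 : s.eval u₀ = 0 := hroot
      rw [hs, eval_shiftPoly] at h3
      rw [h, ← h1, hs, eval_derivative_shiftPoly]
      intro h4
      apply h2
      linear_combination h3 - u₀ * h4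
    · have := hsne u hu h
      rw [hs₁, Polynomial.eval_mul] at this
      exact right_ne_zero_of_mul this
  have h1 : ∀ u ∈ sphere (0 : ℂ) 1, (u ^ 2)⁻¹ * (F.eval u⁻¹⁻¹ *
      (deriv (curveMap r a) u⁻¹ / (curveMap r a u⁻¹ - z))) =
      ((u - 0)⁻¹ • F.eval u - (u - u₀)⁻¹ • F.eval u) -
        F.eval u * (s₁.derivative.eval u / s₁.eval u) := by
    intro u hu
    have hune : u ≠ u₀ := by
      intro h
      have : ‖u‖ = 1 := by simpa using hu
      rw [h] at this
      linarith
    have h2 := kernel_eq r a z (ne_zero_of_mem_circle hu)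
      (hsne u (sphere_subset_closedBall hu) hune)
    have h3 := hs₁ne u (sphere_subset_closedBall hu)
    have h4 : u - u₀ ≠ 0 := sub_ne_zero.2 hune
    have h5 : s.derivative.eval u / s.eval u =
        (u - u₀)⁻¹ + s₁.derivative.eval u / s₁.eval u := by
      rw [hs₁]
      simp only [Polynomial.derivative_mul, Polynomial.derivative_sub, Polynomial.derivative_X,
        Polynomial.derivative_C, sub_zero, one_mul, Polynomial.eval_add, Polynomial.eval_mul,
        Polynomial.eval_sub, Polynomial.eval_X, Polynomial.eval_C]
      field_simp
    rw [inv_inv, mul_left_comm, h2, h5, smul_eq_mul, smul_eq_mul, sub_zero]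
    ring
  have hd : ∀ u ∈ closedBall (0 : ℂ) 1,
      DifferentiableAt ℂ (fun u => F.eval u * (s₁.derivative.eval u / s₁.eval u)) u :=
    fun u hu => F.differentiableAt.mul (.div (Polynomial.differentiableAt _)
      (Polynomial.differentiableAt _) (hs₁ne u hu))
  have hc : ∀ v : ℂ, ‖v‖ < 1 → CircleIntegrable (fun u => (u - v)⁻¹ • F.eval u) 0 1 := by
    intro v hv
    refine ContinuousOn.circleIntegrable zero_le_one (.smul (.inv₀
      (continuousOn_id.sub continuousOn_const) ?_)
      F.continuous.continuousOn)
    intro u hu h0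
    replace h0 : u - v = 0 := h0
    rw [sub_eq_zero] at h0
    subst h0
    have : ‖u‖ = 1 := by simpa using hu
    linarith
  have hc1 : CircleIntegrable (fun u => (u - 0)⁻¹ • F.eval u - (u - u₀)⁻¹ • F.eval u) 0 1 :=
    (hc 0 (by simp)).sub (hc u₀ hun)
  have hc2 : CircleIntegrable (fun u => F.eval u * (s₁.derivative.eval u / s₁.eval u)) 0 1 :=
    ContinuousOn.circleIntegrable zero_le_one fun u hu =>
      (hd u (sphere_subset_closedBall hu)).continuousAt.continuousWithinAt
  rw [circleIntegral.integral_congr zero_le_one h1, circleIntegral.integral_sub hc1 hc2,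
    circleIntegral.integral_sub (hc 0 (by simp)) (hc u₀ hun),
    circleIntegral_eq_zero_of_differentiableOn hd,
    F.differentiable.diffContOnCl.circleIntegral_sub_inv_smul (mem_ball_self one_pos),
    F.differentiable.diffContOnCl.circleIntegral_sub_inv_smul (by simpa using hun)]
  simp only [smul_eq_mul]
  ring

lemma Polynomial.exists_derivative_eq (p : Polynomial ℂ) :
    ∃ q : Polynomial ℂ, q.derivative = p := by
  induction p using Polynomial.induction_on' with
  | add p q hp hq =>
    obtain ⟨P, rfl⟩ := hp
    obtain ⟨Q, rfl⟩ := hq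
    exact ⟨P + Q, by simp⟩
  | monomial k c =>
    refine ⟨Polynomial.monomial (k + 1) (c / (k + 1)), ?_⟩
    rw [Polynomial.derivative_monomial]
    congr 1
    have : (k : ℂ) + 1 ≠ 0 := by exact_mod_cast Nat.succ_ne_zero k
    push_cast
    field_simp

lemma circleIntegral_eval_curveMap_mul_deriv (r : ℝ) (a p : Polynomial ℂ) :
    ∮ w in C(0, 1), p.eval (curveMap r a w) * deriv (curveMap r a) w = 0 := by
  obtain ⟨q, rfl⟩ := p.exists_derivative_eq
  refine circleIntegral.integral_eq_zero_of_hasDerivWithinAt zero_le_one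
    (f := fun w => q.eval (curveMap r a w)) fun w hw => ?_
  have hw0 := ne_zero_of_mem_circle hw
  have h := hasDerivAt_curveMap r a hw0
  rw [deriv_curveMap _ _ hw0]
  exact ((q.hasDerivAt _).comp w h).hasDerivWithinAt

/-- The curve `h` has a Schwarz function of the form `P(z) + O(1/z)`. -/
def HasSchwarzPoly (r : ℝ) (a P g : Polynomial ℂ) : Prop :=
  ∀ w : ℂ, w ≠ 0 → conjCurve r a w = P.eval (curveMap r a w) + w⁻¹ * g.eval w⁻¹

namespace PolynomialCurve

variable (γ : PolynomialCurve)

lemma eval_shiftPoly_ne_zero_of_mem_interiorDomain (hU : IsExteriorUnivalent γ.r γ.a) {z : ℂ}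
    (hz : z ∈ γ.interiorDomain) :
    ∀ u ∈ closedBall (0 : ℂ) 1, (shiftPoly γ.r γ.a z).eval u ≠ 0 := by
  intro u hu
  by_cases h0 : u = 0
  · rw [h0, eval_shiftPoly]
    simpa using γ.r_pos.ne'
  · rw [eval_shiftPoly_of_ne_zero _ _ _ h0]
    refine mul_ne_zero h0 fun h => ?_
    rw [γ.interiorDomain_eq hU, ← image_curveMap_eq] at hz
    refine hz ⟨u⁻¹, ?_, sub_eq_zero.1 h⟩
    rw [mem_ofPred_eq, norm_inv]
    exact (one_le_inv₀ (norm_pos_iff.2 h0)).2 (by simpa using hu)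

/-- The circle integral which represents the Cauchy transform of the interior domain. -/
lemma circleIntegral_conjCurve_kernel {P g : Polynomial ℂ}
    (hS : HasSchwarzPoly γ.r γ.a P g) {z : ℂ} (hz : z ∉ γ.image) {c₀ cg : ℂ}
    (h1 : ∮ w in C(0, 1), (1 : Polynomial ℂ).eval w⁻¹ *
      (deriv (curveMap γ.r γ.a) w / (curveMap γ.r γ.a w - z)) = c₀)
    (h2 : ∮ w in C(0, 1), (Polynomial.X * g).eval w⁻¹ *
      (deriv (curveMap γ.r γ.a) w / (curveMap γ.r γ.a w - z)) = cg) :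
    ∮ w in C(0, 1), ((starRingEnd ℂ) (γ.h w - z) / (γ.h w - z)) * deriv γ.h w =
      (P.eval z - (starRingEnd ℂ) z) * c₀ + cg := by
  have hne : ∀ w ∈ sphere (0 : ℂ) 1, curveMap γ.r γ.a w - z ≠ 0 := fun w hw h =>
    hz ⟨w, hw, sub_eq_zero.1 h⟩
  -- (P(h) - P(z))/(h - z) is a polynomial in h, so times h' it has a primitive and integrates to
  -- zero. Only the constant P(z) - z̄ and the part with `g` remain over h - z.
  obtain ⟨q, hq⟩ := Polynomial.X_sub_C_dvd_sub_C_eval (p := P) (a := z)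
  have hPz : ∀ ζ, P.eval ζ = P.eval z + (ζ - z) * q.eval ζ := by
    intro ζ
    have := congrArg (Polynomial.eval ζ) hq
    simp only [Polynomial.eval_sub, Polynomial.eval_C, Polynomial.eval_mul, Polynomial.eval_X]
      at this
    linear_combination this
  have h3 : ∀ w ∈ sphere (0 : ℂ) 1,
      ((starRingEnd ℂ) (γ.h w - z) / (γ.h w - z)) * deriv γ.h w =
      ((P.eval z - (starRingEnd ℂ) z) * ((1 : Polynomial ℂ).eval w⁻¹ *
        (deriv (curveMap γ.r γ.a) w / (curveMap γ.r γ.a w - z))) +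
      (Polynomial.X * g).eval w⁻¹ *
        (deriv (curveMap γ.r γ.a) w / (curveMap γ.r γ.a w - z))) +
      q.eval (curveMap γ.r γ.a w) * deriv (curveMap γ.r γ.a) w := by
    intro w hw
    have h4 := hne w hw
    unfold h
    rw [map_sub, conj_curveMap _ _ hw, hS w (ne_zero_of_mem_circle hw),
      hPz (curveMap γ.r γ.a w)]
    simp only [Polynomial.eval_one, Polynomial.eval_mul, Polynomial.eval_X]
    field_simp
    ring
  have hsub : sphere (0 : ℂ) 1 ⊆ {w | w ≠ 0} := fun w hw => ne_zero_of_mem_circle hw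
  have hk : ContinuousOn (fun w => deriv (curveMap γ.r γ.a) w / (curveMap γ.r γ.a w - z))
      (sphere 0 1) :=
    ((continuousOn_deriv_curveMap _ _).mono hsub).div
      (((continuousOn_curveMap_ne_zero _ _).mono hsub).sub continuousOn_const) hne
  have hc : ∀ F : Polynomial ℂ, CircleIntegrable (fun w => F.eval w⁻¹ *
      (deriv (curveMap γ.r γ.a) w / (curveMap γ.r γ.a w - z))) 0 1 := fun F =>
    (((continuousOn_eval_inv F).mono hsub).mul hk).circleIntegrable zero_le_one
  have hc1 : CircleIntegrable (fun w => (P.eval z - (starRingEnd ℂ) z) *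
      ((1 : Polynomial ℂ).eval w⁻¹ *
        (deriv (curveMap γ.r γ.a) w / (curveMap γ.r γ.a w - z)))) 0 1 :=
    (continuousOn_const.mul (((continuousOn_eval_inv 1).mono hsub).mul hk)).circleIntegrable
      zero_le_one
  have hc12 : CircleIntegrable (fun w => (P.eval z - (starRingEnd ℂ) z) *
      ((1 : Polynomial ℂ).eval w⁻¹ *
        (deriv (curveMap γ.r γ.a) w / (curveMap γ.r γ.a w - z))) +
      (Polynomial.X * g).eval w⁻¹ *
        (deriv (curveMap γ.r γ.a) w / (curveMap γ.r γ.a w - z))) 0 1 := hc1.add (hc _)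
  have hc3 : CircleIntegrable (fun w => q.eval (curveMap γ.r γ.a w) *
      deriv (curveMap γ.r γ.a) w) 0 1 :=
    circleIntegrable_of_continuousOn_ne_zero
      ((q.continuous.comp_continuousOn (continuousOn_curveMap_ne_zero _ _)).mul
        (continuousOn_deriv_curveMap _ _))
  rw [circleIntegral.integral_congr zero_le_one h3, circleIntegral.integral_add hc12 hc3,
    circleIntegral.integral_add hc1 (hc _), circleIntegral.integral_const_mul, h1, h2,
    circleIntegral_eval_curveMap_mul_deriv, add_zero]

end PolynomialCurve

/-! ### The Cauchy transform of the interior domain -/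

lemma lintegral_ball_inv_norm {ρ : ℝ} (hρ : 0 ≤ ρ) (z : ℂ) :
    ∫⁻ ζ in ball z ρ, ENNReal.ofReal ‖z - ζ‖⁻¹ = ENNReal.ofReal (2 * Real.pi * ρ) := by
  have hpi := Real.pi_pos
  rw [← lintegral_indicator measurableSet_ball]
  have h1 : ∀ ζ, (ball z ρ).indicator (fun ζ => ENNReal.ofReal ‖z - ζ‖⁻¹) ζ =
      (ball (0 : ℂ) ρ).indicator (fun x => ENNReal.ofReal ‖x‖⁻¹) (z - ζ) := by
    intro ζ
    simp [indicator, dist_eq_norm, norm_sub_rev ζ z]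
  simp only [h1]
  rw [lintegral_sub_left_eq_self (fun x => (ball (0 : ℂ) ρ).indicator
      (fun x => ENNReal.ofReal ‖x‖⁻¹) x) z, ← Complex.lintegral_comp_polarCoord_symm]
  have h2 : ∀ p ∈ polarCoord.target, ENNReal.ofReal p.1 • (ball (0 : ℂ) ρ).indicator
      (fun x => ENNReal.ofReal ‖x‖⁻¹) (Complex.polarCoord.symm p) =
      (Ioo 0 ρ ×ˢ Ioo (-Real.pi) Real.pi).indicator (fun _ => 1) p := by
    rintro ⟨s, θ⟩ ⟨hs, hθ⟩
    have hs0 : 0 < s := hs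
    have hn : ‖Complex.polarCoord.symm (s, θ)‖ = s := by
      rw [Complex.norm_polarCoord_symm, abs_of_pos hs0]
    simp only [indicator, mem_ball_zero_iff, hn, mem_prod, mem_Ioo, smul_eq_mul]
    by_cases h : s < ρ
    · rw [if_pos h, if_pos ⟨⟨hs0, h⟩, hθ⟩, ← ENNReal.ofReal_mul hs0.le, mul_inv_cancel₀ hs0.ne',
        ENNReal.ofReal_one]
    · rw [if_neg h, if_neg (fun h' => h h'.1.2), mul_zero]
  have hm : MeasurableSet (Ioo 0 ρ ×ˢ Ioo (-Real.pi) Real.pi) :=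
    measurableSet_Ioo.prod measurableSet_Ioo
  rw [setLIntegral_congr_fun polarCoord.open_target.measurableSet h2,
    setLIntegral_indicator hm, setLIntegral_one]
  have h3 : (Ioo 0 ρ ×ˢ Ioo (-Real.pi) Real.pi) ∩ polarCoord.target =
      Ioo 0 ρ ×ˢ Ioo (-Real.pi) Real.pi := by
    refine inter_eq_left.2 ?_
    rintro ⟨s, θ⟩ ⟨hs, hθ⟩
    exact ⟨hs.1, hθ⟩
  rw [h3, Measure.volume_eq_prod, Measure.prod_prod, Real.volume_Ioo, Real.volume_Ioo,
    ← ENNReal.ofReal_mul (by linarith)]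
  congr 1
  ring

lemma setLIntegral_inv_norm_le {S : Set ℂ} (hS : MeasurableSet S) {ρ : ℝ} (hρ : 0 < ρ) (z : ℂ) :
    ∫⁻ ζ in S, ENNReal.ofReal ‖z - ζ‖⁻¹ ≤
      ENNReal.ofReal (2 * Real.pi * ρ) + ENNReal.ofReal ρ⁻¹ * volume S := by
  rw [← lintegral_ball_inv_norm hρ.le z,
    ← lintegral_inter_add_sdiff (μ := volume) (fun ζ => ENNReal.ofReal ‖z - ζ‖⁻¹) S
      (measurableSet_ball (x := z) (ε := ρ))]
  refine add_le_add (lintegral_mono_set inter_subset_right) ?_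
  calc ∫⁻ ζ in S \ ball z ρ, ENNReal.ofReal ‖z - ζ‖⁻¹
      ≤ ∫⁻ _ in S \ ball z ρ, ENNReal.ofReal ρ⁻¹ := by
        refine setLIntegral_mono' (hS.diff measurableSet_ball) fun ζ hζ => ?_
        have h1 : ρ ≤ ‖z - ζ‖ := by
          have := hζ.2
          rw [mem_ball, dist_eq_norm, norm_sub_rev] at this
          exact not_lt.1 this
        exact ENNReal.ofReal_le_ofReal (inv_anti₀ hρ h1)
    _ = ENNReal.ofReal ρ⁻¹ * volume (S \ ball z ρ) := setLIntegral_const _ _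
    _ ≤ _ := by gcongr; exact sdiff_subset

lemma integrableOn_inv_sub {S : Set ℂ} (hS : MeasurableSet S) (hfin : volume S ≠ ∞) (z : ℂ) :
    IntegrableOn (fun ζ => (z - ζ)⁻¹) S := by
  refine ⟨(measurable_const.sub measurable_id).inv.aestronglyMeasurable, ?_⟩
  rw [hasFiniteIntegral_iff_norm]
  simp only [norm_inv]
  refine (setLIntegral_inv_norm_le hS one_pos z).trans_lt ?_
  exact ENNReal.add_lt_top.2 ⟨ENNReal.ofReal_lt_top,
    ENNReal.mul_lt_top ENNReal.ofReal_lt_top hfin.lt_top⟩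

/-- Splitting at distance √t from z gives at most 2π√t from the ball and (√t)⁻¹ · πt from the rest.
The shape and the position of the set do not enter. -/
lemma integral_inv_norm_le {S : Set ℂ} (hS : MeasurableSet S) {t : ℝ} (ht : 0 < t)
    (hvol : volume S = ENNReal.ofReal (Real.pi * t)) (z : ℂ) :
    ∫ ζ in S, ‖z - ζ‖⁻¹ ≤ 3 * Real.pi * √t := by
  have hpi := Real.pi_pos
  have hs := Real.sqrt_pos.2 ht
  rw [integral_eq_lintegral_of_nonneg_ae (ae_of_all _ fun _ => by positivity)
    (by fun_prop : Measurable fun ζ => ‖z - ζ‖⁻¹).aestronglyMeasurable]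
  refine ENNReal.toReal_le_of_le_ofReal (by positivity)
    ((setLIntegral_inv_norm_le hS hs z).trans_eq ?_)
  rw [hvol, ← ENNReal.ofReal_mul (by positivity), ← ENNReal.ofReal_add (by positivity)
    (by positivity)]
  congr 1
  have : (√t)⁻¹ * (Real.pi * t) = Real.pi * √t := by
    nth_rewrite 2 [← Real.mul_self_sqrt ht.le]
    field_simp
  rw [this]
  ring

lemma dbar_conj_mul {g : ℂ → ℂ} {ζ : ℂ} (hg : DifferentiableAt ℂ g ζ) (z : ℂ) :
    dbar (fun ζ => (starRingEnd ℂ) (ζ - z) * g ζ) ζ = 2 * g ζ := by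
  have h1 : HasFDerivAt (fun ζ : ℂ => (starRingEnd ℂ) (ζ - z)) (Complex.conjCLE : ℂ →L[ℝ] ℂ) ζ := by
    have := (Complex.conjCLE : ℂ →L[ℝ] ℂ).hasFDerivAt (x := ζ - z)
    exact this.comp ζ ((hasFDerivAt_id ζ).sub_const z)
  have h2 : HasFDerivAt (fun ζ => (starRingEnd ℂ) (ζ - z) * g ζ) _ ζ :=
    h1.mul (hg.hasDerivAt.hasFDerivAt.restrictScalars ℝ)
  rw [dbar, h2.fderiv]
  simp
  linear_combination ((starRingEnd ℂ) ζ * deriv g ζ - (starRingEnd ℂ) z * deriv g ζ -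
    g ζ) * Complex.I_sq

lemma dbar_congr {φ ψ : ℂ → ℂ} {z : ℂ} (h : φ =ᶠ[𝓝 z] ψ) : dbar φ z = dbar ψ z := by
  rw [dbar, dbar, h.fderiv_eq]

lemma dbar_reflect {ψ : ℂ → ℂ} {z : ℂ} (h : ∀ ζ, ψ (2 * z - ζ) = ψ ζ) (ζ : ℂ) :
    dbar ψ (2 * z - ζ) = -dbar ψ ζ := by
  have h1 : fderiv ℝ ψ ζ = -fderiv ℝ ψ (2 * z - ζ) := by
    have h2 := fderiv_comp_smul (𝕜 := ℝ) (f := fun ζ => ψ (2 * z + ζ)) (x := ζ) (-1)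
    simp only [neg_smul, one_smul, ← sub_eq_add_neg, h] at h2
    rw [h2, fderiv_comp_add_left, ← sub_eq_add_neg]
  rw [dbar, dbar, h1]
  simp
  ring

namespace PolynomialCurve

variable (γ : PolynomialCurve)

/-- Away from z the function conj(ζ - z)/(ζ - z) has `dbar` equal to 2/(ζ - z). A radial cutoff
removes its discontinuity at z. The error lives in a small disc around z and is odd under reflection
in z, so it integrates to zero without any limit of radii. -/
lemma integral_interiorDomain_inv_sub (hU : IsExteriorUnivalent γ.r γ.a) {z : ℂ}
    (hz : z ∉ γ.image) :
    ∫ ζ in γ.interiorDomain, (ζ - z)⁻¹ = -(Complex.I / 2) *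
      ∮ w in C(0, 1), ((starRingEnd ℂ) (γ.h w - z) / (γ.h w - z)) * deriv γ.h w := by
  have hDo := γ.isOpen_interiorDomain hU
  have hDm := hDo.measurableSet
  obtain ⟨ε, hε, hball⟩ : ∃ ε > 0, closedBall z ε ⊆ γ.interiorDomain ∨
      closedBall z ε ⊆ γ.exteriorDomain := by
    by_cases h : z ∈ γ.exteriorDomain
    · obtain ⟨ε, hε, h'⟩ := nhds_basis_closedBall.mem_iff.1 (hU.isOpen_image_ext.mem_nhds h)
      exact ⟨ε, hε, Or.inr h'⟩
    · have h1 : z ∈ γ.interiorDomain := by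
        rw [γ.interiorDomain_eq hU]
        simp [hz, h]
      obtain ⟨ε, hε, h'⟩ := nhds_basis_closedBall.mem_iff.1 (hDo.mem_nhds h1)
      exact ⟨ε, hε, Or.inl h'⟩
  have hdisj : Disjoint γ.interiorDomain γ.exteriorDomain := by
    rw [γ.interiorDomain_eq hU]
    exact disjoint_compl_left.mono_right subset_union_right
  let f : ContDiffBump z := ⟨ε / 2, ε, by linarith, by linarith⟩
  set ψ : ℂ → ℂ := fun ζ => (starRingEnd ℂ) (ζ - z) * ((1 - (f ζ : ℂ)) * (ζ - z)⁻¹) with hψ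
  have hfar : ∀ ζ, ζ ∉ closedBall z ε →
      ψ =ᶠ[𝓝 ζ] fun ζ => (starRingEnd ℂ) (ζ - z) * (ζ - z)⁻¹ := by
    intro ζ hζ
    filter_upwards [isClosed_closedBall.isOpen_compl.mem_nhds hζ] with ξ hξ
    have : ε ≤ dist ξ z := by
      have := not_le.1 (mt mem_closedBall.2 hξ)
      exact this.le
    simp only [hψ]
    rw [f.zero_of_le_dist this]
    simp
  have hψd : ContDiff ℝ 1 ψ := by
    rw [contDiff_iff_contDiffAt]
    intro ζ
    by_cases h : ζ = z
    · have : ψ =ᶠ[𝓝 ζ] fun _ => 0 := by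
        rw [h]
        filter_upwards [ball_mem_nhds z (half_pos hε)] with ξ hξ
        simp only [hψ]
        rw [f.one_of_mem_closedBall (ball_subset_closedBall hξ)]
        simp
      exact contDiffAt_const.congr_of_eventuallyEq this
    · have h1 : ContDiffAt ℝ 1 (fun ζ : ℂ => (starRingEnd ℂ) (ζ - z)) ζ :=
        (Complex.conjCLE.contDiff.comp (contDiff_id.sub contDiff_const)).contDiffAt
      have h2 : ContDiffAt ℝ 1 (fun ζ : ℂ => 1 - (f ζ : ℂ)) ζ :=
        (contDiff_const.sub (Complex.ofRealCLM.contDiff.comp f.contDiff)).contDiffAt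
      have h3 : ContDiffAt ℝ 1 (fun ζ : ℂ => (ζ - z)⁻¹) ζ :=
        (contDiffAt_id.sub contDiffAt_const).inv (sub_ne_zero.2 h)
      exact h1.mul (h2.mul h3)
  have hgreen := γ.integral_interiorDomain_dbar hU hψd
  have hcirc : ∮ w in C(0, 1), ψ (γ.h w) * deriv γ.h w =
      ∮ w in C(0, 1), ((starRingEnd ℂ) (γ.h w - z) / (γ.h w - z)) * deriv γ.h w := by
    refine circleIntegral.integral_congr zero_le_one fun w hw => ?_
    have hn : γ.h w ∉ closedBall z ε := by
      intro hmem
      have him : γ.h w ∈ γ.image := ⟨w, hw, rfl⟩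
      rcases hball with h | h
      · have := h hmem
        rw [γ.interiorDomain_eq hU] at this
        exact this (Or.inl him)
      · exact Set.disjoint_left.1 (γ.disjoint_image_exteriorDomain hU) him (h hmem)
    have := (hfar _ hn).self_of_nhds
    simp only [this, div_eq_mul_inv]
  set F : ℂ → ℂ := fun ζ => dbar ψ ζ - 2 * (ζ - z)⁻¹ with hF
  have hF0 : ∀ ζ, ζ ∉ closedBall z ε → F ζ = 0 := by
    intro ζ hζ
    have hne : ζ - z ≠ 0 := by
      intro h
      rw [sub_eq_zero] at h
      subst h
      exact hζ (mem_closedBall_self hε.le)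
    simp only [hF]
    rw [dbar_congr (hfar ζ hζ), dbar_conj_mul (g := fun ζ => (ζ - z)⁻¹)
      ((differentiableAt_id.sub_const z).inv hne), sub_self]
  have hFint : ∫ ζ in γ.interiorDomain, F ζ = 0 := by
    rcases hball with h | h
    · rw [setIntegral_eq_integral_of_forall_compl_eq_zero fun ζ hζ => hF0 ζ fun h' => hζ (h h')]
      have hodd : ∀ ζ, F (2 * z - ζ) = -F ζ := by
        intro ζ
        simp only [hF]
        rw [dbar_reflect]
        · rw [show 2 * z - ζ - z = -(ζ - z) by ring, inv_neg]
          ring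
        · intro ξ
          simp only [hψ]
          have h1 : f (2 * z - ξ) = f ξ := by
            have := f.sub (ξ - z)
            rw [show z - (ξ - z) = 2 * z - ξ by ring, show z + (ξ - z) = ξ by ring] at this
            exact this
          rw [h1, show 2 * z - ξ - z = -(ξ - z) by ring, inv_neg, map_neg]
          ring
      have h1 := integral_sub_left_eq_self F volume (2 * z)
      simp only [hodd, integral_neg] at h1
      exact self_eq_neg.1 h1.symm
    · refine setIntegral_eq_zero_of_forall_eq_zero fun ζ hζ => hF0 ζ fun h' => ?_
      exact Set.disjoint_left.1 hdisj hζ (h h')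
  have hfin : volume γ.interiorDomain ≠ ∞ := (γ.isBounded_interiorDomain hU).measure_lt_top.ne
  have hint1 : IntegrableOn (dbar ψ) γ.interiorDomain := by
    have hcb : IsCompact (closure γ.interiorDomain) :=
      (γ.isBounded_interiorDomain hU).isCompact_closure
    exact ((continuous_dbar hψd).continuousOn.integrableOn_compact hcb).mono_set subset_closure
  have hint2 : IntegrableOn (fun ζ => 2 * (ζ - z)⁻¹) γ.interiorDomain := by
    have h1 := (integrableOn_inv_sub hDm hfin z).const_mul (-2)
    refine h1.congr (ae_of_all _ fun ζ => ?_)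
    simp only
    rw [← neg_sub ζ z, inv_neg]
    ring
  have h2 := integral_sub hint1 hint2
  rw [show (∫ ζ in γ.interiorDomain, dbar ψ ζ - 2 * (ζ - z)⁻¹) =
    ∫ ζ in γ.interiorDomain, F ζ from rfl, hFint, hgreen, hcirc, integral_const_mul] at h2
  linear_combination (1 / 2 : ℂ) * h2

/-- The Cauchy transform of the interior domain. -/
def cauchyTransform (z : ℂ) : ℂ := ∫ ζ in γ.interiorDomain, (z - ζ)⁻¹

lemma cauchyTransform_eq_neg (z : ℂ) :
    γ.cauchyTransform z = -∫ ζ in γ.interiorDomain, (ζ - z)⁻¹ := by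
  rw [cauchyTransform, ← integral_neg]
  refine integral_congr_ae (ae_of_all _ fun ζ => ?_)
  simp only
  rw [← inv_neg, neg_sub]

lemma norm_cauchyTransform_le (hU : IsExteriorUnivalent γ.r γ.a) {t : ℝ} (ht : 0 < t)
    (hvol : volume γ.interiorDomain = ENNReal.ofReal (Real.pi * t)) (z : ℂ) :
    ‖γ.cauchyTransform z‖ ≤ 3 * Real.pi * √t := by
  refine (norm_integral_le_integral_norm _).trans ?_
  simp only [norm_inv]
  exact integral_inv_norm_le (γ.isOpen_interiorDomain hU).measurableSet ht hvol z

lemma cauchyTransform_of_mem_interiorDomain (hU : IsExteriorUnivalent γ.r γ.a)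
    {P g : Polynomial ℂ} (hS : HasSchwarzPoly γ.r γ.a P g) {z : ℂ} (hz : z ∈ γ.interiorDomain) :
    γ.cauchyTransform z = Real.pi * ((starRingEnd ℂ) z - P.eval z) := by
  have hz' : z ∉ γ.image := by
    rw [γ.interiorDomain_eq hU] at hz
    exact fun h => hz (Or.inl h)
  have hk := circleIntegral_mul_kernel_of_forall_ne_zero γ.r γ.a z
    (γ.eval_shiftPoly_ne_zero_of_mem_interiorDomain hU hz)
  rw [cauchyTransform_eq_neg, γ.integral_interiorDomain_inv_sub hU hz',
    γ.circleIntegral_conjCurve_kernel hS hz' (hk 1) (hk _)]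
  simp
  linear_combination (Real.pi : ℂ) * (P.eval z - (starRingEnd ℂ) z) * Complex.I_sq

/-- Outside, the two residues of the plain kernel cancel. The residue at 1/w leaves only w⁻¹ g(w⁻¹),
which is h̄(1/w) - P(h(w)). -/
lemma cauchyTransform_of_exterior (hU : IsExteriorUnivalent γ.r γ.a)
    {P g : Polynomial ℂ} (hS : HasSchwarzPoly γ.r γ.a P g) {w : ℂ} (hw : 1 < ‖w‖) :
    γ.cauchyTransform (γ.h w) = Real.pi * (conjCurve γ.r γ.a w - P.eval (γ.h w)) := by
  have hz' : γ.h w ∉ γ.image := fun h =>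
    Set.disjoint_left.1 (γ.disjoint_image_exteriorDomain hU) h ⟨w, hw, rfl⟩
  have hk := circleIntegral_mul_kernel_of_exterior γ.r_pos hU hw
  have h1 := hS w (ne_zero_of_one_le_norm hw.le)
  rw [cauchyTransform_eq_neg, γ.integral_interiorDomain_inv_sub hU hz',
    γ.circleIntegral_conjCurve_kernel hS hz' (hk 1) (hk _), h1]
  simp [h]
  linear_combination (-Real.pi : ℂ) * w⁻¹ * g.eval w⁻¹ * Complex.I_sq

end PolynomialCurve

/-! ### Laurent polynomials as functions -/

/-- The function is given by a Laurent polynomial away from `0`. -/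
def IsLaurent (f : ℂ → ℂ) : Prop :=
  ∃ (N : ℕ) (p : Polynomial ℂ), ∀ w : ℂ, w ≠ 0 → f w = (w⁻¹) ^ N * p.eval w

namespace IsLaurent

variable {f g : ℂ → ℂ}

lemma eval (p : Polynomial ℂ) : IsLaurent fun w => p.eval w := ⟨0, p, fun w _ => by simp⟩

lemma inv : IsLaurent fun w => w⁻¹ := ⟨1, 1, fun w _ => by simp⟩

lemma mul (hf : IsLaurent f) (hg : IsLaurent g) : IsLaurent fun w => f w * g w := by
  obtain ⟨N, p, hp⟩ := hf
  obtain ⟨M, q, hq⟩ := hg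
  refine ⟨N + M, p * q, fun w hw => ?_⟩
  simp only [hp w hw, hq w hw, Polynomial.eval_mul]
  ring

lemma add (hf : IsLaurent f) (hg : IsLaurent g) : IsLaurent fun w => f w + g w := by
  obtain ⟨N, p, hp⟩ := hf
  obtain ⟨M, q, hq⟩ := hg
  refine ⟨N + M, p * Polynomial.X ^ M + q * Polynomial.X ^ N, fun w hw => ?_⟩
  simp only [hp w hw, hq w hw, Polynomial.eval_add, Polynomial.eval_mul, Polynomial.eval_pow,
    Polynomial.eval_X]
  have h1 : w⁻¹ ^ M * w ^ M = 1 := by rw [← mul_pow, inv_mul_cancel₀ hw, one_pow]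
  have h2 : w⁻¹ ^ N * w ^ N = 1 := by rw [← mul_pow, inv_mul_cancel₀ hw, one_pow]
  rw [pow_add]
  linear_combination (-(w⁻¹ ^ N * p.eval w)) * h1 - (w⁻¹ ^ M * q.eval w) * h2

lemma polynomial_comp (hf : IsLaurent f) (p : Polynomial ℂ) : IsLaurent fun w => p.eval (f w) := by
  induction p using Polynomial.induction_on with
  | C c => simpa using eval (Polynomial.C c)
  | add p q hp hq => simpa using hp.add hq
  | monomial n c h =>
    have := h.mul hf
    refine this.imp fun N h => h.imp fun q h w hw => ?_
    rw [← h w hw]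
    simp [pow_succ, mul_assoc]

lemma exists_decomposition (hf : IsLaurent f) :
    ∃ p q : Polynomial ℂ, ∀ w : ℂ, w ≠ 0 → f w = p.eval w + w⁻¹ * q.eval w⁻¹ := by
  obtain ⟨N, P, hP⟩ := hf
  suffices h : ∀ N : ℕ, ∃ p q : Polynomial ℂ, ∀ w : ℂ, w ≠ 0 →
      (w⁻¹) ^ N * P.eval w = p.eval w + w⁻¹ * q.eval w⁻¹ by
    obtain ⟨p, q, h⟩ := h N
    exact ⟨p, q, fun w hw => (hP w hw).trans (h w hw)⟩
  intro N
  induction N with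
  | zero => exact ⟨P, 0, fun w _ => by simp⟩
  | succ N ih =>
    obtain ⟨p, q, h⟩ := ih
    refine ⟨p.divX, Polynomial.C (p.coeff 0) + Polynomial.X * q, fun w hw => ?_⟩
    have h1 := congrArg (Polynomial.eval w) (Polynomial.divX_mul_X_add p)
    simp only [Polynomial.eval_add, Polynomial.eval_mul, Polynomial.eval_X, Polynomial.eval_C]
      at h1
    rw [pow_succ', mul_assoc, h w hw, ← h1]
    simp only [Polynomial.eval_add, Polynomial.eval_mul, Polynomial.eval_X, Polynomial.eval_C]
    generalize q.eval w⁻¹ = Q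
    field_simp
    ring

end IsLaurent

lemma isLaurent_curveMap (r : ℝ) (a : Polynomial ℂ) : IsLaurent (curveMap r a) := by
  have h1 := (IsLaurent.eval (Polynomial.C (r : ℂ) * Polynomial.X)).add
    (IsLaurent.inv.polynomial_comp a)
  simpa using! h1

/-! ### Exterior harmonic moments -/

/-- The polynomial `∑ k t_k z^{k-1}`. -/
def momentPoly (n : ℕ) (t : ℕ → ℂ) : Polynomial ℂ :=
  ∑ k ∈ Finset.Icc 1 (n + 1), Polynomial.C (k * t k) * Polynomial.X ^ (k - 1)

lemma eval_momentPoly (n : ℕ) (t : ℕ → ℂ) (z : ℂ) :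
    (momentPoly n t).eval z = ∑ k ∈ Finset.Icc 1 (n + 1), k * t k * z ^ (k - 1) := by
  simp [momentPoly, Polynomial.eval_finsetSum]

namespace PolynomialCurve

variable (γ : PolynomialCurve)

lemma curveMap_ne_zero_of_mem_sphere (h0 : (0 : ℂ) ∈ γ.interiorDomain)
    {w : ℂ} (hw : w ∈ sphere (0 : ℂ) 1) : curveMap γ.r γ.a w ≠ 0 :=
  fun h => h0.1 ⟨w, hw, h⟩

lemma continuousOn_pow_inv_mul_deriv (h0 : (0 : ℂ) ∈ γ.interiorDomain) (j : ℕ) :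
    ContinuousOn (fun w => (curveMap γ.r γ.a w ^ j)⁻¹ * deriv (curveMap γ.r γ.a) w)
      (sphere 0 1) := by
  have hsub : sphere (0 : ℂ) 1 ⊆ {w | w ≠ 0} := fun w hw => ne_zero_of_mem_circle hw
  refine ContinuousOn.mul (ContinuousOn.inv₀ ?_ ?_) ((continuousOn_deriv_curveMap _ _).mono hsub)
  · exact ((continuousOn_curveMap_ne_zero _ _).mono hsub).pow j
  · exact fun w hw => pow_ne_zero j (γ.curveMap_ne_zero_of_mem_sphere h0 hw)

lemma pow_inv_mul_deriv_inv {j : ℕ} {u : ℂ} (hu : u ≠ 0) :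
    (u ^ 2)⁻¹ * ((curveMap γ.r γ.a u⁻¹ ^ j)⁻¹ * deriv (curveMap γ.r γ.a) u⁻¹) =
      (u ^ 2)⁻¹ * (u ^ j * ((derivPoly γ.r γ.a).eval u / (shiftPoly γ.r γ.a 0).eval u ^ j)) := by
  rw [deriv_curveMap _ _ (inv_ne_zero hu), inv_inv, eval_derivPoly,
    eval_shiftPoly_of_ne_zero _ _ _ hu, sub_zero, mul_pow]
  have := pow_ne_zero j hu
  field_simp

/-- The integrand is holomorphic outside the disc and O(w⁻²) at infinity, so the decaying part of
the Schwarz function does not affect the moments. -/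
lemma circleIntegral_inv_mul_eval_inv_pow (hU : IsExteriorUnivalent γ.r γ.a)
    (h0 : (0 : ℂ) ∈ γ.interiorDomain) (g : Polynomial ℂ) {j : ℕ} (hj : 1 ≤ j) :
    ∮ w in C(0, 1), w⁻¹ * g.eval w⁻¹ *
      ((curveMap γ.r γ.a w ^ j)⁻¹ * deriv (curveMap γ.r γ.a) w) = 0 := by
  obtain ⟨j, rfl⟩ := Nat.exists_eq_add_of_le' hj
  rw [circleIntegral_inv_comp]
  have hs := γ.eval_shiftPoly_ne_zero_of_mem_interiorDomain hU h0
  have h1 : ∀ u ∈ sphere (0 : ℂ) 1, (u ^ 2)⁻¹ * (u⁻¹⁻¹ * g.eval u⁻¹⁻¹ *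
      ((curveMap γ.r γ.a u⁻¹ ^ (j + 1))⁻¹ * deriv (curveMap γ.r γ.a) u⁻¹)) =
      u ^ j * (g.eval u *
        ((derivPoly γ.r γ.a).eval u / (shiftPoly γ.r γ.a 0).eval u ^ (j + 1))) := by
    intro u hu
    have hu0 := ne_zero_of_mem_circle hu
    rw [mul_left_comm, γ.pow_inv_mul_deriv_inv hu0, inv_inv]
    have h2 : (u ^ 2)⁻¹ * u ^ (j + 1) * u = u ^ j := by field_simp; ring
    rw [← h2]
    ring
  rw [circleIntegral.integral_congr zero_le_one h1]
  refine circleIntegral_eq_zero_of_differentiableOn fun u hu => ?_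
  exact (differentiableAt_id.pow j).mul ((Polynomial.differentiableAt _).mul
    (.div (Polynomial.differentiableAt _) ((Polynomial.differentiableAt _).pow _)
      (pow_ne_zero _ (hs u hu))))

/-- With the exponent deg p + 1 the integrand is of order 1/w at infinity, and its residue sees only
the leading coefficient of p. -/
lemma circleIntegral_eval_mul_pow_natDegree (hU : IsExteriorUnivalent γ.r γ.a)
    (h0 : (0 : ℂ) ∈ γ.interiorDomain) (p : Polynomial ℂ) :
    ∮ w in C(0, 1), p.eval w *
      ((curveMap γ.r γ.a w ^ (p.natDegree + 1))⁻¹ * deriv (curveMap γ.r γ.a) w) =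
      2 * Real.pi * Complex.I * (p.leadingCoeff * (γ.r / γ.r ^ (p.natDegree + 1))) := by
  rw [circleIntegral_inv_comp]
  have hs := γ.eval_shiftPoly_ne_zero_of_mem_interiorDomain hU h0
  set M := p.natDegree with hM
  set Φ : ℂ → ℂ := fun u => p.reverse.eval u *
    ((derivPoly γ.r γ.a).eval u / (shiftPoly γ.r γ.a 0).eval u ^ (M + 1)) with hΦ
  have h1 : ∀ u ∈ sphere (0 : ℂ) 1, (u ^ 2)⁻¹ * (p.eval u⁻¹ *
      ((curveMap γ.r γ.a u⁻¹ ^ (M + 1))⁻¹ * deriv (curveMap γ.r γ.a) u⁻¹)) =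
      (u - 0)⁻¹ • Φ u := by
    intro u hu
    have hu0 := ne_zero_of_mem_circle hu
    have h2 : p.reverse.eval u = u ^ M * p.eval u⁻¹ := by
      have hinv := invertibleOfNonzero (inv_ne_zero hu0)
      have h3 := Polynomial.eval₂_reverse_mul_pow (RingHom.id ℂ) u⁻¹ p
      rw [invOf_eq_inv, inv_inv, Polynomial.eval₂_id, Polynomial.eval₂_id] at h3
      rw [← h3, mul_left_comm, ← mul_pow, mul_inv_cancel₀ hu0, one_pow, mul_one]
    rw [mul_left_comm, γ.pow_inv_mul_deriv_inv hu0]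
    simp only [hΦ, h2, smul_eq_mul, sub_zero]
    have h4 : (u ^ 2)⁻¹ * u ^ (M + 1) = u⁻¹ * u ^ M := by field_simp; ring
    linear_combination (p.eval u⁻¹ * ((derivPoly γ.r γ.a).eval u /
      (shiftPoly γ.r γ.a 0).eval u ^ (M + 1))) * h4
  have hd : DiffContOnCl ℂ Φ (ball 0 1) := by
    refine DifferentiableOn.diffContOnCl fun u hu => ?_
    rw [closure_ball _ one_ne_zero] at hu
    have h2 : DifferentiableAt ℂ Φ u := (Polynomial.differentiableAt _).mul
      (.div (Polynomial.differentiableAt _) ((Polynomial.differentiableAt _).pow _)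
      (pow_ne_zero _ (hs u hu)))
    exact h2.differentiableWithinAt
  rw [circleIntegral.integral_congr zero_le_one h1,
    hd.circleIntegral_sub_inv_smul (mem_ball_self one_pos), smul_eq_mul]
  simp only [hΦ, eval_derivPoly, eval_shiftPoly, secant_zero_right, zero_mul, add_zero]
  rw [← Polynomial.coeff_zero_eq_eval_zero, Polynomial.coeff_zero_reverse]

lemma circleIntegral_pow_mul_pow_inv (hU : IsExteriorUnivalent γ.r γ.a)
    (h0 : (0 : ℂ) ∈ γ.interiorDomain) (k j : ℕ) :
    ∮ w in C(0, 1), curveMap γ.r γ.a w ^ k *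
      ((curveMap γ.r γ.a w ^ j)⁻¹ * deriv (curveMap γ.r γ.a) w) =
      if k + 1 = j then 2 * Real.pi * Complex.I else 0 := by
  split_ifs with h
  · subst h
    have h1 := circleIntegral_mul_kernel_of_forall_ne_zero γ.r γ.a 0
      (γ.eval_shiftPoly_ne_zero_of_mem_interiorDomain hU h0) 1
    simp only [Polynomial.eval_one, mul_one, one_mul, sub_zero] at h1
    rw [← h1]
    refine circleIntegral.integral_congr zero_le_one fun w hw => ?_
    have := γ.curveMap_ne_zero_of_mem_sphere h0 hw
    simp only [pow_succ]
    field_simp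
  · have hm : ((k : ℤ) - j + 1 : ℂ) ≠ 0 := by
      have : (k : ℤ) - j + 1 ≠ 0 := by omega
      exact_mod_cast this
    refine circleIntegral.integral_eq_zero_of_hasDerivWithinAt zero_le_one
      (f := fun w => curveMap γ.r γ.a w ^ ((k : ℤ) - j + 1) / ((k : ℤ) - j + 1 : ℂ)) fun w hw => ?_
    have hw0 := ne_zero_of_mem_circle hw
    have hne := γ.curveMap_ne_zero_of_mem_sphere h0 hw
    have h1 := hasDerivAt_curveMap γ.r γ.a hw0
    rw [deriv_curveMap _ _ hw0]
    have h2 : HasDerivAt (fun w => curveMap γ.r γ.a w ^ ((k : ℤ) - j + 1)) _ w :=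
      (hasDerivAt_zpow ((k : ℤ) - j + 1) _ (Or.inl hne)).comp w h1
    refine ((h2.div_const _).congr_deriv ?_).hasDerivWithinAt
    rw [add_sub_cancel_right, zpow_sub₀ hne]
    simp only [zpow_natCast]
    push_cast at hm ⊢
    field_simp

lemma circleIntegral_momentPoly (hU : IsExteriorUnivalent γ.r γ.a)
    (h0 : (0 : ℂ) ∈ γ.interiorDomain) {n : ℕ} {t : ℕ → ℂ}
    (ht : ∀ k : ℕ, n + 1 < k → t k = 0) {j : ℕ} (hj : 1 ≤ j) :
    ∮ w in C(0, 1), (momentPoly n t).eval (curveMap γ.r γ.a w) *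
      ((curveMap γ.r γ.a w ^ j)⁻¹ * deriv (curveMap γ.r γ.a) w) =
      2 * Real.pi * Complex.I * (j * t j) := by
  have hsub : sphere (0 : ℂ) 1 ⊆ {w | w ≠ 0} := fun w hw => ne_zero_of_mem_circle hw
  have hc : ∀ k, CircleIntegrable (fun w => k * t k * (curveMap γ.r γ.a w ^ (k - 1) *
      ((curveMap γ.r γ.a w ^ j)⁻¹ * deriv (curveMap γ.r γ.a) w))) 0 1 := fun k =>
    (continuousOn_const.mul ((((continuousOn_curveMap_ne_zero _ _).mono hsub).pow _).mul
      (γ.continuousOn_pow_inv_mul_deriv h0 j))).circleIntegrable zero_le_one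
  simp only [eval_momentPoly, Finset.sum_mul, mul_assoc]
  simp only [mul_assoc] at hc
  rw [circleIntegral.integral_fun_sum fun k _ => hc k]
  simp only [circleIntegral.integral_const_mul, γ.circleIntegral_pow_mul_pow_inv hU h0]
  by_cases hjn : j ≤ n + 1
  · rw [Finset.sum_eq_single j]
    · rw [if_pos (by omega)]
      ring
    · intro k hk hkj
      rw [Finset.mem_Icc] at hk
      rw [if_neg (by omega)]
      simp
    · intro hj'
      exact absurd (Finset.mem_Icc.2 ⟨hj, hjn⟩) hj'
  · rw [ht j (by omega), Finset.sum_eq_zero]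
    · simp
    · intro k hk
      rw [Finset.mem_Icc] at hk
      rw [if_neg (by omega)]
      simp

lemma harmonicMoment_eq_iff {j : ℕ} (hj : 1 ≤ j) (c : ℂ) :
    γ.harmonicMoment j = c ↔ ∮ w in C(0, 1), conjCurve γ.r γ.a w *
      ((curveMap γ.r γ.a w ^ j)⁻¹ * deriv (curveMap γ.r γ.a) w) =
      2 * Real.pi * Complex.I * (j * c) := by
  have h1 : ∮ w in C(0, 1), (starRingEnd ℂ) (γ.h w) * (γ.h w ^ j)⁻¹ * deriv γ.h w =
      ∮ w in C(0, 1), conjCurve γ.r γ.a w *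
      ((curveMap γ.r γ.a w ^ j)⁻¹ * deriv (curveMap γ.r γ.a) w) := by
    refine circleIntegral.integral_congr zero_le_one fun w hw => ?_
    unfold h
    simp only [conj_curveMap _ _ hw]
    ring
  have hj0 : (j : ℂ) ≠ 0 := by exact_mod_cast (by omega : j ≠ 0)
  have hpi : (2 * Real.pi * Complex.I * j : ℂ) ≠ 0 := by simp [Real.pi_ne_zero, hj0]
  rw [harmonicMoment, h1, inv_mul_eq_iff_eq_mul₀ hpi, mul_assoc _ (j : ℂ) c]

lemma forall_harmonicMoment_of_hasSchwarzPoly (hU : IsExteriorUnivalent γ.r γ.a)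
    (h0 : (0 : ℂ) ∈ γ.interiorDomain) {n : ℕ} {t : ℕ → ℂ}
    (ht : ∀ k : ℕ, n + 1 < k → t k = 0) {g : Polynomial ℂ}
    (hS : HasSchwarzPoly γ.r γ.a (momentPoly n t) g) {j : ℕ} (hj : 1 ≤ j) :
    γ.harmonicMoment j = t j := by
  rw [γ.harmonicMoment_eq_iff hj]
  have hsub : sphere (0 : ℂ) 1 ⊆ {w | w ≠ 0} := fun w hw => ne_zero_of_mem_circle hw
  have hk := γ.continuousOn_pow_inv_mul_deriv h0 j
  have h1 : ∀ w ∈ sphere (0 : ℂ) 1, conjCurve γ.r γ.a w *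
      ((curveMap γ.r γ.a w ^ j)⁻¹ * deriv (curveMap γ.r γ.a) w) =
      (momentPoly n t).eval (curveMap γ.r γ.a w) *
        ((curveMap γ.r γ.a w ^ j)⁻¹ * deriv (curveMap γ.r γ.a) w) + w⁻¹ * g.eval w⁻¹ *
        ((curveMap γ.r γ.a w ^ j)⁻¹ * deriv (curveMap γ.r γ.a) w) := by
    intro w hw
    rw [hS w (ne_zero_of_mem_circle hw), add_mul]
  rw [circleIntegral.integral_congr zero_le_one h1, circleIntegral.integral_add,
    γ.circleIntegral_momentPoly hU h0 ht hj, γ.circleIntegral_inv_mul_eval_inv_pow hU h0 g hj,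
    add_zero]
  · exact (((Polynomial.continuous _).comp_continuousOn
      ((continuousOn_curveMap_ne_zero _ _).mono hsub)).mul hk).circleIntegrable zero_le_one
  · exact (((continuousOn_inv_ne_zero.mono hsub).mul ((continuousOn_eval_inv g).mono hsub)).mul
      hk).circleIntegrable zero_le_one

/-- Split h̄(1/w) - P(h(w)) into a polynomial p in w and a part O(1/w). The moment of order deg p +
1 of this difference is zero and detects the leading coefficient of p, so p = 0. -/
lemma exists_hasSchwarzPoly_of_forall_harmonicMoment (hU : IsExteriorUnivalent γ.r γ.a)
    (h0 : (0 : ℂ) ∈ γ.interiorDomain) {n : ℕ} {t : ℕ → ℂ}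
    (ht : ∀ k : ℕ, n + 1 < k → t k = 0)
    (hm : ∀ j : ℕ, 1 ≤ j → γ.harmonicMoment j = t j) :
    ∃ g, HasSchwarzPoly γ.r γ.a (momentPoly n t) g := by
  have hL : IsLaurent fun w => conjCurve γ.r γ.a w +
      (-1 : ℂ) * (momentPoly n t).eval (curveMap γ.r γ.a w) := by
    have h1 : IsLaurent (conjCurve γ.r γ.a) := by
      have := ((IsLaurent.eval (Polynomial.C (γ.r : ℂ))).mul IsLaurent.inv).add
        (IsLaurent.eval (γ.a.map (starRingEnd ℂ)))
      simpa using! this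
    have h2 : IsLaurent fun _ => (-1 : ℂ) := by simpa using IsLaurent.eval (Polynomial.C (-1))
    exact h1.add (h2.mul ((isLaurent_curveMap γ.r γ.a).polynomial_comp _))
  obtain ⟨p, g, hpg⟩ := hL.exists_decomposition
  have hS : ∀ w : ℂ, w ≠ 0 → p.eval w = conjCurve γ.r γ.a w -
      (momentPoly n t).eval (curveMap γ.r γ.a w) - w⁻¹ * g.eval w⁻¹ := by
    intro w hw
    linear_combination -hpg w hw
  suffices hp : p = 0 by
    refine ⟨g, fun w hw => ?_⟩
    have := hS w hw
    rw [hp, Polynomial.eval_zero] at this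
    linear_combination -this
  have hsub : sphere (0 : ℂ) 1 ⊆ {w | w ≠ 0} := fun w hw => ne_zero_of_mem_circle hw
  set j := p.natDegree + 1 with hj
  have hj1 : 1 ≤ j := by omega
  have hk := γ.continuousOn_pow_inv_mul_deriv h0 j
  have h1 := γ.circleIntegral_eval_mul_pow_natDegree hU h0 p
  have h2 : ∀ w ∈ sphere (0 : ℂ) 1, p.eval w *
      ((curveMap γ.r γ.a w ^ j)⁻¹ * deriv (curveMap γ.r γ.a) w) =
      (conjCurve γ.r γ.a w * ((curveMap γ.r γ.a w ^ j)⁻¹ * deriv (curveMap γ.r γ.a) w) -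
      (momentPoly n t).eval (curveMap γ.r γ.a w) *
        ((curveMap γ.r γ.a w ^ j)⁻¹ * deriv (curveMap γ.r γ.a) w)) - w⁻¹ * g.eval w⁻¹ *
        ((curveMap γ.r γ.a w ^ j)⁻¹ * deriv (curveMap γ.r γ.a) w) := by
    intro w hw
    rw [hS w (ne_zero_of_mem_circle hw), sub_mul, sub_mul]
  have hc1 : CircleIntegrable (fun w => conjCurve γ.r γ.a w *
      ((curveMap γ.r γ.a w ^ j)⁻¹ * deriv (curveMap γ.r γ.a) w)) 0 1 :=
    (((continuousOn_conjCurve γ.r γ.a).mono hsub).mul hk).circleIntegrable zero_le_one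
  have hc2 : CircleIntegrable (fun w => (momentPoly n t).eval (curveMap γ.r γ.a w) *
      ((curveMap γ.r γ.a w ^ j)⁻¹ * deriv (curveMap γ.r γ.a) w)) 0 1 :=
    (((momentPoly n t).continuous.comp_continuousOn
      ((continuousOn_curveMap_ne_zero γ.r γ.a).mono hsub)).mul hk).circleIntegrable zero_le_one
  have hc3 : CircleIntegrable (fun w => w⁻¹ * g.eval w⁻¹ *
      ((curveMap γ.r γ.a w ^ j)⁻¹ * deriv (curveMap γ.r γ.a) w)) 0 1 :=
    (((continuousOn_inv_ne_zero.mono hsub).mul ((continuousOn_eval_inv g).mono hsub)).mul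
      hk).circleIntegrable zero_le_one
  have hc12 : CircleIntegrable (fun w => conjCurve γ.r γ.a w *
      ((curveMap γ.r γ.a w ^ j)⁻¹ * deriv (curveMap γ.r γ.a) w) -
      (momentPoly n t).eval (curveMap γ.r γ.a w) *
      ((curveMap γ.r γ.a w ^ j)⁻¹ * deriv (curveMap γ.r γ.a) w)) 0 1 := hc1.sub hc2
  rw [circleIntegral.integral_congr zero_le_one h2, circleIntegral.integral_sub hc12 hc3,
    circleIntegral.integral_sub hc1 hc2, γ.circleIntegral_momentPoly hU h0 ht hj1,
    γ.circleIntegral_inv_mul_eval_inv_pow hU h0 g hj1,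
    (γ.harmonicMoment_eq_iff hj1 _).1 (hm j hj1), sub_self, sub_zero, eq_comm] at h1
  have hr : (γ.r : ℂ) ≠ 0 := by exact_mod_cast γ.r_pos.ne'
  have hpi : (2 * Real.pi * Complex.I : ℂ) ≠ 0 := by simp [Real.pi_ne_zero]
  have h3 := (mul_eq_zero.1 h1).resolve_left hpi
  have h4 : (γ.r : ℂ) / γ.r ^ (p.natDegree + 1) ≠ 0 := div_ne_zero hr (pow_ne_zero _ hr)
  exact Polynomial.leadingCoeff_eq_zero.1 ((mul_eq_zero.1 h3).resolve_right h4)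

end PolynomialCurve

/-! ### The equations for the coefficients -/

lemma circleIntegral_eval_mul_inv_pow (p : Polynomial ℂ) (k : ℕ) :
    ∮ w in C(0, 1), p.eval w * w⁻¹ ^ k * w⁻¹ = 2 * Real.pi * Complex.I * p.coeff k := by
  have h := circleIntegral_eval_mul_eval_inv p (Polynomial.X ^ k)
  simp only [Polynomial.eval_pow, Polynomial.eval_X, Polynomial.coeff_X_pow, mul_ite, mul_one,
    mul_zero] at h
  rw [h]
  congr 1
  rw [Finset.sum_ite_eq']
  split_ifs with hk
  · rfl
  · rw [Finset.mem_range, not_lt] at hk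
    exact (Polynomial.coeff_eq_zero_of_natDegree_lt (by omega)).symm

lemma circleIntegral_laurent_mul_inv_pow {f : ℂ → ℂ} {p q : Polynomial ℂ}
    (hf : ∀ w : ℂ, w ≠ 0 → f w = p.eval w + w⁻¹ * q.eval w⁻¹) (k : ℕ) :
    ∮ w in C(0, 1), f w * w⁻¹ ^ k * w⁻¹ = 2 * Real.pi * Complex.I * p.coeff k := by
  have h1 : ∀ w ∈ sphere (0 : ℂ) 1, f w * w⁻¹ ^ k * w⁻¹ = p.eval w * w⁻¹ ^ k * w⁻¹ +
      w ^ 0 * (q * Polynomial.X ^ (k + 1)).eval w⁻¹ * w⁻¹ := by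
    intro w hw
    rw [hf w (ne_zero_of_mem_circle hw)]
    simp only [Polynomial.eval_mul, Polynomial.eval_pow, Polynomial.eval_X]
    ring
  rw [circleIntegral.integral_congr zero_le_one h1, circleIntegral.integral_add,
    circleIntegral_eval_mul_inv_pow, circleIntegral_pow_mul_eval_inv]
  · simp
  · exact circleIntegrable_of_continuousOn_ne_zero ((p.continuous.continuousOn.mul
      (continuousOn_inv_ne_zero.pow k)).mul continuousOn_inv_ne_zero)
  · exact circleIntegrable_of_continuousOn_ne_zero (((continuousOn_id.pow 0).mul
      (continuousOn_eval_inv _)).mul continuousOn_inv_ne_zero)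

/-- The condition says that h̄(1/w) and P(h(w)) have the same coefficients at wʲ for all j ≥ 0; in
the former this coefficient is the conjugate of a_j. -/
lemma exists_hasSchwarzPoly_iff (r : ℝ) (a P : Polynomial ℂ) :
    (∃ g, HasSchwarzPoly r a P g) ↔ ∀ j : ℕ,
      2 * Real.pi * Complex.I * (starRingEnd ℂ) (a.coeff j) =
        ∮ w in C(0, 1), P.eval (curveMap r a w) * w⁻¹ ^ j * w⁻¹ := by
  have hpi : (2 * Real.pi * Complex.I : ℂ) ≠ 0 := by simp [Real.pi_ne_zero]
  constructor
  · rintro ⟨g, hg⟩ j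
    have h1 : ∀ w : ℂ, w ≠ 0 → P.eval (curveMap r a w) =
        (a.map (starRingEnd ℂ)).eval w + w⁻¹ * (Polynomial.C (r : ℂ) - g).eval w⁻¹ := by
      intro w hw
      have := hg w hw
      rw [conjCurve] at this
      simp only [Polynomial.eval_sub, Polynomial.eval_C]
      linear_combination -this
    rw [circleIntegral_laurent_mul_inv_pow h1 j, Polynomial.coeff_map]
  · intro h
    obtain ⟨p, q, hpq⟩ := ((isLaurent_curveMap r a).polynomial_comp P).exists_decomposition
    have hp : p = a.map (starRingEnd ℂ) := by
      ext j
      have h1 := h j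
      rw [circleIntegral_laurent_mul_inv_pow hpq j] at h1
      rw [Polynomial.coeff_map]
      exact (mul_left_cancel₀ hpi h1).symm
    refine ⟨Polynomial.C (r : ℂ) - q, fun w hw => ?_⟩
    rw [conjCurve, hpq w hw, hp]
    simp only [Polynomial.eval_sub, Polynomial.eval_C]
    ring

lemma circleIntegral_curveMap_pow_eq_zero (r : ℝ) (a : Polynomial ℂ) {m j : ℕ} (hmj : m < j) :
    ∮ w in C(0, 1), curveMap r a w ^ m * w⁻¹ ^ j * w⁻¹ = 0 := by
  obtain ⟨i, rfl⟩ := Nat.exists_eq_add_of_lt hmj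
  rw [circleIntegral_inv_comp]
  have h1 : ∀ u ∈ sphere (0 : ℂ) 1,
      (u ^ 2)⁻¹ * (curveMap r a u⁻¹ ^ m * u⁻¹⁻¹ ^ (m + i + 1) * u⁻¹⁻¹) =
        ((shiftPoly r a 0) ^ m * Polynomial.X ^ i).eval u := by
    intro u hu
    have hu0 := ne_zero_of_mem_circle hu
    simp only [Polynomial.eval_mul, Polynomial.eval_pow, Polynomial.eval_X]
    rw [eval_shiftPoly_of_ne_zero _ _ _ hu0, sub_zero, inv_inv, mul_pow]
    have h2 : (u ^ 2)⁻¹ * u ^ (m + i + 1) * u = u ^ m * u ^ i := by field_simp; ring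
    linear_combination (curveMap r a u⁻¹ ^ m) * h2
  rw [circleIntegral.integral_congr zero_le_one h1]
  exact circleIntegral_eq_zero_of_differentiableOn fun u _ => Polynomial.differentiableAt _

lemma circleIntegral_momentPoly_mul_inv_pow (r : ℝ) (a : Polynomial ℂ) (n : ℕ) (t : ℕ → ℂ)
    (j : ℕ) :
    ∮ w in C(0, 1), (momentPoly n t).eval (curveMap r a w) * w⁻¹ ^ j * w⁻¹ =
      ∑ k ∈ Finset.Icc 1 (n + 1), k * t k *
        ∮ w in C(0, 1), curveMap r a w ^ (k - 1) * w⁻¹ ^ j * w⁻¹ := by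
  have hc : ∀ k : ℕ, CircleIntegrable (fun w => (k : ℂ) * t k *
      (curveMap r a w ^ (k - 1) * w⁻¹ ^ j * w⁻¹)) 0 1 := fun k =>
    circleIntegrable_of_continuousOn_ne_zero (continuousOn_const.mul
      ((((continuousOn_curveMap_ne_zero _ _).pow _).mul (continuousOn_inv_ne_zero.pow j)).mul
        continuousOn_inv_ne_zero))
  have h1 : ∀ w : ℂ, (momentPoly n t).eval (curveMap r a w) * w⁻¹ ^ j * w⁻¹ =
      ∑ k ∈ Finset.Icc 1 (n + 1), k * t k * (curveMap r a w ^ (k - 1) * w⁻¹ ^ j * w⁻¹) := by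
    intro w
    rw [eval_momentPoly, Finset.sum_mul, Finset.sum_mul]
    exact Finset.sum_congr rfl fun k _ => by ring
  simp only [h1]
  rw [circleIntegral.integral_fun_sum fun k _ => hc k]
  simp only [circleIntegral.integral_const_mul]

/-- P has degree at most n, so P(h(w)) contains no power of w above wⁿ. This is where the degree
bound of the theorem comes from. -/
lemma natDegree_le_of_hasSchwarzPoly {r : ℝ} {a g : Polynomial ℂ} {n : ℕ} {t : ℕ → ℂ}
    (hS : HasSchwarzPoly r a (momentPoly n t) g) : a.natDegree ≤ n := by
  rw [Polynomial.natDegree_le_iff_coeff_eq_zero]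
  intro j hj
  have h1 := (exists_hasSchwarzPoly_iff r a _).1 ⟨g, hS⟩ j
  have hpi : (2 * Real.pi * Complex.I : ℂ) ≠ 0 := by simp [Real.pi_ne_zero]
  rw [circleIntegral_momentPoly_mul_inv_pow, Finset.sum_eq_zero] at h1
  · simpa using (mul_eq_zero.1 h1).resolve_left hpi
  · intro k hk
    rw [Finset.mem_Icc] at hk
    rw [circleIntegral_curveMap_pow_eq_zero r a (by omega), mul_zero]

/-- The polynomial `∑ b_j X^j`. -/
def coeffPoly (n : ℕ) (b : Fin (n + 1) → ℂ) : Polynomial ℂ :=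
  ∑ i, Polynomial.C (b i) * Polynomial.X ^ (i : ℕ)

/-- The polynomial `w^n (w + ∑ b_j w^{-j})`. -/
def numerator (n : ℕ) (b : Fin (n + 1) → ℂ) : Polynomial ℂ :=
  Polynomial.X ^ (n + 1) + ∑ i, Polynomial.C (b i) * Polynomial.X ^ (n - (i : ℕ))

/-- The coefficient of `w^j` in `(w + ∑ b_j w^{-j})^m`. -/
def laurentCoeff (n : ℕ) (b : Fin (n + 1) → ℂ) (m j : ℕ) : ℂ :=
  ((numerator n b) ^ m).coeff (n * m + j)

lemma coeff_coeffPoly (n : ℕ) (b : Fin (n + 1) → ℂ) (j : ℕ) :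
    (coeffPoly n b).coeff j = if h : j < n + 1 then b ⟨j, h⟩ else 0 := by
  rw [coeffPoly, Polynomial.finsetSum_coeff]
  simp only [Polynomial.coeff_C_mul, Polynomial.coeff_X_pow, mul_ite, mul_one, mul_zero]
  split_ifs with h
  · rw [Finset.sum_eq_single ⟨j, h⟩]
    · simp
    · intro i _ hi
      rw [if_neg]
      rintro rfl
      exact hi rfl
    · simp
  · refine Finset.sum_eq_zero fun i _ => if_neg ?_
    have := i.2
    omega

lemma natDegree_coeffPoly_le (n : ℕ) (b : Fin (n + 1) → ℂ) : (coeffPoly n b).natDegree ≤ n := by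
  rw [Polynomial.natDegree_le_iff_coeff_eq_zero]
  intro j hj
  rw [coeff_coeffPoly, dif_neg (by omega)]

lemma curveMap_coeffPoly (n : ℕ) (b : Fin (n + 1) → ℂ) {w : ℂ} (hw : w ≠ 0) :
    curveMap 1 (coeffPoly n b) w = (numerator n b).eval w * w⁻¹ ^ n := by
  simp only [curveMap, coeffPoly, numerator, Polynomial.eval_finsetSum, Polynomial.eval_add,
    Polynomial.eval_mul, Polynomial.eval_C, Polynomial.eval_pow, Polynomial.eval_X, add_mul,
    Finset.sum_mul, Complex.ofReal_one, one_mul]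
  congr 1
  · rw [pow_succ, mul_assoc, mul_comm w, ← mul_assoc, ← mul_pow, mul_inv_cancel₀ hw, one_pow,
      one_mul]
  · refine Finset.sum_congr rfl fun i _ => ?_
    have h1 : n = (n - (i : ℕ)) + i := by have := i.2; omega
    have h2 : w⁻¹ ^ n = w⁻¹ ^ (n - (i : ℕ)) * w⁻¹ ^ (i : ℕ) := by rw [← pow_add, ← h1]
    rw [h2, mul_assoc, ← mul_assoc (w ^ _), ← mul_pow, mul_inv_cancel₀ hw, one_pow, one_mul]

lemma circleIntegral_coeffPoly_pow (n : ℕ) (b : Fin (n + 1) → ℂ) (m j : ℕ) :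
    ∮ w in C(0, 1), curveMap 1 (coeffPoly n b) w ^ m * w⁻¹ ^ j * w⁻¹ =
      2 * Real.pi * Complex.I * laurentCoeff n b m j := by
  rw [laurentCoeff, ← circleIntegral_eval_mul_inv_pow]
  refine circleIntegral.integral_congr zero_le_one fun w hw => ?_
  rw [curveMap_coeffPoly n b (ne_zero_of_mem_circle hw), mul_pow, Polynomial.eval_pow, pow_add,
    ← pow_mul]
  ring

lemma coeff_numerator (n : ℕ) (b : Fin (n + 1) → ℂ) (i : ℕ) :
    (numerator n b).coeff i =
      (if i = n + 1 then 1 else 0) + ∑ k, b k * (if i = n - (k : ℕ) then 1 else 0) := by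
  simp [numerator, Polynomial.coeff_X_pow, Polynomial.finsetSum_coeff]

lemma laurentCoeff_one_zero (n : ℕ) (b : Fin (n + 1) → ℂ) : laurentCoeff n b 1 0 = b 0 := by
  rw [laurentCoeff, pow_one, coeff_numerator, if_neg (by omega), zero_add,
    Finset.sum_eq_single 0]
  · simp
  · intro k _ hk
    have : (k : ℕ) ≠ 0 := fun h => hk (Fin.ext h)
    have := k.2
    rw [if_neg (by omega), mul_zero]
  · simp

lemma laurentCoeff_one_of_ne_zero (n : ℕ) (b : Fin (n + 1) → ℂ) {j : ℕ} (hj : j ≠ 0) :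
    laurentCoeff n b 1 j = if j = 1 then 1 else 0 := by
  rw [laurentCoeff, pow_one, coeff_numerator, Finset.sum_eq_zero, add_zero]
  · congr 1
    rw [eq_iff_iff]
    omega
  · intro k _
    rw [if_neg (by omega), mul_zero]

lemma contDiff_laurentCoeff (n m j : ℕ) : ContDiff ℝ 1 fun b => laurentCoeff n b m j := by
  unfold laurentCoeff
  suffices h : ∀ i, ContDiff ℝ 1 fun b => ((numerator n b) ^ m).coeff i from h _
  induction m with
  | zero => intro i; simpa using contDiff_const
  | succ m ih =>
    intro i
    simp only [pow_succ, Polynomial.coeff_mul]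
    refine ContDiff.sum fun x _ => (ih _).mul ?_
    simp only [coeff_numerator]
    fun_prop

/-- The right-hand side of the equations `conj b_j = ∑ k t_k r^{k-2} [w^j] (w + ∑ b_i w^{-i})^{k-1}`
for the coefficients of the rescaled curve. -/
def coeffRHS (n : ℕ) (t : ℕ → ℂ) (r : ℝ) (b : Fin (n + 1) → ℂ) (j : ℕ) : ℂ :=
  ∑ k ∈ Finset.Icc 2 (n + 1), k * t k * (r : ℂ) ^ (k - 2) * laurentCoeff n b (k - 1) j

/-- In (r·)^(k-1) one factor r cancels against conj a_j = r conj b_j. Since t₁ = 0, only exponents k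
- 2 ≥ 0 remain, so the rescaled equations make sense at r = 0. -/
lemma exists_hasSchwarzPoly_coeffPoly_iff {n : ℕ} {t : ℕ → ℂ} (ht1 : t 1 = 0) {r : ℝ} (hr : 0 < r)
    (b : Fin (n + 1) → ℂ) :
    (∃ g, HasSchwarzPoly r (Polynomial.C (r : ℂ) * coeffPoly n b) (momentPoly n t) g) ↔
      ∀ j : Fin (n + 1), (starRingEnd ℂ) (b j) = coeffRHS n t r b j := by
  have hr0 : (r : ℂ) ≠ 0 := by exact_mod_cast hr.ne'
  have hpi : (2 * Real.pi * Complex.I : ℂ) ≠ 0 := by simp [Real.pi_ne_zero]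
  have hcm : ∀ w, curveMap r (Polynomial.C (r : ℂ) * coeffPoly n b) w =
      r * curveMap 1 (coeffPoly n b) w := by
    intro w
    simp only [curveMap, Polynomial.eval_mul, Polynomial.eval_C, Complex.ofReal_one]
    ring
  have hint : ∀ j : ℕ, ∮ w in C(0, 1),
      (momentPoly n t).eval (curveMap r (Polynomial.C (r : ℂ) * coeffPoly n b) w) * w⁻¹ ^ j * w⁻¹ =
      2 * Real.pi * Complex.I * (r * coeffRHS n t r b j) := by
    intro j
    rw [circleIntegral_momentPoly_mul_inv_pow, coeffRHS, Finset.mul_sum, Finset.mul_sum,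
      ← Finset.sum_Ioc_add_eq_sum_Icc (by omega : 1 ≤ n + 1)]
    simp only [ht1, mul_zero, zero_mul, add_zero]
    refine Finset.sum_congr ?_ fun k hk => ?_
    · ext k
      simp only [Finset.mem_Ioc, Finset.mem_Icc]
      omega
    · rw [Finset.mem_Icc] at hk
      have h1 : ∀ w : ℂ, curveMap r (Polynomial.C (r : ℂ) * coeffPoly n b) w ^ (k - 1) * w⁻¹ ^ j *
          w⁻¹ = (r : ℂ) ^ (k - 1) *
            (curveMap 1 (coeffPoly n b) w ^ (k - 1) * w⁻¹ ^ j * w⁻¹) := by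
        intro w
        rw [hcm, mul_pow]
        ring
      simp only [h1]
      rw [circleIntegral.integral_const_mul, circleIntegral_coeffPoly_pow,
        show k - 1 = (k - 2) + 1 by omega, pow_succ]
      ring
  rw [exists_hasSchwarzPoly_iff]
  constructor
  · intro h j
    have h1 := h j
    rw [hint, Polynomial.coeff_C_mul, map_mul, Complex.conj_ofReal, coeff_coeffPoly,
      dif_pos j.2] at h1
    exact mul_left_cancel₀ hr0 (mul_left_cancel₀ hpi h1)
  · intro h j
    rw [hint, Polynomial.coeff_C_mul, map_mul, Complex.conj_ofReal, coeff_coeffPoly]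
    split_ifs with hj
    · rw [h ⟨j, hj⟩]
    · rw [map_zero, mul_zero, mul_zero, coeffRHS, Finset.sum_eq_zero, mul_zero, mul_zero]
      intro k hk
      rw [Finset.mem_Icc] at hk
      have h1 := circleIntegral_curveMap_pow_eq_zero 1 (coeffPoly n b) (m := k - 1) (j := j)
        (by omega)
      rw [circleIntegral_coeffPoly_pow] at h1
      rw [(mul_eq_zero.1 h1).resolve_left hpi, mul_zero]

/-! ### Solving the equations for small area -/

/-- The higher-order part of `coeffRHS`. -/
def coeffHigher (n : ℕ) (t : ℕ → ℂ) (p : ℝ × (Fin (n + 1) → ℂ)) (j : Fin (n + 1)) : ℂ :=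
  ∑ k ∈ Finset.Icc 3 (n + 1), k * t k * (p.1 : ℂ) ^ (k - 3) * laurentCoeff n p.2 (k - 1) j

lemma coeffRHS_eq {n : ℕ} {t : ℕ → ℂ} (ht : ∀ k : ℕ, n + 1 < k → t k = 0) (r : ℝ)
    (b : Fin (n + 1) → ℂ) (j : Fin (n + 1)) :
    coeffRHS n t r b j = 2 * t 2 * laurentCoeff n b 1 j + r * coeffHigher n t (r, b) j := by
  rw [coeffRHS, coeffHigher]
  rcases Nat.eq_zero_or_pos n with hn | hn
  · subst hn
    simp [ht 2 (by omega)]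
  · rw [← Finset.sum_Ioc_add_eq_sum_Icc (by omega : 2 ≤ n + 1), add_comm, Finset.mul_sum]
    congr 1
    · simp
    · refine Finset.sum_congr ?_ fun k hk => ?_
      · ext k
        simp only [Finset.mem_Ioc, Finset.mem_Icc]
        omega
      · rw [Finset.mem_Icc] at hk
        rw [show k - 2 = (k - 3) + 1 by omega, pow_succ]
        ring

lemma contDiff_coeffHigher (n : ℕ) (t : ℕ → ℂ) : ContDiff ℝ 1 (coeffHigher n t) := by
  refine contDiff_pi.2 fun j => ?_
  unfold coeffHigher
  refine ContDiff.sum fun k _ => ContDiff.mul (contDiff_const.mul (ContDiff.pow ?_ _)) ?_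
  · exact Complex.ofRealCLM.contDiff.comp contDiff_fst
  · exact (contDiff_laurentCoeff n (k - 1) j).comp contDiff_snd

/-- The sum `∑ j |b_j|²`, the area deficit. -/
def areaDeficit (n : ℕ) (b : Fin (n + 1) → ℂ) : ℝ :=
  ∑ j : Fin (n + 1), ((j : ℕ) : ℝ) * ‖b j‖ ^ 2

lemma contDiff_areaDeficit (n : ℕ) : ContDiff ℝ 1 (areaDeficit n) := by
  unfold areaDeficit
  refine ContDiff.sum fun j _ => contDiff_const.mul ?_
  exact ContDiff.norm_sq ℝ (contDiff_apply ℝ ℂ j)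

/-- The coefficients of the limiting ellipse `w + 2 \bar t_2 / w`. -/
def ellipseCoeff (n : ℕ) (t : ℕ → ℂ) (j : Fin (n + 1)) : ℂ :=
  if (j : ℕ) = 1 then 2 * (starRingEnd ℂ) (t 2) else 0

lemma norm_ellipseCoeff_le (n : ℕ) (t : ℕ → ℂ) : ‖ellipseCoeff n t‖ ≤ 2 * ‖t 2‖ := by
  refine (pi_norm_le_iff_of_nonneg (by positivity)).2 fun j => ?_
  rw [ellipseCoeff]
  split_ifs
  · simp
  · simp

lemma areaDeficit_ellipseCoeff_le (n : ℕ) (t : ℕ → ℂ) :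
    areaDeficit n (ellipseCoeff n t) ≤ 4 * ‖t 2‖ ^ 2 := by
  rw [areaDeficit]
  cases n with
  | zero => simp
  | succ n =>
    rw [Finset.sum_eq_single ⟨1, by omega⟩]
    · simp [ellipseCoeff, mul_pow]
      norm_num
    · intro j _ hj
      have : (j : ℕ) ≠ 1 := fun h => hj (Fin.ext h)
      simp [ellipseCoeff, this]
    · simp

/-- The map whose fixed points are the coefficients of the rescaled curves. -/
def coeffMap (n : ℕ) (t : ℕ → ℂ) (r : ℝ) (b : Fin (n + 1) → ℂ) (j : Fin (n + 1)) : ℂ :=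
  (starRingEnd ℂ) (coeffRHS n t r b j)

lemma coeffMap_zero_ellipseCoeff {n : ℕ} {t : ℕ → ℂ} (ht : ∀ k : ℕ, n + 1 < k → t k = 0) :
    coeffMap n t 0 (ellipseCoeff n t) = ellipseCoeff n t := by
  ext j
  rw [coeffMap, coeffRHS_eq ht]
  simp only [Complex.ofReal_zero, zero_mul, add_zero, map_mul]
  by_cases hj : (j : ℕ) = 0
  · have : j = 0 := Fin.ext hj
    subst this
    simp [laurentCoeff_one_zero, ellipseCoeff]
  · rw [laurentCoeff_one_of_ne_zero _ _ hj, ellipseCoeff]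
    split_ifs
    · simp [Complex.conj_ofNat]
    · simp

lemma norm_laurentCoeff_one_sub_le (n : ℕ) (b c : Fin (n + 1) → ℂ) (j : ℕ) :
    ‖laurentCoeff n b 1 j - laurentCoeff n c 1 j‖ ≤ ‖b - c‖ := by
  by_cases hj : j = 0
  · subst hj
    rw [laurentCoeff_one_zero, laurentCoeff_one_zero]
    exact norm_le_pi_norm (b - c) 0
  · rw [laurentCoeff_one_of_ne_zero _ _ hj, laurentCoeff_one_of_ne_zero _ _ hj, sub_self, norm_zero]
    exact norm_nonneg _

/-- The term of t₂ is affine in b with Lipschitz constant at most 2|t₂| < 1. All other terms carry a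
factor r, so for small r they do not spoil the contraction on a given ball. -/
lemma exists_lipschitz_coeffMap {n : ℕ} {t : ℕ → ℂ} (ht2 : ‖t 2‖ < 1 / 2)
    (ht : ∀ k : ℕ, n + 1 < k → t k = 0) (R : ℝ) :
    ∃ r₁ > 0, ∃ L ≥ 0, ∃ q, 0 ≤ q ∧ q < 1 ∧ ∀ r ∈ Icc 0 r₁, ∀ s ∈ Icc 0 r₁,
      ∀ b ∈ closedBall (0 : Fin (n + 1) → ℂ) R, ∀ c ∈ closedBall (0 : Fin (n + 1) → ℂ) R,
      ‖coeffMap n t r b - coeffMap n t s c‖ ≤ q * ‖b - c‖ + L * |r - s| := by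
  have hcomp : IsCompact (Icc (0 : ℝ) 1 ×ˢ closedBall (0 : Fin (n + 1) → ℂ) R) :=
    isCompact_Icc.prod (isCompact_closedBall _ _)
  obtain ⟨K, hK⟩ := ((contDiff_coeffHigher n t).locallyLipschitz.locallyLipschitzOn
    ).exists_lipschitzOnWith_of_compact hcomp
  obtain ⟨M, hM⟩ := hcomp.exists_bound_of_continuousOn
    (contDiff_coeffHigher n t).continuous.continuousOn
  -- Half the gap: the contraction constant will be 1 - Q = 2|t₂| + Q, and the bound Q/(K + 1) on
  -- the parameter keeps the contribution of the higher terms below Q.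
  set Q := (1 - 2 * ‖t 2‖) / 2 with hQ
  have hQ0 : 0 < Q := by rw [hQ]; linarith
  have hK0 : (0 : ℝ) ≤ K := K.2
  refine ⟨min 1 (Q / (K + 1)), by positivity, max M 0 + K, by positivity, 1 - Q,
    by rw [hQ]; linarith [norm_nonneg (t 2)], by linarith, ?_⟩
  intro r hr s hs b hb c hc
  have hr1 : r ∈ Icc (0 : ℝ) 1 := ⟨hr.1, hr.2.trans (min_le_left _ _)⟩
  have hs1 : s ∈ Icc (0 : ℝ) 1 := ⟨hs.1, hs.2.trans (min_le_left _ _)⟩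
  have hsK : s * K ≤ Q := by
    have h1 : s ≤ Q / (K + 1) := hs.2.trans (min_le_right _ _)
    rw [le_div_iff₀ (by positivity)] at h1
    nlinarith [hs.1]
  have h1 := hK.dist_le_mul _ (mk_mem_prod hr1 hb) _ (mk_mem_prod hs1 hc)
  rw [dist_eq_norm, Prod.dist_eq, Real.dist_eq, dist_eq_norm] at h1
  have h2 := hM _ (mk_mem_prod hr1 hb)
  refine (pi_norm_le_iff_of_nonneg (by
    have := hQ0
    have : 0 ≤ 1 - Q := by rw [hQ]; linarith [norm_nonneg (t 2)]
    positivity)).2 fun j => ?_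
  have h3 : (coeffMap n t r b - coeffMap n t s c) j = (starRingEnd ℂ)
      (2 * t 2 * (laurentCoeff n b 1 j - laurentCoeff n c 1 j) +
        (((r : ℂ) - s) * coeffHigher n t (r, b) j +
          s * (coeffHigher n t (r, b) - coeffHigher n t (s, c)) j)) := by
    rw [Pi.sub_apply, coeffMap, coeffMap, ← map_sub, coeffRHS_eq ht, coeffRHS_eq ht, Pi.sub_apply]
    congr 1
    ring
  have h4 : ‖2 * t 2 * (laurentCoeff n b 1 j - laurentCoeff n c 1 j)‖ ≤ 2 * ‖t 2‖ * ‖b - c‖ := by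
    rw [norm_mul, norm_mul, Complex.norm_ofNat]
    gcongr
    exact norm_laurentCoeff_one_sub_le n b c j
  have h5 : ‖((r : ℂ) - s) * coeffHigher n t (r, b) j‖ ≤ |r - s| * max M 0 := by
    rw [norm_mul, ← Complex.ofReal_sub, Complex.norm_real, Real.norm_eq_abs]
    gcongr
    exact (norm_le_pi_norm _ j).trans (h2.trans (le_max_left _ _))
  have h6 : ‖(s : ℂ) * (coeffHigher n t (r, b) - coeffHigher n t (s, c)) j‖ ≤
      s * (K * (|r - s| + ‖b - c‖)) := by
    rw [norm_mul, Complex.norm_real, Real.norm_of_nonneg hs.1]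
    refine mul_le_mul_of_nonneg_left ((norm_le_pi_norm _ j).trans (h1.trans ?_)) hs.1
    refine mul_le_mul_of_nonneg_left (max_le ?_ ?_) hK0
    · linarith [norm_nonneg (b - c)]
    · linarith [abs_nonneg (r - s)]
  rw [h3, RCLike.norm_conj]
  refine (norm_add_le _ _).trans ((add_le_add h4 ((norm_add_le _ _).trans (add_le_add h5 h6))).trans
    ?_)
  have h7 : s * K * ‖b - c‖ ≤ Q * ‖b - c‖ := mul_le_mul_of_nonneg_right hsK (norm_nonneg _)
  have h8 : s * K * |r - s| ≤ 1 * K * |r - s| := by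
    gcongr
    exact hs1.2
  have h9 : 1 - Q = 2 * ‖t 2‖ + Q := by rw [hQ]; ring
  rw [h9]
  nlinarith [norm_nonneg (b - c), abs_nonneg (r - s)]

/-- The contraction has a fixed point near the ellipse for each small r, unique in the ball of
radius R and Lipschitz in r. The area factor r²(1 - ∑ j|b_j|²) is continuous and strictly increasing
along this branch and zero at r = 0, so each small t₀ is attained once. -/
lemma exists_parameters {n : ℕ} {t : ℕ → ℂ} (ht2 : ‖t 2‖ < 1 / 2)
    (ht : ∀ k : ℕ, n + 1 < k → t k = 0) {R ε : ℝ} (hR : 2 ≤ R) (hε : 0 < ε) :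
    ∃ r₁ > 0, ∃ K > 0, ∃ δ > 0,
      (∀ t₀ : ℝ, 0 < t₀ → t₀ < δ → ∃ (r : ℝ) (b : Fin (n + 1) → ℂ), 0 < r ∧ r < r₁ ∧
        r ^ 2 ≤ K * t₀ ∧ ‖b - ellipseCoeff n t‖ ≤ ε ∧ ‖b‖ ≤ R ∧ coeffMap n t r b = b ∧
        r ^ 2 * (1 - areaDeficit n b) = t₀) ∧
      ∀ (r r' : ℝ) (b b' : Fin (n + 1) → ℂ), 0 < r → r < r₁ → 0 < r' → r' < r₁ → ‖b‖ ≤ R →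
        ‖b'‖ ≤ R → coeffMap n t r b = b → coeffMap n t r' b' = b' →
        r ^ 2 * (1 - areaDeficit n b) = r' ^ 2 * (1 - areaDeficit n b') → r = r' ∧ b = b' := by
  obtain ⟨r₂, hr₂, L, hL, q, hq0, hq1, hlip⟩ := exists_lipschitz_coeffMap ht2 ht R
  obtain ⟨S, hS⟩ := ((contDiff_areaDeficit n).locallyLipschitz.locallyLipschitzOn
    ).exists_lipschitzOnWith_of_compact (isCompact_closedBall (0 : Fin (n + 1) → ℂ) R)
  have hS0 : (0 : ℝ) ≤ S := S.2
  set e := ellipseCoeff n t with he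
  set ρ := min ε 1 with hρ
  have hρ0 : 0 < ρ := lt_min hε one_pos
  have heR : ‖e‖ ≤ 1 := (norm_ellipseCoeff_le n t).trans (by linarith)
  have hsub : closedBall e ρ ⊆ closedBall (0 : Fin (n + 1) → ℂ) R := by
    intro b hb
    rw [mem_closedBall, dist_eq_norm] at hb
    rw [mem_closedBall_zero_iff]
    have h1 := norm_add_le (b - e) e
    rw [sub_add_cancel] at h1
    have h2 : ρ ≤ 1 := min_le_right _ _
    linarith
  have heB : e ∈ closedBall (0 : Fin (n + 1) → ℂ) R := hsub (mem_closedBall_self hρ0.le)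
  have hfix := coeffMap_zero_ellipseCoeff ht
  -- A lower bound for the area factor of the limiting ellipse.
  set c₀ := 1 - 4 * ‖t 2‖ ^ 2 with hc₀
  have hc₀0 : 0 < c₀ := by rw [hc₀]; nlinarith [norm_nonneg (t 2)]
  have h1q : 0 < 1 - q := by linarith
  set L₀ := L / (1 - q) with hL₀
  have hL₀0 : 0 ≤ L₀ := by positivity
  -- The second bound lets the map preserve the ball of radius ρ around the ellipse; the third keeps
  -- the area deficit within c₀/2 of that of the ellipse.
  set r₁ := min r₂ (min ((1 - q) * ρ / (L + 1)) (c₀ / (2 * (S * L₀ + 1)))) with hr₁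
  have hr₁0 : 0 < r₁ := by positivity
  have hr₁2 : r₁ ≤ r₂ := min_le_left _ _
  have hIcc : ∀ r ∈ Icc 0 r₁, r ∈ Icc 0 r₂ := fun r hr => ⟨hr.1, hr.2.trans hr₁2⟩
  -- fixed points
  have hex : ∀ r ∈ Icc 0 r₁, ∃ b ∈ closedBall e ρ, coeffMap n t r b = b := by
    intro r hr
    have hmaps : MapsTo (coeffMap n t r) (closedBall e ρ) (closedBall e ρ) := by
      intro b hb
      have h1 := hlip r (hIcc r hr) 0 ⟨le_rfl, hr₂.le⟩ b (hsub hb) e heB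
      rw [hfix, sub_zero, abs_of_nonneg hr.1] at h1
      rw [mem_closedBall, dist_eq_norm] at hb ⊢
      have h2 : r ≤ (1 - q) * ρ / (L + 1) :=
        hr.2.trans ((min_le_right _ _).trans (min_le_left _ _))
      rw [le_div_iff₀ (by positivity)] at h2
      have h3 : q * ‖b - e‖ ≤ q * ρ := mul_le_mul_of_nonneg_left hb hq0
      have := hr.1
      nlinarith
    have hcontr : ContractingWith ⟨q, hq0⟩ (hmaps.restrict (coeffMap n t r) _ _) := by
      refine ⟨by exact_mod_cast hq1, LipschitzWith.of_dist_le_mul fun x y => ?_⟩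
      have h1 := hlip r (hIcc r hr) r (hIcc r hr) x (hsub x.2) y (hsub y.2)
      rw [sub_self, abs_zero, mul_zero, add_zero] at h1
      rw [Subtype.dist_eq, Subtype.dist_eq, dist_eq_norm, dist_eq_norm]
      exact h1
    obtain ⟨b, hb, hfb, -⟩ := hcontr.exists_fixedPoint' isClosed_closedBall.isComplete hmaps
      (mem_closedBall_self hρ0.le) (edist_ne_top _ _)
    exact ⟨b, hb, hfb⟩
  have hdist : ∀ r ∈ Icc 0 r₁, ∀ s ∈ Icc 0 r₁, ∀ b ∈ closedBall (0 : Fin (n + 1) → ℂ) R,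
      ∀ c ∈ closedBall (0 : Fin (n + 1) → ℂ) R, coeffMap n t r b = b → coeffMap n t s c = c →
      ‖b - c‖ ≤ L₀ * |r - s| := by
    intro r hr s hs b hb c hc hfb hfc
    have h1 := hlip r (hIcc r hr) s (hIcc s hs) b hb c hc
    rw [hfb, hfc] at h1
    rw [hL₀, div_mul_eq_mul_div, le_div_iff₀ h1q]
    linarith
  have hdef : ∀ r ∈ Icc 0 r₁, ∀ s ∈ Icc 0 r₁, ∀ b ∈ closedBall (0 : Fin (n + 1) → ℂ) R,
      ∀ c ∈ closedBall (0 : Fin (n + 1) → ℂ) R, coeffMap n t r b = b → coeffMap n t s c = c →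
      |areaDeficit n b - areaDeficit n c| ≤ S * L₀ * |r - s| := by
    intro r hr s hs b hb c hc hfb hfc
    have h1 := hS.dist_le_mul _ hb _ hc
    rw [Real.dist_eq, dist_eq_norm] at h1
    have h2 := mul_le_mul_of_nonneg_left (hdist r hr s hs b hb c hc hfb hfc) hS0
    linarith
  have hSL : ∀ r ∈ Icc 0 r₁, S * L₀ * r ≤ c₀ / 2 := by
    intro r hr
    have h2 : r ≤ c₀ / (2 * (S * L₀ + 1)) :=
      hr.2.trans ((min_le_right _ _).trans (min_le_right _ _))
    rw [le_div_iff₀ (by positivity)] at h2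
    nlinarith [hr.1]
  have hpos : ∀ r ∈ Icc 0 r₁, ∀ b ∈ closedBall (0 : Fin (n + 1) → ℂ) R, coeffMap n t r b = b →
      c₀ / 2 ≤ 1 - areaDeficit n b := by
    intro r hr b hb hfb
    have h1 := hdef r hr 0 ⟨le_rfl, hr₁0.le⟩ b hb e heB hfb hfix
    rw [sub_zero, abs_of_nonneg hr.1] at h1
    have h2 := (le_abs_self _).trans (h1.trans (hSL r hr))
    have h3 := areaDeficit_ellipseCoeff_le n t
    rw [← he] at h3
    linarith
  -- Passing from s to r gains at least (r² - s²)c₀/2, while the change of the deficit costs at most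
  -- s² S L₀ (r - s) ≤ s(r - s)c₀/2. The balance is at least r(r - s)c₀/2.
  have hmono : ∀ r ∈ Icc 0 r₁, ∀ s ∈ Icc 0 r₁, ∀ b ∈ closedBall (0 : Fin (n + 1) → ℂ) R,
      ∀ c ∈ closedBall (0 : Fin (n + 1) → ℂ) R, coeffMap n t r b = b → coeffMap n t s c = c →
      s < r → s ^ 2 * (1 - areaDeficit n c) < r ^ 2 * (1 - areaDeficit n b) := by
    intro r hr s hs b hb c hc hfb hfc hsr
    have h1 := hdef r hr s hs b hb c hc hfb hfc
    rw [abs_of_pos (sub_pos.2 hsr)] at h1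
    have h2 := (le_abs_self _).trans h1
    have h3 := hpos r hr b hb hfb
    have h4 : s * (S * L₀ * s) ≤ s * (c₀ / 2) := mul_le_mul_of_nonneg_left (hSL s hs) hs.1
    have h5 : 0 < r - s := sub_pos.2 hsr
    have hr0 : 0 < r := hs.1.trans_lt hsr
    have h6 : (r ^ 2 - s ^ 2) * (c₀ / 2) ≤ (r ^ 2 - s ^ 2) * (1 - areaDeficit n b) :=
      mul_le_mul_of_nonneg_left h3 (by nlinarith [hs.1])
    have h7 : s ^ 2 * (areaDeficit n b - areaDeficit n c) ≤ s ^ 2 * (S * L₀ * (r - s)) :=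
      mul_le_mul_of_nonneg_left h2 (sq_nonneg s)
    have h8 : (r - s) * (s * (S * L₀ * s)) ≤ (r - s) * (s * (c₀ / 2)) :=
      mul_le_mul_of_nonneg_left h4 h5.le
    have h9 : 0 < (r - s) * r * (c₀ / 2) := by positivity
    nlinarith
  choose! β hβ hβfix using hex
  have hβR : ∀ r ∈ Icc 0 r₁, β r ∈ closedBall (0 : Fin (n + 1) → ℂ) R := fun r hr =>
    hsub (hβ r hr)
  have hβcont : ContinuousOn β (Icc 0 r₁) := by
    have : LipschitzOnWith ⟨L₀, hL₀0⟩ β (Icc 0 r₁) := by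
      refine LipschitzOnWith.of_dist_le_mul fun r hr s hs => ?_
      rw [dist_eq_norm, Real.dist_eq]
      exact hdist r hr s hs _ (hβR r hr) _ (hβR s hs) (hβfix r hr) (hβfix s hs)
    exact this.continuousOn
  have hTcont : ContinuousOn (fun r => r ^ 2 * (1 - areaDeficit n (β r))) (Icc 0 r₁) :=
    (continuousOn_id.pow 2).mul (continuousOn_const.sub
      ((contDiff_areaDeficit n).continuous.comp_continuousOn hβcont))
  -- Stopping at half the range makes the solutions satisfy the strict bound r < r₁.
  set ρ₁ := r₁ / 2 with hρ₁
  have hρ₁m : ρ₁ ∈ Icc 0 r₁ := ⟨by positivity, by rw [hρ₁]; linarith⟩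
  refine ⟨r₁, hr₁0, 2 / c₀, by positivity, ρ₁ ^ 2 * (1 - areaDeficit n (β ρ₁)), ?_, ?_, ?_⟩
  · have := hpos ρ₁ hρ₁m _ (hβR _ hρ₁m) (hβfix _ hρ₁m)
    have h1 : 0 < 1 - areaDeficit n (β ρ₁) := by linarith [half_pos hc₀0]
    positivity
  · intro t₀ ht₀ htδ
    have hivt := intermediate_value_Icc hρ₁m.1
      (hTcont.mono (Icc_subset_Icc_right hρ₁m.2))
    obtain ⟨r, hr, hrt⟩ := hivt (show t₀ ∈ Icc _ _ from ⟨by simpa using ht₀.le, htδ.le⟩)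
    have hr' : r ∈ Icc 0 r₁ := ⟨hr.1, hr.2.trans hρ₁m.2⟩
    have hr0 : 0 < r := by
      refine lt_of_le_of_ne hr.1 ?_
      rintro rfl
      simp at hrt
      linarith
    refine ⟨r, β r, hr0, ?_, ?_, ?_, ?_, hβfix r hr', hrt⟩
    · have := hr.2
      rw [hρ₁] at this
      linarith
    · have h1 := hpos r hr' _ (hβR _ hr') (hβfix _ hr')
      have h2 := mul_le_mul_of_nonneg_left h1 (sq_nonneg r)
      simp only at hrt
      rw [hrt] at h2
      rw [div_mul_eq_mul_div, le_div_iff₀ hc₀0]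
      linarith
    · have := hβ r hr'
      rw [mem_closedBall, dist_eq_norm] at this
      exact this.trans (min_le_left _ _)
    · simpa using hβR r hr'
  · intro r r' b b' hr0 hr hr0' hr' hb hb' hfb hfb' heq
    have hrm : r ∈ Icc 0 r₁ := ⟨hr0.le, hr.le⟩
    have hrm' : r' ∈ Icc 0 r₁ := ⟨hr0'.le, hr'.le⟩
    have hbm : b ∈ closedBall (0 : Fin (n + 1) → ℂ) R := by simpa using hb
    have hbm' : b' ∈ closedBall (0 : Fin (n + 1) → ℂ) R := by simpa using hb'
    have hrr : r = r' := by
      rcases lt_trichotomy r r' with h | h | h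
      · exact absurd heq (hmono r' hrm' r hrm b' hbm' b hbm hfb' hfb h).ne
      · exact h
      · exact absurd heq (hmono r hrm r' hrm' b hbm b' hbm' hfb hfb' h).ne'
    refine ⟨hrr, ?_⟩
    have h1 := hdist r hrm r' hrm' b hbm b' hbm' hfb hfb'
    rw [hrr, sub_self, abs_zero, mul_zero] at h1
    exact sub_eq_zero.1 (norm_le_zero_iff.1 h1)

/-! ### Curves with given moments -/

/-- The secant function of the curve map `w + ∑ b_j w^{-j}`. -/
def scaledSecant (n : ℕ) (b : Fin (n + 1) → ℂ) (u v : ℂ) : ℂ :=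
  1 - u * v * ∑ j : Fin (n + 1), b j * ∑ i ∈ Finset.range (j : ℕ), u ^ i * v ^ ((j : ℕ) - 1 - i)

/-- The polynomial `r ∑ b_j X^j`. -/
def scaledPoly (n : ℕ) (r : ℝ) (b : Fin (n + 1) → ℂ) : Polynomial ℂ :=
  Polynomial.C (r : ℂ) * coeffPoly n b

lemma coeff_scaledPoly (n : ℕ) (r : ℝ) (b : Fin (n + 1) → ℂ) (j : Fin (n + 1)) :
    (scaledPoly n r b).coeff j = r * b j := by
  rw [scaledPoly, Polynomial.coeff_C_mul, coeff_coeffPoly, dif_pos j.2]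

lemma natDegree_scaledPoly_le (n : ℕ) (r : ℝ) (b : Fin (n + 1) → ℂ) :
    (scaledPoly n r b).natDegree ≤ n :=
  (Polynomial.natDegree_C_mul_le _ _).trans (natDegree_coeffPoly_le n b)

lemma sum_range_natDegree {M : Type*} [AddCommMonoid M] {a : Polynomial ℂ} {n : ℕ}
    (ha : a.natDegree ≤ n) (f : ℕ → ℂ → M) (hf : ∀ j, f j 0 = 0) :
    ∑ j ∈ Finset.range (a.natDegree + 1), f j (a.coeff j) =
      ∑ j : Fin (n + 1), f j (a.coeff j) := by
  rw [← Finset.sum_range fun j => f j (a.coeff j)]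
  refine Finset.sum_subset ?_ fun j _ hj => ?_
  · exact Finset.range_subset_range.2 (by omega)
  · rw [Finset.mem_range, not_lt] at hj
    rw [Polynomial.coeff_eq_zero_of_natDegree_lt (by omega), hf]

lemma secant_scaledPoly (n : ℕ) (r : ℝ) (b : Fin (n + 1) → ℂ) (u v : ℂ) :
    secant r (scaledPoly n r b) u v = r * scaledSecant n b u v := by
  rw [secant, sum_range_natDegree (natDegree_scaledPoly_le n r b)
    (fun j c => c * ∑ i ∈ Finset.range j, u ^ i * v ^ (j - 1 - i)) (by simp), scaledSecant]
  simp only [coeff_scaledPoly, mul_sub, mul_one, Finset.mul_sum]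
  congr 1
  refine Finset.sum_congr rfl fun j _ => Finset.sum_congr rfl fun i _ => ?_
  ring

lemma area_scaledPoly (n : ℕ) (r : ℝ) (b : Fin (n + 1) → ℂ) :
    r ^ 2 - ∑ j ∈ Finset.range ((scaledPoly n r b).natDegree + 1),
      j * ‖(scaledPoly n r b).coeff j‖ ^ 2 = r ^ 2 * (1 - areaDeficit n b) := by
  rw [sum_range_natDegree (natDegree_scaledPoly_le n r b) (fun j c => (j : ℝ) * ‖c‖ ^ 2) (by simp),
    areaDeficit, mul_sub, mul_one, Finset.mul_sum]
  congr 1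
  refine Finset.sum_congr rfl fun j _ => ?_
  rw [coeff_scaledPoly, norm_mul, Complex.norm_real, mul_pow, Real.norm_eq_abs, sq_abs]
  ring

lemma scaledPoly_eq {n : ℕ} {a : Polynomial ℂ} (ha : a.natDegree ≤ n) {r : ℝ} (hr : r ≠ 0) :
    scaledPoly n r (fun j => a.coeff j / r) = a := by
  have hr' : (r : ℂ) ≠ 0 := by exact_mod_cast hr
  ext j
  rw [scaledPoly, Polynomial.coeff_C_mul, coeff_coeffPoly]
  split_ifs with h
  · field_simp
  · rw [Polynomial.coeff_eq_zero_of_natDegree_lt (by omega), mul_zero]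

lemma curveMap_scaledPoly (n : ℕ) (r : ℝ) (b : Fin (n + 1) → ℂ) (w : ℂ) :
    curveMap r (scaledPoly n r b) w = r * (w + ∑ j : Fin (n + 1), b j * w⁻¹ ^ (j : ℕ)) := by
  simp only [curveMap, scaledPoly, coeffPoly, Polynomial.eval_mul, Polynomial.eval_C,
    Polynomial.eval_finsetSum, Polynomial.eval_pow, Polynomial.eval_X]
  ring

lemma norm_scaledSecant_sub_le (n : ℕ) (b c : Fin (n + 1) → ℂ) {ρ : ℝ} (hρ : 1 ≤ ρ) {u v : ℂ}
    (hu : ‖u‖ ≤ ρ) (hv : ‖v‖ ≤ ρ) :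
    ‖scaledSecant n b u v - scaledSecant n c u v‖ ≤ (n + 1) ^ 2 * ρ ^ (n + 2) * ‖b - c‖ := by
  have h1 : scaledSecant n b u v - scaledSecant n c u v = -(u * v * ∑ j : Fin (n + 1), (b - c) j *
      ∑ i ∈ Finset.range (j : ℕ), u ^ i * v ^ ((j : ℕ) - 1 - i)) := by
    simp only [scaledSecant, Pi.sub_apply, sub_mul, Finset.sum_sub_distrib]
    ring
  have h2 : ∀ j : Fin (n + 1), ‖(b - c) j *
      ∑ i ∈ Finset.range (j : ℕ), u ^ i * v ^ ((j : ℕ) - 1 - i)‖ ≤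
      ‖b - c‖ * ((n + 1) * ρ ^ n) := by
    intro j
    rw [norm_mul]
    refine mul_le_mul (norm_le_pi_norm _ j) ?_ (norm_nonneg _) (norm_nonneg _)
    refine (norm_sum_le _ _).trans ((Finset.sum_le_sum (g := fun _ => ρ ^ n) fun i hi => ?_).trans
      ?_)
    · rw [Finset.mem_range] at hi
      rw [norm_mul, norm_pow, norm_pow]
      calc ‖u‖ ^ i * ‖v‖ ^ ((j : ℕ) - 1 - i) ≤ ρ ^ i * ρ ^ ((j : ℕ) - 1 - i) := by gcongr
        _ = ρ ^ ((j : ℕ) - 1) := by rw [← pow_add]; congr 1; omega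
        _ ≤ ρ ^ n := pow_le_pow_right₀ hρ (by omega)
    · rw [Finset.sum_const, Finset.card_range, nsmul_eq_mul]
      have : ((j : ℕ) : ℝ) ≤ n + 1 := by exact_mod_cast j.2.le
      gcongr
  have h3 := (norm_sum_le Finset.univ _).trans (Finset.sum_le_sum fun j _ => h2 j)
  rw [Finset.sum_const, Finset.card_univ, Fintype.card_fin, nsmul_eq_mul] at h3
  rw [h1, norm_neg, norm_mul, norm_mul]
  calc ‖u‖ * ‖v‖ * _ ≤ ρ * ρ * (((n + 1 : ℕ) : ℝ) * (‖b - c‖ * ((n + 1) * ρ ^ n))) := by gcongr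
    _ = (n + 1) ^ 2 * ρ ^ (n + 2) * ‖b - c‖ := by
      push_cast
      ring

lemma sum_ellipseCoeff_mul {n : ℕ} {t : ℕ → ℂ} (ht : ∀ k : ℕ, n + 1 < k → t k = 0) (f : ℕ → ℂ) :
    ∑ j : Fin (n + 1), ellipseCoeff n t j * f j = 2 * (starRingEnd ℂ) (t 2) * f 1 := by
  cases n with
  | zero => simp [ellipseCoeff, ht 2 (by omega)]
  | succ n =>
    rw [Finset.sum_eq_single ⟨1, by omega⟩]
    · simp [ellipseCoeff]
    · intro j _ hj
      have : (j : ℕ) ≠ 1 := fun h => hj (Fin.ext h)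
      simp [ellipseCoeff, this]
    · simp

lemma scaledSecant_ellipseCoeff {n : ℕ} {t : ℕ → ℂ} (ht : ∀ k : ℕ, n + 1 < k → t k = 0) (u v : ℂ) :
    scaledSecant n (ellipseCoeff n t) u v = 1 - 2 * (starRingEnd ℂ) (t 2) * (u * v) := by
  rw [scaledSecant, sum_ellipseCoeff_mul ht fun j =>
    ∑ i ∈ Finset.range j, u ^ i * v ^ (j - 1 - i)]
  simp
  ring

lemma norm_sum_mul_pow_le (n : ℕ) (b : Fin (n + 1) → ℂ) {u : ℂ} (hu : ‖u‖ ≤ 1) :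
    ‖∑ j : Fin (n + 1), b j * u ^ (j : ℕ)‖ ≤ (n + 1) * ‖b‖ := by
  refine (norm_sum_le _ _).trans ((Finset.sum_le_sum (g := fun _ => ‖b‖) fun j _ => ?_).trans ?_)
  · rw [norm_mul, norm_pow]
    exact (mul_le_of_le_one_right (norm_nonneg _) (pow_le_one₀ (norm_nonneg _) hu)).trans
      (norm_le_pi_norm b j)
  · simp

/-- Closeness to the limiting ellipse that makes the curve univalent. -/
def IsNearEllipse (n : ℕ) (t : ℕ → ℂ) (b : Fin (n + 1) → ℂ) : Prop :=
  (n + 1) ^ 2 * ‖b - ellipseCoeff n t‖ < 1 - 2 * ‖t 2‖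

section

variable {n : ℕ} {t : ℕ → ℂ} {b : Fin (n + 1) → ℂ} {r : ℝ}

/-- For the ellipse the secant function is 1 - 2 t̄₂ u v, of modulus at least 1 - 2|t₂| on the
bidisc, and the perturbation is smaller than that. -/
lemma isExteriorUnivalent_scaledPoly (ht : ∀ k : ℕ, n + 1 < k → t k = 0)
    (hb : IsNearEllipse n t b) (hr : 0 < r) : IsExteriorUnivalent r (scaledPoly n r b) := by
  intro u hu v hv h
  rw [mem_closedBall_zero_iff] at hu hv
  rw [secant_scaledPoly, mul_eq_zero, or_iff_right (by exact_mod_cast hr.ne')] at h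
  have h1 := norm_scaledSecant_sub_le n b (ellipseCoeff n t) le_rfl hu hv
  rw [h, scaledSecant_ellipseCoeff ht, one_pow, mul_one, zero_sub, norm_neg] at h1
  have h2 := norm_sub_norm_le (1 : ℂ) (2 * (starRingEnd ℂ) (t 2) * (u * v))
  rw [norm_one, norm_mul, norm_mul, norm_mul, RCLike.norm_conj, Complex.norm_ofNat] at h2
  have h3 : ‖u‖ * ‖v‖ ≤ 1 := mul_le_one₀ hu (norm_nonneg _) hv
  have h4 := mul_le_mul_of_nonneg_left h3 (by positivity : 0 ≤ 2 * ‖t 2‖)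
  unfold IsNearEllipse at hb
  linarith

/-- Since D₊ is the complement of h({|w| ≥ 1}), this puts the origin into D₊. -/
lemma curveMap_scaledPoly_ne_zero (ht : ∀ k : ℕ, n + 1 < k → t k = 0)
    (hb : IsNearEllipse n t b) (hr : 0 < r) {w : ℂ} (hw : 1 ≤ ‖w‖) :
    curveMap r (scaledPoly n r b) w ≠ 0 := by
  intro h
  rw [curveMap_scaledPoly, mul_eq_zero, or_iff_right (by exact_mod_cast hr.ne')] at h
  have hw1 : ‖w⁻¹‖ ≤ 1 := by rw [norm_inv]; exact inv_le_one_of_one_le₀ hw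
  have h1 := norm_sum_mul_pow_le n (b - ellipseCoeff n t) hw1
  simp only [Pi.sub_apply, sub_mul, Finset.sum_sub_distrib] at h1
  rw [sum_ellipseCoeff_mul ht fun j => w⁻¹ ^ j, eq_neg_of_add_eq_zero_right h, pow_one,
    ← neg_add', norm_neg] at h1
  have h2 := norm_sub_norm_le w (-(2 * (starRingEnd ℂ) (t 2) * w⁻¹))
  rw [sub_neg_eq_add, norm_neg, norm_mul, norm_mul, RCLike.norm_conj, Complex.norm_ofNat] at h2
  have h4 := mul_le_mul_of_nonneg_left hw1 (by positivity : 0 ≤ 2 * ‖t 2‖)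
  have h5 : ((n : ℝ) + 1) * ‖b - ellipseCoeff n t‖ ≤ (n + 1) ^ 2 * ‖b - ellipseCoeff n t‖ := by
    refine mul_le_mul_of_nonneg_right ?_ (norm_nonneg _)
    nlinarith [(Nat.cast_nonneg n : (0 : ℝ) ≤ n)]
  unfold IsNearEllipse at hb
  linarith

/-- The polynomial curve `r (w + ∑ b_j w^{-j})`. -/
def scaledCurve (ht : ∀ k : ℕ, n + 1 < k → t k = 0) (hb : IsNearEllipse n t b) (hr : 0 < r) :
    PolynomialCurve where
  r := r
  a := scaledPoly n r b
  r_pos := hr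
  injOn := (isExteriorUnivalent_scaledPoly ht hb hr).injOn.mono PolynomialCurve.sphere_subset
  deriv_ne_zero := fun w hw => by
    have hw1 : 1 ≤ ‖w‖ := PolynomialCurve.sphere_subset hw
    rw [deriv_curveMap _ _ (ne_zero_of_one_le_norm hw1)]
    exact (isExteriorUnivalent_scaledPoly ht hb hr).secant_inv_ne_zero hw1

lemma hasMoments_scaledCurve (ht1 : t 1 = 0) (ht : ∀ k : ℕ, n + 1 < k → t k = 0)
    (hb : IsNearEllipse n t b) (hr : 0 < r) (hfix : coeffMap n t r b = b) {t₀ : ℝ}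
    (harea : r ^ 2 * (1 - areaDeficit n b) = t₀) : (scaledCurve ht hb hr).HasMoments t₀ t := by
  have hU : IsExteriorUnivalent (scaledCurve ht hb hr).r (scaledCurve ht hb hr).a :=
    isExteriorUnivalent_scaledPoly ht hb hr
  have h0 : (0 : ℂ) ∈ (scaledCurve ht hb hr).interiorDomain := by
    rw [PolynomialCurve.interiorDomain_eq _ hU, ← PolynomialCurve.image_curveMap_eq]
    rintro ⟨w, hw, h⟩
    exact curveMap_scaledPoly_ne_zero ht hb hr hw h
  refine ⟨PolynomialCurve.positivelyOriented_of_isExteriorUnivalent _ hU, h0, ?_, fun j hj => ?_⟩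
  · have h1 := PolynomialCurve.volume_interiorDomain_toReal _ hU
    rw [show (scaledCurve ht hb hr).a = scaledPoly n r b from rfl,
      show (scaledCurve ht hb hr).r = r from rfl, area_scaledPoly, harea] at h1
    rw [← h1, ENNReal.ofReal_toReal]
    exact (PolynomialCurve.isBounded_interiorDomain _ hU).measure_lt_top.ne
  · obtain ⟨g, hg⟩ := (exists_hasSchwarzPoly_coeffPoly_iff ht1 hr b).2 fun j => by
      rw [← hfix, coeffMap, Complex.conj_conj, hfix]
    exact PolynomialCurve.forall_harmonicMoment_of_hasSchwarzPoly _ hU h0 ht hg hj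

end

/-! ### Curves of small area are small -/

lemma circleIntegral_curveMap_mul_inv (r : ℝ) (a : Polynomial ℂ) :
    ∮ w in C(0, 1), curveMap r a w * w⁻¹ ^ 1 * w⁻¹ = 2 * Real.pi * Complex.I * r := by
  rw [circleIntegral_laurent_mul_inv_pow (p := Polynomial.C (r : ℂ) * Polynomial.X +
    Polynomial.C (a.coeff 0)) (q := a.divX)]
  · simp [Polynomial.coeff_C]
  · intro w _
    conv_lhs => rw [curveMap, ← a.divX_mul_X_add]
    simp
    ring

lemma circleIntegral_pow_mul_curveMap (r : ℝ) (a : Polynomial ℂ) (j : ℕ) :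
    ∮ w in C(0, 1), w ^ j * curveMap r a w * w⁻¹ = 2 * Real.pi * Complex.I * a.coeff j := by
  rw [← circleIntegral_pow_mul_eval_inv a j]
  have h0 : ∮ w in C(0, 1), (r : ℂ) * w ^ j = 0 :=
    circleIntegral_eq_zero_of_differentiableOn fun z _ => by fun_prop
  have h1 : ∮ w in C(0, 1), w ^ j * curveMap r a w * w⁻¹ =
      ∮ w in C(0, 1), ((r : ℂ) * w ^ j + w ^ j * a.eval w⁻¹ * w⁻¹) := by
    refine circleIntegral.integral_congr zero_le_one fun w hw => ?_
    have := ne_zero_of_mem_circle hw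
    simp only [curveMap]
    field_simp
  rw [h1, circleIntegral.integral_add, h0, zero_add]
  · exact circleIntegrable_of_continuousOn_ne_zero (by fun_prop)
  · exact circleIntegrable_of_continuousOn_ne_zero
      (((continuousOn_id.pow j).mul (continuousOn_eval_inv a)).mul continuousOn_inv_ne_zero)

lemma norm_le_of_circleIntegral {f : ℂ → ℂ} {B : ℝ} {c : ℂ}
    (hf : ∀ w ∈ sphere (0 : ℂ) 1, ‖f w‖ ≤ B)
    (h : ∮ w in C(0, 1), f w = 2 * Real.pi * Complex.I * c) : ‖c‖ ≤ B := by
  have h1 := circleIntegral.norm_integral_le_of_norm_le_const zero_le_one hf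
  rw [h, norm_mul, norm_mul, norm_mul, Complex.norm_I, Complex.norm_ofNat, Complex.norm_real,
    Real.norm_of_nonneg Real.pi_pos.le, mul_one] at h1
  exact le_of_mul_le_mul_left h1 (by positivity)

lemma norm_coeff_le_of_norm_curveMap_le {r B : ℝ} {a : Polynomial ℂ}
    (hB : ∀ w ∈ sphere (0 : ℂ) 1, ‖curveMap r a w‖ ≤ B) :
    |r| ≤ B ∧ ∀ j, ‖a.coeff j‖ ≤ B := by
  constructor
  · have := norm_le_of_circleIntegral (B := B) (fun w hw => ?_) (circleIntegral_curveMap_mul_inv r a)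
    · simpa using this
    · rw [mem_sphere_zero_iff_norm] at hw
      rw [norm_mul, norm_mul, norm_pow, norm_inv, hw]
      simpa using hB w (by simpa using hw)
  · intro j
    refine norm_le_of_circleIntegral (B := B) (fun w hw => ?_)
      (circleIntegral_pow_mul_curveMap r a j)
    rw [mem_sphere_zero_iff_norm] at hw
    rw [norm_mul, norm_mul, norm_pow, norm_inv, hw]
    simpa using hB w (by simpa using hw)

lemma exists_norm_momentPoly_le {n : ℕ} {t : ℕ → ℂ} (ht1 : t 1 = 0)
    (ht : ∀ k : ℕ, n + 1 < k → t k = 0) :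
    ∃ M ≥ 0, ∀ z : ℂ, ‖z‖ ≤ 1 → ‖(momentPoly n t).eval z‖ ≤ 2 * ‖t 2‖ * ‖z‖ + M * ‖z‖ ^ 2 := by
  refine ⟨∑ k ∈ Finset.Icc 3 (n + 1), k * ‖t k‖, by positivity, fun z hz => ?_⟩
  rw [eval_momentPoly]
  have h1 : ∑ k ∈ Finset.Icc 1 (n + 1), k * t k * z ^ (k - 1) =
      2 * t 2 * z + ∑ k ∈ Finset.Icc 3 (n + 1), k * t k * z ^ (k - 1) := by
    rcases Nat.eq_zero_or_pos n with rfl | hn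
    · simp [ht1, ht 2 (by omega)]
    · rw [← Finset.sum_Ioc_add_eq_sum_Icc (by omega : 1 ≤ n + 1), ht1,
        show Finset.Ioc 1 (n + 1) = Finset.Icc 2 (n + 1) from rfl,
        ← Finset.sum_Ioc_add_eq_sum_Icc (by omega : 2 ≤ n + 1),
        show Finset.Ioc 2 (n + 1) = Finset.Icc 3 (n + 1) from rfl]
      simp
      ring
  rw [h1]
  refine (norm_add_le _ _).trans (add_le_add (by simp) ?_)
  rw [Finset.sum_mul]
  refine (norm_sum_le _ _).trans (Finset.sum_le_sum fun k hk => ?_)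
  rw [Finset.mem_Icc] at hk
  rw [norm_mul, norm_mul, norm_pow, Complex.norm_natCast]
  exact mul_le_mul_of_nonneg_left (pow_le_pow_of_le_one (norm_nonneg _) hz (by omega))
    (by positivity)

namespace PolynomialCurve

variable (γ : PolynomialCurve)

/-- On the curve π(z̄ - P(z)) is the limit of the Cauchy transform from outside, and the latter is
bounded in terms of the area alone. -/
lemma norm_conj_sub_eval_le (hU : IsExteriorUnivalent γ.r γ.a) {P g : Polynomial ℂ}
    (hS : HasSchwarzPoly γ.r γ.a P g) {t₀ : ℝ} (ht : 0 < t₀)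
    (hvol : volume γ.interiorDomain = ENNReal.ofReal (Real.pi * t₀)) {z : ℂ} (hz : z ∈ γ.image) :
    ‖(starRingEnd ℂ) z - P.eval z‖ ≤ 3 * √t₀ := by
  obtain ⟨w, hw, rfl⟩ := hz
  have hw0 := ne_zero_of_mem_circle hw
  rw [h, conj_curveMap _ _ hw]
  have hc : ContinuousAt (fun w => ‖conjCurve γ.r γ.a w - P.eval (curveMap γ.r γ.a w)‖) w := by
    have hmem : {w : ℂ | w ≠ 0} ∈ 𝓝 w := isOpen_ne.mem_nhds hw0
    exact (((continuousOn_conjCurve γ.r γ.a).continuousAt hmem).sub (P.continuous.continuousAt.comp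
      ((continuousOn_curveMap_ne_zero γ.r γ.a).continuousAt hmem))).norm
  have hl : Tendsto (fun s : ℝ => (s : ℂ) * w) (𝓝[>] 1) (𝓝 w) := by
    have : Continuous fun s : ℝ => (s : ℂ) * w := by fun_prop
    have h2 := this.tendsto 1
    simp only [Complex.ofReal_one, one_mul] at h2
    exact h2.mono_left nhdsWithin_le_nhds
  refine le_of_tendsto (hc.tendsto.comp hl) ?_
  filter_upwards [self_mem_nhdsWithin] with s hs
  have hsw : 1 < ‖(s : ℂ) * w‖ := by
    rw [mem_sphere_zero_iff_norm] at hw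
    rw [norm_mul, hw, mul_one, Complex.norm_real]
    exact lt_of_lt_of_le hs (le_abs_self s)
  have h1 := γ.norm_cauchyTransform_le hU ht hvol (γ.h ((s : ℂ) * w))
  rw [γ.cauchyTransform_of_exterior hU hS hsw, norm_mul, Complex.norm_real,
    Real.norm_of_nonneg Real.pi_pos.le] at h1
  have h2 : Real.pi * ‖conjCurve γ.r γ.a (s * w) - P.eval (γ.h (s * w))‖ ≤
      Real.pi * (3 * √t₀) := by linarith
  exact le_of_mul_le_mul_left h2 Real.pi_pos

lemma isConnected_image : IsConnected γ.image := by
  refine IsConnected.image ?_ _ ((continuousOn_curveMap γ.r γ.a).mono sphere_subset)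
  refine isConnected_sphere ?_ 0 zero_le_one
  rw [Complex.rank_real_complex]
  exact Nat.one_lt_ofNat

lemma ball_subset_interiorDomain {z : ℂ} (hz : z ∈ γ.interiorDomain) {c : ℝ} (hc : 0 < c)
    (hd : Disjoint (ball z c) γ.image) : ball z c ⊆ γ.interiorDomain := by
  intro x hx
  have hsub : ball z c ⊆ γ.imageᶜ := fun y hy => disjoint_left.1 hd hy
  refine ⟨hsub hx, ?_⟩
  have : x ∈ connectedComponentIn γ.imageᶜ z :=
    ((convex_ball z c).isPreconnected.subset_connectedComponentIn (mem_ball_self hc) hsub) hx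
  rw [← connectedComponentIn_eq this]
  exact hz.2

end PolynomialCurve

/-- Curves with the given moments and small area have diameter of the order of `√t₀`. -/
lemma exists_norm_curveMap_le {n : ℕ} {t : ℕ → ℂ} (ht1 : t 1 = 0) (ht2 : ‖t 2‖ < 1 / 2)
    (ht : ∀ k : ℕ, n + 1 < k → t k = 0) :
    ∃ B > 0, ∃ δ > 0, ∀ t₀ : ℝ, 0 < t₀ → t₀ < δ → ∀ γ : PolynomialCurve, γ.HasMoments t₀ t →
      ∀ z ∈ γ.image, ‖z‖ ≤ B * √t₀ := by
  obtain ⟨M, hM0, hM⟩ := exists_norm_momentPoly_le ht1 ht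
  set κ := 1 - 2 * ‖t 2‖ with hκ
  have hκ0 : 0 < κ := by rw [hκ]; linarith
  set c := min 1 (κ / (2 * (M + 1))) with hc
  have hc0 : 0 < c := by positivity
  set B := 6 / κ with hB
  have hB0 : 0 < B := by positivity
  refine ⟨B, hB0, min (c ^ 2) ((c / B) ^ 2), by positivity, fun t₀ ht₀ hδ γ hγ z hz => ?_⟩
  have hU := γ.isExteriorUnivalent hγ.1
  obtain ⟨g, hg⟩ := γ.exists_hasSchwarzPoly_of_forall_harmonicMoment hU hγ.2.1 ht hγ.2.2.2
  have hsq : B * √t₀ < c := by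
    have h1 : t₀ < (c / B) ^ 2 := hδ.trans_le (min_le_right _ _)
    have h2 : √t₀ < c / B := by
      rw [Real.sqrt_lt' (by positivity)]
      exact h1
    rwa [lt_div_iff₀ hB0, mul_comm] at h2
  -- On the curve κ|z| - M|z|² ≤ 3√t₀. For |z| ≤ c the quadratic term is at most κ|z|/2, whence the
  -- constant B = 6/κ.
  have hsmall : ∀ z ∈ γ.image, ‖z‖ ≤ c → ‖z‖ ≤ B * √t₀ := by
    intro z hz hzc
    have h1 := γ.norm_conj_sub_eval_le hU hg ht₀ hγ.2.2.1 hz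
    have h2 := norm_sub_norm_le ((starRingEnd ℂ) z) ((momentPoly n t).eval z)
    rw [RCLike.norm_conj] at h2
    have h3 := hM z (hzc.trans (min_le_left _ _))
    have h4 : ‖z‖ * (2 * (M + 1)) ≤ κ := by
      have := hzc.trans (min_le_right _ _)
      rwa [le_div_iff₀ (by positivity)] at this
    rw [hB, div_mul_eq_mul_div, le_div_iff₀ hκ0]
    have h5 : M * ‖z‖ ^ 2 ≤ κ / 2 * ‖z‖ := by nlinarith [norm_nonneg z]
    rw [hκ] at h5 ⊢
    linarith
  -- Norms between B√t₀ and c do not occur, so by connectedness the curve lies entirely on one side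
  -- of the gap. If it lay beyond c, the disc of radius c would be contained in D₊ and the area
  -- would be too large.
  by_cases hcase : ∃ y ∈ γ.image, ‖y‖ ≤ c
  · by_contra hcon
    obtain ⟨y, hy, hyc⟩ := hcase
    have hzc : c < ‖z‖ := by
      by_contra h
      exact hcon (hsmall z hz (not_lt.1 h))
    obtain ⟨x, hx, hx1⟩ := γ.isConnected_image.isPreconnected.intermediate_value hy hz
      continuous_norm.continuousOn (show c ∈ Icc _ _ from ⟨hyc, hzc.le⟩)
    have := hsmall x hx hx1.le
    linarith
  · exfalso
    push Not at hcase
    have hsub : ball (0 : ℂ) c ⊆ γ.interiorDomain := by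
      refine γ.ball_subset_interiorDomain hγ.2.1 hc0 (disjoint_left.2 fun x hx hx' => ?_)
      rw [mem_ball_zero_iff] at hx
      exact (hcase x hx').not_gt hx
    have h1 := measure_mono (μ := volume) hsub
    rw [hγ.2.2.1, Complex.volume_ball] at h1
    have h2 : ENNReal.ofReal c ^ 2 * (NNReal.pi : ℝ≥0∞) = ENNReal.ofReal (Real.pi * c ^ 2) := by
      rw [mul_comm, ENNReal.ofReal_mul Real.pi_pos.le, ENNReal.ofReal_pow hc0.le]
      congr 1
      exact (ENNReal.ofReal_coe_nnreal (p := NNReal.pi)).symm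
    rw [h2, ENNReal.ofReal_le_ofReal_iff (by positivity)] at h1
    have h3 := le_of_mul_le_mul_left h1 Real.pi_pos
    exact absurd (h3.trans_lt (hδ.trans_le (min_le_left _ _))) (lt_irrefl _)

/-- The parameters of a curve with given moments. -/
lemma parameters_of_hasMoments {n : ℕ} {t : ℕ → ℂ} (ht1 : t 1 = 0)
    (ht : ∀ k : ℕ, n + 1 < k → t k = 0) {t₀ B : ℝ} (ht₀ : 0 < t₀) {γ : PolynomialCurve}
    (hγ : γ.HasMoments t₀ t) (hB : 0 < B) (hz : ∀ z ∈ γ.image, ‖z‖ ≤ B * √t₀) :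
    ∃ b : Fin (n + 1) → ℂ, γ.a = scaledPoly n γ.r b ∧ γ.r ≤ B * √t₀ ∧ ‖b‖ ≤ B ∧
      coeffMap n t γ.r b = b ∧ γ.r ^ 2 * (1 - areaDeficit n b) = t₀ := by
  have hU := γ.isExteriorUnivalent hγ.1
  obtain ⟨g, hg⟩ := γ.exists_hasSchwarzPoly_of_forall_harmonicMoment hU hγ.2.1 ht hγ.2.2.2
  have hr := γ.r_pos
  set b : Fin (n + 1) → ℂ := fun j => γ.a.coeff j / γ.r with hb
  have ha : scaledPoly n γ.r b = γ.a :=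
    scaledPoly_eq (natDegree_le_of_hasSchwarzPoly hg) hr.ne'
  obtain ⟨h1, h2⟩ := norm_coeff_le_of_norm_curveMap_le (r := γ.r) (a := γ.a) (B := B * √t₀)
    fun w hw => hz _ ⟨w, hw, rfl⟩
  have harea : γ.r ^ 2 * (1 - areaDeficit n b) = t₀ := by
    have h3 := γ.volume_interiorDomain_toReal hU
    rw [hγ.2.2.1, ENNReal.toReal_ofReal (by positivity)] at h3
    have h4 := mul_left_cancel₀ Real.pi_pos.ne' h3
    rw [← area_scaledPoly, ha, ← h4]
  -- The deficit is nonnegative. Thus division by r turns coefficients of size B√t₀ into a bound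
  -- independent of t₀.
  have hsqrt : √t₀ ≤ γ.r := by
    rw [Real.sqrt_le_left hr.le, ← harea]
    have : 0 ≤ areaDeficit n b := by
      unfold areaDeficit
      positivity
    nlinarith [sq_nonneg γ.r]
  refine ⟨b, ha.symm, (le_abs_self _).trans h1, ?_, ?_, harea⟩
  · refine (pi_norm_le_iff_of_nonneg hB.le).2 fun j => ?_
    rw [hb, norm_div, Complex.norm_real, Real.norm_of_nonneg hr.le, div_le_iff₀ hr]
    exact (h2 j).trans (mul_le_mul_of_nonneg_left hsqrt hB.le)
  · have h3 := (exists_hasSchwarzPoly_coeffPoly_iff (n := n) ht1 hr b).1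
      ⟨g, by rw [← scaledPoly, ha]; exact hg⟩
    ext j
    rw [coeffMap, ← h3, Complex.conj_conj]

lemma PolynomialCurve.ext_of_eq {γ γ' : PolynomialCurve} (hr : γ.r = γ'.r) (ha : γ.a = γ'.a) :
    γ = γ' := by
  cases γ
  cases γ'
  simp only at hr ha
  subst hr ha
  rfl

/-! ### The logarithmic potential of the interior domain -/

lemma abs_log_le_add_inv {x : ℝ} (hx : 0 ≤ x) : |Real.log x| ≤ x + x⁻¹ := by
  rcases hx.eq_or_lt with rfl | hx
  · simp
  · rw [abs_le]
    have h1 := Real.log_le_sub_one_of_pos hx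
    have h2 := Real.log_le_sub_one_of_pos (inv_pos.2 hx)
    rw [Real.log_inv] at h2
    have := inv_pos.2 hx
    constructor <;> linarith

lemma integrableOn_log_norm_sub {S : Set ℂ} (hS : MeasurableSet S) (hb : Bornology.IsBounded S)
    (z : ℂ) : IntegrableOn (fun ζ => Real.log ‖z - ζ‖) S := by
  have hfin : volume S ≠ ∞ := hb.measure_lt_top.ne
  have h1 : IntegrableOn (fun ζ => ‖z - ζ‖) S := by
    have hc : IntegrableOn (fun ζ : ℂ => ‖z - ζ‖) (closure S) :=
      ContinuousOn.integrableOn_compact (Metric.isCompact_of_isClosed_isBounded isClosed_closure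
        hb.closure) (by fun_prop)
    exact hc.mono_set subset_closure
  refine (h1.add (integrableOn_inv_sub hS hfin z).norm).mono' ?_ ?_
  · exact (Real.measurable_log.comp (by fun_prop : Measurable fun ζ : ℂ => ‖z - ζ‖)
      ).aestronglyMeasurable
  · refine Eventually.of_forall fun ζ => ?_
    rw [Real.norm_eq_abs, Pi.add_apply, norm_inv]
    exact abs_log_le_add_inv (norm_nonneg _)

lemma hasDerivAt_log_norm {f : ℝ → ℂ} {f' : ℂ} {s : ℝ} (hf : HasDerivAt f f' s) (h0 : f s ≠ 0) :
    HasDerivAt (fun s => Real.log ‖f s‖) ((f s)⁻¹ * f').re s := by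
  have h1 := (hf.norm_sq.log (by positivity)).const_mul (1 / 2)
  refine (h1.congr_of_eventuallyEq ?_).congr_deriv ?_
  · refine Eventually.of_forall fun s => ?_
    simp only [Real.log_pow]
    push_cast
    ring
  · rw [Complex.inner, ← Complex.normSq_eq_norm_sq, Complex.inv_def]
    simp only [Complex.mul_re, Complex.conj_re, Complex.conj_im, Complex.ofReal_re,
      Complex.ofReal_im, Complex.mul_im]
    field_simp
    ring

lemma volume_line_eq_zero (p d : ℂ) : volume {ζ : ℂ | ∃ s : ℝ, ζ = p + s * d} = 0 := by
  have h1 : {ζ : ℂ | ∃ s : ℝ, ζ = p + s * d} ⊆ line[ℝ, p, p + d] := by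
    rintro ζ ⟨s, rfl⟩
    have := AffineMap.lineMap_mem_affineSpan_pair (k := ℝ) s p (p + d)
    rwa [AffineMap.lineMap_apply, vsub_eq_sub, add_sub_cancel_left, vadd_eq_add, Complex.real_smul,
      add_comm (_ * d) p] at this
  refine measure_mono_null h1 (Measure.addHaar_affineSubspace volume _ fun h => ?_)
  have h2 : Collinear ℝ ({p, p + d} : Set ℂ) := collinear_pair ℝ _ _
  rw [collinear_iff_finrank_le_one, ← direction_affineSpan, h, AffineSubspace.direction_top,
    finrank_top, Complex.finrank_real_complex] at h2
  omega

/-- The logarithmic potential of Lebesgue measure on a set. -/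
def logPotential (S : Set ℂ) (z : ℂ) : ℝ := ∫ ζ in S, Real.log ‖z - ζ‖

lemma integrable_prod_inv_sub {S : Set ℂ} (hS : MeasurableSet S) {t : ℝ} (ht : 0 < t)
    (hvol : volume S = ENNReal.ofReal (Real.pi * t)) (p d : ℂ) :
    Integrable (fun x : ℝ × ℂ => (p + x.1 * d - x.2)⁻¹)
      ((volume.restrict (Ioc (0 : ℝ) 1)).prod (volume.restrict S)) := by
  have hfin : volume S ≠ ∞ := by rw [hvol]; exact ENNReal.ofReal_ne_top
  have : IsFiniteMeasure (volume.restrict S) := ⟨by simpa using hfin.lt_top⟩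
  have hm : Measurable fun x : ℝ × ℂ => (p + x.1 * d - x.2)⁻¹ := by fun_prop
  refine (integrable_prod_iff hm.aestronglyMeasurable).2
    ⟨Eventually.of_forall fun s => integrableOn_inv_sub hS hfin (p + s * d), ?_⟩
  have hbd : ∀ s : ℝ, ‖∫ ζ in S, ‖(p + s * d - ζ)⁻¹‖‖ ≤ 3 * Real.pi * √t := by
    intro s
    rw [Real.norm_of_nonneg (integral_nonneg fun _ => norm_nonneg _)]
    simp only [norm_inv]
    exact integral_inv_norm_le hS ht hvol _
  have hm2 : AEStronglyMeasurable (fun s : ℝ => ∫ ζ in S, ‖(p + s * d - ζ)⁻¹‖)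
      (volume.restrict (Ioc (0 : ℝ) 1)) :=
    (hm.norm.stronglyMeasurable.integral_prod_right').aestronglyMeasurable
  exact Integrable.of_bound hm2 _ (Eventually.of_forall hbd)

/-- The derivative of log|z - ζ| is integrated along the segment and the integrals are exchanged;
points ζ on the line through the segment form a null set. The potential is thus controlled by the
Cauchy transform without differentiating a singular integral. -/
lemma logPotential_sub {S : Set ℂ} (hS : MeasurableSet S) (hb : Bornology.IsBounded S) {t : ℝ}
    (ht : 0 < t) (hvol : volume S = ENNReal.ofReal (Real.pi * t)) (p d : ℂ) :
    logPotential S (p + d) - logPotential S p =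
      ∫ s in (0 : ℝ)..1, ((∫ ζ in S, (p + s * d - ζ)⁻¹) * d).re := by
  have hfin : volume S ≠ ∞ := by rw [hvol]; exact ENNReal.ofReal_ne_top
  have : IsFiniteMeasure (volume.restrict S) := ⟨by simpa using hfin.lt_top⟩
  have hint : Integrable (fun x : ℝ × ℂ => ((p + x.1 * d - x.2)⁻¹ * d).re)
      ((volume.restrict (Ioc (0 : ℝ) 1)).prod (volume.restrict S)) :=
    ((integrable_prod_inv_sub hS ht hvol p d).mul_const d).re
  rw [logPotential, logPotential, ← integral_sub (integrableOn_log_norm_sub hS hb _)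
    (integrableOn_log_norm_sub hS hb _)]
  have h1 : ∀ᵐ ζ ∂(volume.restrict S), Real.log ‖p + d - ζ‖ - Real.log ‖p - ζ‖ =
      ∫ s in Ioc (0 : ℝ) 1, ((p + s * d - ζ)⁻¹ * d).re := by
    have hnull : ∀ᵐ ζ ∂(volume.restrict S), ζ ∉ {ζ : ℂ | ∃ s : ℝ, ζ = p + s * d} :=
      ae_restrict_of_ae (measure_eq_zero_iff_ae_notMem.1 (volume_line_eq_zero p d))
    filter_upwards [hnull] with ζ hζ
    have hne : ∀ s : ℝ, p + s * d - ζ ≠ 0 := fun s h => hζ ⟨s, (sub_eq_zero.1 h).symm⟩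
    have hd : ∀ s : ℝ, HasDerivAt (fun s : ℝ => p + (s : ℂ) * d - ζ) d s := fun s => by
      simpa using (((Complex.ofRealCLM.hasDerivAt (x := s)).mul_const d).const_add p).sub_const ζ
    rw [← intervalIntegral.integral_of_le zero_le_one,
      intervalIntegral.integral_eq_sub_of_hasDerivAt
        (f := fun s : ℝ => Real.log ‖p + (s : ℂ) * d - ζ‖)
        (fun s _ => hasDerivAt_log_norm (hd s) (hne s))]
    · simp
    · refine Continuous.intervalIntegrable ?_ _ _
      exact Complex.continuous_re.comp ((Continuous.inv₀ (by fun_prop) hne).mul continuous_const)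
  rw [integral_congr_ae h1, integral_integral_swap (f := fun (ζ : ℂ) (s : ℝ) => ((p + s * d - ζ)⁻¹ * d).re)
    hint.swap, intervalIntegral.integral_of_le zero_le_one]
  refine integral_congr_ae (Eventually.of_forall fun s => ?_)
  simp only
  rw [← integral_mul_const]
  exact integral_re ((integrableOn_inv_sub hS hfin _).mul_const d)

section potential

variable {S : Set ℂ} {t : ℝ}

lemma abs_logPotential_sub_le (hS : MeasurableSet S) (hb : Bornology.IsBounded S)
    (ht : 0 < t) (hvol : volume S = ENNReal.ofReal (Real.pi * t)) (p d : ℂ) :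
    |logPotential S (p + d) - logPotential S p| ≤ 3 * Real.pi * √t * ‖d‖ := by
  rw [logPotential_sub hS hb ht hvol, ← Real.norm_eq_abs]
  have h1 := intervalIntegral.norm_integral_le_of_norm_le_const (a := (0 : ℝ)) (b := 1)
    (f := fun s : ℝ => ((∫ ζ in S, (p + s * d - ζ)⁻¹) * d).re) (C := 3 * Real.pi * √t * ‖d‖)
    fun s _ => by
      refine (Complex.abs_re_le_norm _).trans ?_
      rw [norm_mul]
      refine mul_le_mul_of_nonneg_right ((norm_integral_le_integral_norm _).trans ?_)
        (norm_nonneg _)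
      simp only [norm_inv]
      exact integral_inv_norm_le hS ht hvol _
  simpa using h1

lemma continuous_logPotential (hS : MeasurableSet S) (hb : Bornology.IsBounded S)
    (ht : 0 < t) (hvol : volume S = ENNReal.ofReal (Real.pi * t)) :
    Continuous (logPotential S) := by
  have : LipschitzWith ⟨3 * Real.pi * √t, by positivity⟩ (logPotential S) := by
    refine LipschitzWith.of_dist_le_mul fun x y => ?_
    have h1 := abs_logPotential_sub_le hS hb ht hvol y (x - y)
    rw [add_sub_cancel] at h1
    rw [Real.dist_eq, dist_eq_norm]
    exact h1
  exact this.continuous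

lemma continuousAt_integral_inv_sub (hfin : volume S ≠ ∞) {z : ℂ}
    (hz : z ∉ closure S) : ContinuousAt (fun z => ∫ ζ in S, (z - ζ)⁻¹) z := by
  have : IsFiniteMeasure (volume.restrict S) := ⟨by simpa using hfin.lt_top⟩
  obtain ⟨δ, hδ, hball⟩ := Metric.mem_nhds_iff.1 (isClosed_closure.isOpen_compl.mem_nhds hz)
  have hne : ∀ ζ ∈ S, δ ≤ ‖z - ζ‖ := by
    intro ζ hζ
    by_contra h
    refine hball (?_ : ζ ∈ ball z δ) (subset_closure hζ)
    rw [mem_ball', dist_eq_norm]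
    exact not_le.1 h
  have hae : ∀ᵐ ζ ∂(volume.restrict S), δ ≤ ‖z - ζ‖ := by
    have h1 : MeasurableSet {ζ : ℂ | δ ≤ ‖z - ζ‖} :=
      (isClosed_le continuous_const (by fun_prop)).measurableSet
    exact (ae_restrict_iff h1).2 (Eventually.of_forall hne)
  refine continuousAt_of_dominated (bound := fun _ => (δ / 2)⁻¹)
    (Eventually.of_forall fun x => (by fun_prop : Measurable fun ζ : ℂ => (x - ζ)⁻¹
      ).aestronglyMeasurable) ?_ (integrable_const _) ?_
  · filter_upwards [ball_mem_nhds z (half_pos hδ)] with x hx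
    filter_upwards [hae] with ζ hζ
    rw [norm_inv]
    refine inv_anti₀ (half_pos hδ) ?_
    rw [mem_ball', dist_eq_norm] at hx
    have := norm_sub_le_norm_sub_add_norm_sub z x ζ
    linarith
  · filter_upwards [hae] with ζ hζ
    refine ContinuousAt.inv₀ (by fun_prop) fun h => ?_
    rw [h, norm_zero] at hζ
    linarith

lemma hasFDerivAt_logPotential (hS : MeasurableSet S) (hb : Bornology.IsBounded S)
    (ht : 0 < t) (hvol : volume S = ENNReal.ofReal (Real.pi * t)) {z : ℂ} (hz : z ∉ closure S) :
    HasFDerivAt (logPotential S)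
      (Complex.reCLM.comp ((∫ ζ in S, (z - ζ)⁻¹) • (1 : ℂ →L[ℝ] ℂ))) z := by
  have hfin : volume S ≠ ∞ := by rw [hvol]; exact ENNReal.ofReal_ne_top
  set C : ℂ → ℂ := fun z => ∫ ζ in S, (z - ζ)⁻¹ with hC
  have hcont : ContinuousAt C z := continuousAt_integral_inv_sub hfin hz
  rw [hasFDerivAt_iff_isLittleO_nhds_zero, Asymptotics.isLittleO_iff]
  intro c hc
  obtain ⟨δ, hδ, hball⟩ := Metric.continuousAt_iff.1 hcont c hc
  filter_upwards [ball_mem_nhds (0 : ℂ) hδ] with d hd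
  rw [mem_ball_zero_iff] at hd
  rw [logPotential_sub hS hb ht hvol]
  have hint : IntervalIntegrable (fun s : ℝ => (C (z + s * d) * d).re) volume 0 1 := by
    rw [intervalIntegrable_iff_integrableOn_Ioc_of_le zero_le_one]
    exact ((integrable_prod_inv_sub hS ht hvol z d).integral_prod_left.mul_const d).re
  have h1 : (∫ s in (0 : ℝ)..1, (C (z + s * d) * d).re) -
      (Complex.reCLM.comp (C z • (1 : ℂ →L[ℝ] ℂ))) d =
      ∫ s in (0 : ℝ)..1, ((C (z + s * d) - C z) * d).re := by
    simp only [sub_mul, Complex.sub_re]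
    rw [intervalIntegral.integral_sub hint intervalIntegrable_const]
    simp
  rw [h1]
  refine (intervalIntegral.norm_integral_le_of_norm_le_const (C := c * ‖d‖) fun s hs => ?_).trans
    (by simp)
  rw [uIoc_of_le zero_le_one] at hs
  refine (Complex.abs_re_le_norm _).trans ?_
  rw [norm_mul]
  refine mul_le_mul_of_nonneg_right ?_ (norm_nonneg _)
  have h2 := hball (x := z + s * d) (by
    rw [dist_eq_norm, add_sub_cancel_left, norm_mul, Complex.norm_real, Real.norm_of_nonneg hs.1.le]
    exact (mul_le_of_le_one_left (norm_nonneg _) hs.2).trans_lt hd)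
  rw [dist_eq_norm] at h2
  exact h2.le

end potential

/-! ### The effective potential -/

lemma hasDerivAt_scaledPotential (n : ℕ) (t : ℕ → ℂ) {p : ℝ → ℂ} {p' : ℂ} {s : ℝ}
    (hp : HasDerivAt p p' s) :
    HasDerivAt (fun s => scaledPotential n t (p s))
      (2 * (((starRingEnd ℂ) (p s) - (momentPoly n t).eval (p s)) * p').re) s := by
  have h1 : HasDerivAt (fun z : ℂ => ∑ k ∈ Finset.Icc 1 (n + 1), t k * z ^ k)
      ((momentPoly n t).eval (p s)) (p s) := by
    rw [eval_momentPoly]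
    refine (HasDerivAt.fun_sum (A' := fun k => t k * (k * (p s) ^ (k - 1))) fun k _ =>
      (hasDerivAt_pow k (p s)).const_mul (t k)).congr_deriv ?_
    refine Finset.sum_congr rfl fun k _ => ?_
    ring
  have h2 := Complex.reCLM.hasFDerivAt.comp_hasDerivAt s (h1.scomp s hp)
  refine (hp.norm_sq.sub (h2.const_mul 2)).congr_deriv ?_
  rw [Complex.inner, Complex.reCLM_apply, smul_eq_mul, sub_mul, Complex.sub_re, mul_sub,
    mul_comm p']
  congr 3
  ring

lemma continuous_scaledPotential (n : ℕ) (t : ℕ → ℂ) : Continuous (scaledPotential n t) := by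
  unfold scaledPotential
  fun_prop

/-- h̄(1/w) is the conjugate of h at the reflected point 1/w̄, so the difference is a secant between
w and its reflection; the factor w - 1/w̄ vanishes on the circle. -/
lemma conj_curveMap_sub_conjCurve (r : ℝ) (a : Polynomial ℂ) {w : ℂ} (hw : w ≠ 0) :
    (starRingEnd ℂ) (curveMap r a w) - conjCurve r a w =
      (starRingEnd ℂ) ((w - ((starRingEnd ℂ) w)⁻¹) * secant r a w⁻¹ ((starRingEnd ℂ) w)) := by
  have hw' : (starRingEnd ℂ) w ≠ 0 := (map_ne_zero _).2 hw
  have h1 := curveMap_sub_curveMap r a (inv_ne_zero hw) hw'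
  rw [inv_inv] at h1
  rw [← h1, map_sub]
  congr 1
  simp [curveMap, conjCurve, eval_map_conj]

namespace PolynomialCurve

variable (γ : PolynomialCurve)

/-- The potential `U` minus the logarithmic potential of the interior domain. -/
def effectivePotential (n : ℕ) (t : ℕ → ℂ) (z : ℂ) : ℝ :=
  scaledPotential n t z - 2 / Real.pi * logPotential γ.interiorDomain z

lemma notMem_closure_of_exterior (hU : IsExteriorUnivalent γ.r γ.a) {w : ℂ} (hw : 1 < ‖w‖) :
    γ.h w ∉ closure γ.interiorDomain := by
  intro h
  have hext : γ.h w ∈ γ.exteriorDomain := ⟨w, hw, rfl⟩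
  rcases γ.closure_interiorDomain_subset hU h with h | h
  · rw [γ.interiorDomain_eq hU] at h
    exact h (Or.inr hext)
  · exact disjoint_left.1 (γ.disjoint_image_exteriorDomain hU) h hext

section

variable {γ} {n : ℕ} {t : ℕ → ℂ} {g : Polynomial ℂ} {t₀ : ℝ}

lemma continuous_effectivePotential (hU : IsExteriorUnivalent γ.r γ.a) (ht₀ : 0 < t₀)
    (hvol : volume γ.interiorDomain = ENNReal.ofReal (Real.pi * t₀)) :
    Continuous (γ.effectivePotential n t) :=
  (continuous_scaledPotential n t).sub (continuous_const.mul (continuous_logPotential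
    (γ.isOpen_interiorDomain hU).measurableSet (γ.isBounded_interiorDomain hU) ht₀ hvol))

/-- Inside D₊ the derivative of U, given by z̄ - P(z), is cancelled by the Cauchy transform. The far
endpoint may lie on the boundary, which is how interior values get compared with the curve. -/
lemma effectivePotential_eq_of_segment (hU : IsExteriorUnivalent γ.r γ.a) (ht₀ : 0 < t₀)
    (hvol : volume γ.interiorDomain = ENNReal.ofReal (Real.pi * t₀))
    (hS : HasSchwarzPoly γ.r γ.a (momentPoly n t) g) {z d : ℂ}
    (hz : ∀ s : ℝ, 0 ≤ s → s < 1 → z + s * d ∈ γ.interiorDomain) :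
    γ.effectivePotential n t (z + d) = γ.effectivePotential n t z := by
  have h1 := logPotential_sub (γ.isOpen_interiorDomain hU).measurableSet
    (γ.isBounded_interiorDomain hU) ht₀ hvol z d
  have hd : ∀ s : ℝ, HasDerivAt (fun s : ℝ => z + (s : ℂ) * d) d s := fun s => by
    simpa using ((Complex.ofRealCLM.hasDerivAt (x := s)).mul_const d).const_add z
  have h2 := intervalIntegral.integral_eq_sub_of_hasDerivAt (a := (0 : ℝ)) (b := 1)
    (f := fun s : ℝ => scaledPotential n t (z + (s : ℂ) * d))
    (fun s _ => hasDerivAt_scaledPotential n t (hd s))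
    (Continuous.intervalIntegrable (by fun_prop) _ _)
  have h3 : ∫ s in (0 : ℝ)..1, ((∫ ζ in γ.interiorDomain, (z + s * d - ζ)⁻¹) * d).re =
      ∫ s in (0 : ℝ)..1, Real.pi / 2 * (2 * (((starRingEnd ℂ) (z + s * d) -
        (momentPoly n t).eval (z + s * d)) * d).re) := by
    refine intervalIntegral.integral_congr_ae ?_
    have hne : ∀ᵐ s : ℝ, s ≠ 1 := by simp [ae_iff]
    filter_upwards [hne] with s hs hs'
    rw [uIoc_of_le zero_le_one] at hs'
    have h4 := γ.cauchyTransform_of_mem_interiorDomain hU hS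
      (hz s hs'.1.le (lt_of_le_of_ne hs'.2 hs))
    rw [cauchyTransform] at h4
    rw [h4, mul_assoc, Complex.re_ofReal_mul]
    ring
  rw [h3, intervalIntegral.integral_const_mul, h2] at h1
  simp only [Complex.ofReal_one, Complex.ofReal_zero, one_mul, zero_mul, add_zero] at h1
  rw [effectivePotential, effectivePotential]
  have h5 : 2 / Real.pi * (logPotential γ.interiorDomain (z + d) - logPotential γ.interiorDomain z) =
      scaledPotential n t (z + d) - scaledPotential n t z := by
    rw [h1]
    field_simp
  linarith

lemma hasDerivAt_effectivePotential (hU : IsExteriorUnivalent γ.r γ.a) (ht₀ : 0 < t₀)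
    (hvol : volume γ.interiorDomain = ENNReal.ofReal (Real.pi * t₀))
    (hS : HasSchwarzPoly γ.r γ.a (momentPoly n t) g) {p : ℝ → ℂ} {p' : ℂ} {s : ℝ}
    (hp : HasDerivAt p p' s) (hw : 1 < ‖p s‖) :
    HasDerivAt (fun s => γ.effectivePotential n t (γ.h (p s)))
      (2 * ((starRingEnd ℂ) ((p s - ((starRingEnd ℂ) (p s))⁻¹) *
        secant γ.r γ.a (p s)⁻¹ ((starRingEnd ℂ) (p s))) *
        (p' * secant γ.r γ.a (p s)⁻¹ (p s)⁻¹)).re) s := by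
  have hw0 := ne_zero_of_one_le_norm hw.le
  have hq : HasDerivAt (fun s => γ.h (p s)) (p' * secant γ.r γ.a (p s)⁻¹ (p s)⁻¹) s := by
    have := (hasDerivAt_curveMap γ.r γ.a hw0).scomp s hp
    exact this
  have h1 := (hasFDerivAt_logPotential (γ.isOpen_interiorDomain hU).measurableSet
    (γ.isBounded_interiorDomain hU) ht₀ hvol (γ.notMem_closure_of_exterior hU hw)).comp_hasDerivAt
      s hq
  refine ((hasDerivAt_scaledPotential n t hq).sub (h1.const_mul (2 / Real.pi))).congr_deriv ?_
  have h2 := γ.cauchyTransform_of_exterior hU hS hw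
  rw [cauchyTransform] at h2
  rw [h2, ← conj_curveMap_sub_conjCurve _ _ hw0]
  simp only [ContinuousLinearMap.comp_apply, smul_apply, one_apply_eq_self, smul_eq_mul, Complex.reCLM_apply]
  rw [mul_assoc (Real.pi : ℂ), Complex.re_ofReal_mul]
  simp only [h]
  have hpi := Real.pi_ne_zero
  simp only [sub_mul, Complex.sub_re]
  field_simp
  ring

lemma sub_inv_conj {e : ℂ} (he : ‖e‖ = 1) {ρ : ℝ} :
    (ρ : ℂ) * e - ((starRingEnd ℂ) (ρ * e))⁻¹ = ((ρ - ρ⁻¹ : ℝ) : ℂ) * e := by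
  have h1 : (starRingEnd ℂ) e = e⁻¹ := conj_eq_inv_of_mem_sphere (by simpa using he)
  rw [map_mul, Complex.conj_ofReal, h1, mul_inv, inv_inv]
  push_cast
  ring

lemma exists_norm_secant_le (r : ℝ) (a : Polynomial ℂ) :
    ∃ M : ℝ, 0 ≤ M ∧ ∀ u v : ℂ, ‖u‖ ≤ 2 → ‖v‖ ≤ 2 → ‖secant r a u v‖ ≤ M := by
  obtain ⟨M, hM⟩ := ((isCompact_closedBall (0 : ℂ) 2).prod
    (isCompact_closedBall (0 : ℂ) 2)).exists_bound_of_continuousOn (continuous_secant r a).continuousOn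
  refine ⟨max M 0, le_max_right _ _, fun u v hu hv => (hM (u, v) ⟨?_, ?_⟩).trans (le_max_left _ _)⟩
  · simpa using hu
  · simpa using hv

/-- Along the image of the circle |w| = ρ > 1 the angular derivative is O(ρ - 1/ρ). As ρ → 1 the
oscillation disappears, so no differentiability of the potential on the curve itself is needed. -/
lemma effectivePotential_of_mem_sphere (hU : IsExteriorUnivalent γ.r γ.a) (ht₀ : 0 < t₀)
    (hvol : volume γ.interiorDomain = ENNReal.ofReal (Real.pi * t₀))
    (hS : HasSchwarzPoly γ.r γ.a (momentPoly n t) g) {e : ℂ} (he : e ∈ sphere (0 : ℂ) 1) :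
    γ.effectivePotential n t (γ.h e) = γ.effectivePotential n t (γ.h 1) := by
  obtain ⟨M, hM0, hM⟩ := exists_norm_secant_le γ.r γ.a
  rw [mem_sphere_zero_iff_norm] at he
  have hexp : Complex.exp (e.arg * Complex.I) = e := by
    have := Complex.norm_mul_exp_arg_mul_I e
    rwa [he, Complex.ofReal_one, one_mul] at this
  have hmain : ∀ ρ : ℝ, 1 < ρ → ρ ≤ 2 →
      |γ.effectivePotential n t (γ.h (ρ * e)) - γ.effectivePotential n t (γ.h (ρ * 1))| ≤
        2 * ((ρ - ρ⁻¹) * M * (ρ * M)) * |e.arg| := by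
    intro ρ h1 h2
    have hρ0 : 0 < ρ := by linarith
    have hinv : ρ⁻¹ ≤ 1 := inv_le_one_of_one_le₀ h1.le
    have hp : ∀ θ : ℝ, HasDerivAt (fun θ : ℝ => (ρ : ℂ) * Complex.exp (θ * Complex.I))
        (ρ * Complex.exp (θ * Complex.I) * Complex.I) θ := by
      intro θ
      have := ((Complex.ofRealCLM.hasDerivAt (x := θ)).mul_const Complex.I).cexp.const_mul (ρ : ℂ)
      simpa [mul_assoc] using this
    have hn : ∀ θ : ℝ, ‖(ρ : ℂ) * Complex.exp (θ * Complex.I)‖ = ρ := by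
      intro θ
      rw [norm_mul, Complex.norm_exp_ofReal_mul_I, mul_one, Complex.norm_real,
        Real.norm_of_nonneg hρ0.le]
    have h3 := convex_univ.norm_image_sub_le_of_norm_hasDerivWithin_le (𝕜 := ℝ)
      (f := fun θ : ℝ => γ.effectivePotential n t (γ.h ((ρ : ℂ) * Complex.exp (θ * Complex.I))))
      (C := 2 * ((ρ - ρ⁻¹) * M * (ρ * M))) (x := 0) (y := e.arg)
      (fun θ _ => (hasDerivAt_effectivePotential hU ht₀ hvol hS (hp θ)
        (by rw [hn]; exact h1)).hasDerivWithinAt) ?_ (mem_univ _) (mem_univ _)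
    · simp only [hexp, Complex.ofReal_zero, zero_mul, Complex.exp_zero, sub_zero] at h3
      exact h3
    · intro θ _
      rw [norm_mul, Real.norm_ofNat]
      refine mul_le_mul_of_nonneg_left ((Complex.abs_re_le_norm _).trans ?_) zero_le_two
      rw [sub_inv_conj (Complex.norm_exp_ofReal_mul_I θ)]
      have h4 : ‖(ρ * Complex.exp (θ * Complex.I))⁻¹‖ ≤ 2 := by
        rw [norm_inv, hn]; linarith
      have h5 : ‖(starRingEnd ℂ) (ρ * Complex.exp (θ * Complex.I))‖ ≤ 2 := by
        rw [RCLike.norm_conj, hn]; exact h2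
      rw [norm_mul, RCLike.norm_conj, norm_mul, norm_mul, norm_mul, norm_mul _ Complex.I,
        Complex.norm_exp_ofReal_mul_I, hn, Complex.norm_I, mul_one, mul_one, Complex.norm_real,
        Real.norm_of_nonneg (by linarith)]
      have h6 : 0 ≤ ρ - ρ⁻¹ := by linarith
      gcongr
      · exact hM _ _ h4 h5
      · exact hM _ _ h4 h4
  have hcont : ∀ e : ℂ, ‖e‖ = 1 → Tendsto (fun ρ : ℝ => γ.effectivePotential n t (γ.h (ρ * e)))
      (𝓝[>] 1) (𝓝 (γ.effectivePotential n t (γ.h e))) := by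
    intro e he
    have hce : ContinuousAt γ.h e := (hasDerivAt_curveMap γ.r γ.a
      (ne_zero_of_one_le_norm he.ge)).continuousAt
    have hl : Tendsto (fun s : ℝ => (s : ℂ) * e) (𝓝[>] 1) (𝓝 e) := by
      have : Continuous fun s : ℝ => (s : ℂ) * e := by fun_prop
      have h2 := this.tendsto 1
      simp only [Complex.ofReal_one, one_mul] at h2
      exact h2.mono_left nhdsWithin_le_nhds
    exact ((continuous_effectivePotential hU ht₀ hvol).continuousAt.tendsto.comp hce.tendsto).comp hl
  have hlim1 := ((hcont e he).sub (hcont 1 norm_one)).abs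
  have hlim2 : Tendsto (fun ρ : ℝ => 2 * ((ρ - ρ⁻¹) * M * (ρ * M)) * |e.arg|) (𝓝[>] 1) (𝓝 0) := by
    have : ContinuousAt (fun ρ : ℝ => 2 * ((ρ - ρ⁻¹) * M * (ρ * M)) * |e.arg|) 1 := by
      have : ContinuousAt (fun ρ : ℝ => ρ⁻¹) 1 := continuousAt_inv₀ one_ne_zero
      fun_prop
    have h2 := this.tendsto
    simp only [inv_one, sub_self, zero_mul, mul_zero] at h2
    exact h2.mono_left nhdsWithin_le_nhds
  have hle := le_of_tendsto_of_tendsto hlim1 hlim2 (by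
    filter_upwards [Ioc_mem_nhdsGT one_lt_two] with ρ hρ
    exact hmain ρ hρ.1 hρ.2)
  exact sub_eq_zero.1 (abs_nonpos_iff.1 hle)

/-- Connectedness of D₊ is not used: the horizontal ray from z is followed to its first exit point,
which lies on the curve, where the value is already known. -/
lemma effectivePotential_of_mem_interiorDomain (hU : IsExteriorUnivalent γ.r γ.a) (ht₀ : 0 < t₀)
    (hvol : volume γ.interiorDomain = ENNReal.ofReal (Real.pi * t₀))
    (hS : HasSchwarzPoly γ.r γ.a (momentPoly n t) g) {z : ℂ} (hz : z ∈ γ.interiorDomain) :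
    γ.effectivePotential n t z = γ.effectivePotential n t (γ.h 1) := by
  set T : Set ℝ := {s | 0 ≤ s ∧ z + s ∉ γ.interiorDomain} with hT
  have hcont : Continuous fun s : ℝ => z + (s : ℂ) := by fun_prop
  have hTc : IsClosed T := isClosed_Ici.inter
    ((γ.isOpen_interiorDomain hU).isClosed_compl.preimage hcont)
  have hTb : BddBelow T := ⟨0, fun s hs => hs.1⟩
  have hTne : T.Nonempty := by
    obtain ⟨R, hR0, hR⟩ := (γ.isBounded_interiorDomain hU).exists_pos_norm_le
    refine ⟨R + 1 + ‖z‖, by positivity, fun h => ?_⟩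
    have h1 := hR _ h
    have h2 := norm_sub_le (z + ((R + 1 + ‖z‖ : ℝ) : ℂ)) z
    rw [add_sub_cancel_left, Complex.norm_real, Real.norm_of_nonneg (by positivity)] at h2
    linarith
  have hs1 := hTc.csInf_mem hTne hTb
  set s₁ := sInf T
  have hlt : ∀ s : ℝ, 0 ≤ s → s < s₁ → z + s ∈ γ.interiorDomain := by
    intro s hs hss
    by_contra h
    exact (csInf_le hTb ⟨hs, h⟩).not_gt hss
  have hpos : 0 < s₁ := by
    refine lt_of_le_of_ne hs1.1 fun h => hs1.2 ?_
    rw [← h]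
    simpa using hz
  have hseg : ∀ s : ℝ, 0 ≤ s → s < 1 → z + s * (s₁ : ℂ) ∈ γ.interiorDomain := by
    intro s hs hs1
    have := hlt (s * s₁) (by positivity) (by nlinarith)
    rwa [Complex.ofReal_mul] at this
  rw [← effectivePotential_eq_of_segment hU ht₀ hvol hS hseg]
  have hcl : z + s₁ ∈ closure γ.interiorDomain := by
    have hmem : s₁ ∈ closure (Ico 0 s₁) := by
      rw [closure_Ico hpos.ne]
      exact ⟨hpos.le, le_rfl⟩
    exact map_mem_closure (f := fun s : ℝ => z + (s : ℂ)) hcont hmem fun s hs => hlt s hs.1 hs.2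
  obtain ⟨e, he, hee⟩ := (γ.closure_interiorDomain_subset hU hcl).resolve_left hs1.2
  rw [← hee]
  exact effectivePotential_of_mem_sphere hU ht₀ hvol hS he

end

end PolynomialCurve

/-! ### The effective potential outside the curve -/

lemma exists_norm_sum_le {n : ℕ} {t : ℕ → ℂ} (ht1 : t 1 = 0)
    (ht : ∀ k : ℕ, n + 1 < k → t k = 0) :
    ∃ M ≥ 0, ∀ z : ℂ, ‖z‖ ≤ 1 →
      ‖∑ k ∈ Finset.Icc 1 (n + 1), t k * z ^ k‖ ≤ ‖t 2‖ * ‖z‖ ^ 2 + M * ‖z‖ ^ 3 := by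
  refine ⟨∑ k ∈ Finset.Icc 3 (n + 1), ‖t k‖, by positivity, fun z hz => ?_⟩
  have h1 : ∑ k ∈ Finset.Icc 1 (n + 1), t k * z ^ k =
      t 2 * z ^ 2 + ∑ k ∈ Finset.Icc 3 (n + 1), t k * z ^ k := by
    rcases Nat.eq_zero_or_pos n with rfl | hn
    · simp [ht1, ht 2 (by omega)]
    · rw [← Finset.sum_Ioc_add_eq_sum_Icc (by omega : 1 ≤ n + 1), ht1,
        show Finset.Ioc 1 (n + 1) = Finset.Icc 2 (n + 1) from rfl,
        ← Finset.sum_Ioc_add_eq_sum_Icc (by omega : 2 ≤ n + 1),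
        show Finset.Ioc 2 (n + 1) = Finset.Icc 3 (n + 1) from rfl]
      ring
  rw [h1]
  refine (norm_add_le _ _).trans (add_le_add (by simp) ?_)
  rw [Finset.sum_mul]
  refine (norm_sum_le _ _).trans (Finset.sum_le_sum fun k hk => ?_)
  rw [Finset.mem_Icc] at hk
  rw [norm_mul, norm_pow]
  exact mul_le_mul_of_nonneg_left (pow_le_pow_of_le_one (norm_nonneg _) hz (by omega))
    (norm_nonneg _)

lemma exists_scaledPotential_le {n : ℕ} {t : ℕ → ℂ} (ht1 : t 1 = 0)
    (ht : ∀ k : ℕ, n + 1 < k → t k = 0) :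
    ∃ K ≥ 0, ∀ z : ℂ, ‖z‖ ≤ 1 → scaledPotential n t z ≤ K * ‖z‖ ^ 2 := by
  obtain ⟨M, hM0, hM⟩ := exists_norm_sum_le ht1 ht
  refine ⟨1 + 2 * (‖t 2‖ + M), by positivity, fun z hz => ?_⟩
  have h1 := hM z hz
  have h2 := (abs_le.1 (Complex.abs_re_le_norm (∑ k ∈ Finset.Icc 1 (n + 1), t k * z ^ k))).1
  have h3 : ‖z‖ ^ 3 ≤ ‖z‖ ^ 2 := pow_le_pow_of_le_one (norm_nonneg _) hz (by norm_num)
  have h4 := mul_le_mul_of_nonneg_left h3 hM0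
  rw [scaledPotential]
  linarith

/-- Near the origin |z|² - 2 Re(t₂z²) ≥ (1 - 2|t₂|)|z|² absorbs the higher terms; on the rest of D
the potential has a positive minimum by compactness. -/
lemma exists_le_scaledPotential {n : ℕ} {t : ℕ → ℂ} (ht1 : t 1 = 0) (ht2 : ‖t 2‖ < 1 / 2)
    (ht : ∀ k : ℕ, n + 1 < k → t k = 0) {D : Set ℂ} (hD : IsCompact D)
    (hpos : ∀ z ∈ D \ {0}, 0 < scaledPotential n t z) :
    ∃ c > 0, ∀ z ∈ D, c * ‖z‖ ^ 2 ≤ scaledPotential n t z := by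
  obtain ⟨M, hM0, hM⟩ := exists_norm_sum_le ht1 ht
  set κ := 1 - 2 * ‖t 2‖ with hκ
  have hκ0 : 0 < κ := by rw [hκ]; linarith
  set δ := min 1 (κ / (4 * (M + 1))) with hδ
  have hδ0 : 0 < δ := by positivity
  have hnear : ∀ z : ℂ, ‖z‖ ≤ δ → κ / 2 * ‖z‖ ^ 2 ≤ scaledPotential n t z := by
    intro z hz
    have h1 := hM z (hz.trans (min_le_left _ _))
    have h2 := (abs_le.1 (Complex.abs_re_le_norm (∑ k ∈ Finset.Icc 1 (n + 1), t k * z ^ k))).2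
    have h3 : ‖z‖ * (4 * (M + 1)) ≤ κ := by
      have := hz.trans (min_le_right _ _)
      rwa [le_div_iff₀ (by positivity)] at this
    have h4 : ‖z‖ ^ 2 * (M * ‖z‖) ≤ ‖z‖ ^ 2 * (κ / 4) :=
      mul_le_mul_of_nonneg_left (by linarith [norm_nonneg z]) (sq_nonneg _)
    rw [scaledPotential]
    rw [hκ] at h4 ⊢
    linarith
  obtain ⟨L, hL0, hL⟩ := hD.isBounded.exists_pos_norm_le
  have hfar : ∃ m > 0, ∀ z ∈ D, δ ≤ ‖z‖ → m ≤ scaledPotential n t z := by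
    have hK : IsCompact (D ∩ {z | δ ≤ ‖z‖}) :=
      hD.inter_right (isClosed_le continuous_const continuous_norm)
    rcases (D ∩ {z | δ ≤ ‖z‖}).eq_empty_or_nonempty with he | hne
    · exact ⟨1, one_pos, fun z hz hzδ => absurd (mem_inter hz hzδ)
        (eq_empty_iff_forall_notMem.1 he z)⟩
    · obtain ⟨x, hx, hmin⟩ := hK.exists_isMinOn hne (continuous_scaledPotential n t).continuousOn
      refine ⟨scaledPotential n t x, hpos x ⟨hx.1, fun h => ?_⟩, fun z hz hzδ => hmin ⟨hz, hzδ⟩⟩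
      have h1 : δ ≤ ‖x‖ := hx.2
      rw [mem_singleton_iff.1 h, norm_zero] at h1
      linarith
  obtain ⟨m, hm0, hm⟩ := hfar
  refine ⟨min (κ / 2) (m / L ^ 2), by positivity, fun z hz => ?_⟩
  rcases le_total ‖z‖ δ with h | h
  · exact (mul_le_mul_of_nonneg_right (min_le_left _ _) (sq_nonneg _)).trans (hnear z h)
  · refine le_trans ?_ (hm z hz h)
    calc min (κ / 2) (m / L ^ 2) * ‖z‖ ^ 2 ≤ m / L ^ 2 * L ^ 2 :=
          mul_le_mul (min_le_right _ _) (pow_le_pow_left₀ (norm_nonneg _) (hL z hz) 2)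
            (by positivity) (by positivity)
      _ = m := by field_simp

lemma logPotential_le {S : Set ℂ} (hS : MeasurableSet S) (hb : Bornology.IsBounded S) {t : ℝ}
    (ht : 0 < t) (hvol : volume S = ENNReal.ofReal (Real.pi * t)) {z : ℂ} {B : ℝ}
    (hB : ∀ ζ ∈ S, Real.log ‖z - ζ‖ ≤ B) : logPotential S z ≤ Real.pi * t * B := by
  have hfin : volume S ≠ ∞ := hb.measure_lt_top.ne
  have h1 := setIntegral_mono_on (integrableOn_log_norm_sub hS hb z)
    (integrableOn_const (C := B) hfin) hS hB
  rwa [setIntegral_const, smul_eq_mul, Measure.real, hvol,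
    ENNReal.toReal_ofReal (by positivity)] at h1

lemma le_logPotential {S : Set ℂ} (hS : MeasurableSet S) (hb : Bornology.IsBounded S) {t : ℝ}
    (ht : 0 < t) (hvol : volume S = ENNReal.ofReal (Real.pi * t)) {z : ℂ} {B : ℝ}
    (hB : ∀ ζ ∈ S, B ≤ Real.log ‖z - ζ‖) : Real.pi * t * B ≤ logPotential S z := by
  have hfin : volume S ≠ ∞ := hb.measure_lt_top.ne
  have h1 := setIntegral_mono_on (integrableOn_const (C := B) hfin)
    (integrableOn_log_norm_sub hS hb z) hS hB
  rwa [setIntegral_const, smul_eq_mul, Measure.real, hvol,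
    ENNReal.toReal_ofReal (by positivity)] at h1

lemma PolynomialCurve.norm_le_of_mem_interiorDomain {γ : PolynomialCurve} {m : ℝ}
    (hm : ∀ z ∈ γ.image, ‖z‖ ≤ m) {z : ℂ} (hz : z ∈ γ.interiorDomain) : ‖z‖ ≤ m := by
  by_contra! h
  have hm0 : 0 ≤ m := (norm_nonneg _).trans (hm _ ⟨1, by simp, rfl⟩)
  have hne : z ≠ 0 := norm_pos_iff.1 (hm0.trans_lt h)
  have hsub : {x : ℂ | m < ‖x‖} ⊆ connectedComponentIn γ.imageᶜ z := by
    -- For m = 0 the curve would be a single point, against injectivity.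
    rcases hm0.eq_or_lt with h0 | hpos
    · obtain ⟨w, hw, h0⟩ : γ.h 1 ∈ γ.image := ⟨1, by simp, rfl⟩
      exfalso
      have h1 := hm (γ.h 1) ⟨1, by simp, rfl⟩
      have h2 := hm (γ.h (-1)) ⟨-1, by simp, rfl⟩
      rw [← ‹0 = m›] at h1 h2
      have h3 : γ.h 1 = γ.h (-1) := by
        rw [norm_le_zero_iff.1 h1, norm_le_zero_iff.1 h2]
      have h4 := γ.injOn (by simp) (by simp) h3
      norm_num at h4
    · exact (isPreconnected_norm_gt m hpos).subset_connectedComponentIn h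
        fun x hx hx' => (hm x hx').not_gt hx
  obtain ⟨R, hR0, hR⟩ := (hz.2.subset hsub).exists_pos_norm_le
  have h1 := hR ((R + 1 + m : ℝ) : ℂ) (by
    rw [mem_ofPred_eq, Complex.norm_real, Real.norm_of_nonneg (by linarith)]
    linarith)
  rw [Complex.norm_real, Real.norm_of_nonneg (by linarith)] at h1
  linarith

/-- The two factors are those of the exact ellipse, with τ = |w|⁻². The real part is at least (1 -
|c|)(1 - |c|τ) because Re c ≤ |c|. -/
lemma re_conj_mul_ge {c : ℂ} {k τ : ℝ} (hc : ‖c‖ ≤ k) (hk : k ≤ 1) (hτ0 : 0 ≤ τ) (hτ : τ ≤ 1) :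
    (1 - k) ^ 2 ≤ ((starRingEnd ℂ) (1 - c) * (1 - c * τ)).re := by
  have h1 : ((starRingEnd ℂ) (1 - c) * (1 - c * τ)).re = 1 - c.re * (1 + τ) + ‖c‖ ^ 2 * τ := by
    rw [← Complex.normSq_eq_norm_sq, Complex.normSq_apply]
    simp
    ring
  have h2 : c.re ≤ ‖c‖ := Complex.re_le_norm c
  have h3 : c.re * (1 + τ) ≤ ‖c‖ * (1 + τ) := mul_le_mul_of_nonneg_right h2 (by linarith)
  have h4 : ‖c‖ * τ ≤ k * 1 := mul_le_mul hc hτ hτ0 ((norm_nonneg c).trans hc)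
  have h5 : (1 - k) * (1 - k) ≤ (1 - ‖c‖) * (1 - ‖c‖ * τ) :=
    mul_le_mul (by linarith) (by linarith) (by linarith) (by linarith)
  rw [h1]
  nlinarith

/-- This expression carries the sign of the radial derivative of the effective potential. For the
ellipse it is at least κ². Near the ellipse both factors change by at most κ²/5, and the bounds 2
and 3 on the remaining factors limit the total error to κ². -/
lemma re_conj_scaledSecant_mul_nonneg {n : ℕ} {t : ℕ → ℂ} {b : Fin (n + 1) → ℂ}
    (ht2 : ‖t 2‖ < 1 / 2) (ht : ∀ k : ℕ, n + 1 < k → t k = 0) {ρ : ℝ}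
    (hb : (n + 1) ^ 2 * ρ ^ (n + 2) * ‖b - ellipseCoeff n t‖ ≤ (1 - 2 * ‖t 2‖) ^ 2 / 5)
    {w : ℂ} (hw1 : 1 ≤ ‖w‖) (hwρ : ‖w‖ ≤ ρ) :
    0 ≤ ((starRingEnd ℂ) (scaledSecant n b w⁻¹ ((starRingEnd ℂ) w)) *
      scaledSecant n b w⁻¹ w⁻¹).re := by
  have hw0 := ne_zero_of_one_le_norm hw1
  have hρ : 1 ≤ ρ := hw1.trans hwρ
  have hinv : ‖w⁻¹‖ ≤ 1 := by rw [norm_inv]; exact inv_le_one_of_one_le₀ hw1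
  set κ := 1 - 2 * ‖t 2‖ with hκ
  have hκ0 : 0 < κ := by rw [hκ]; linarith
  have hκ1 : κ ≤ 1 := by rw [hκ]; linarith [norm_nonneg (t 2)]
  set X := scaledSecant n b w⁻¹ ((starRingEnd ℂ) w)
  set Y := scaledSecant n b w⁻¹ w⁻¹
  have hX := norm_scaledSecant_sub_le n b (ellipseCoeff n t) hρ (hinv.trans hρ)
    (v := (starRingEnd ℂ) w) (by rwa [RCLike.norm_conj])
  have hY := norm_scaledSecant_sub_le n b (ellipseCoeff n t) hρ (hinv.trans hρ)
    (hinv.trans hρ)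
  rw [scaledSecant_ellipseCoeff ht] at hX hY
  set c := 2 * (starRingEnd ℂ) (t 2) * (w⁻¹ * (starRingEnd ℂ) w) with hc
  set τ := (‖w‖ ^ 2)⁻¹ with hτ
  have hτ0 : 0 ≤ τ := by positivity
  have hτ1 : τ ≤ 1 := inv_le_one_of_one_le₀ (one_le_pow₀ hw1)
  have hcτ : 2 * (starRingEnd ℂ) (t 2) * (w⁻¹ * w⁻¹) = c * τ := by
    have h2 : (‖w‖ : ℂ) ^ 2 = w * (starRingEnd ℂ) w := (Complex.mul_conj' w).symm
    have hwc : (starRingEnd ℂ) w ≠ 0 := (map_ne_zero _).2 hw0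
    rw [hc, hτ]
    push_cast
    rw [h2]
    field_simp
  rw [hcτ] at hY
  have hcn : ‖c‖ ≤ 2 * ‖t 2‖ := by
    rw [hc, norm_mul, norm_mul, norm_mul, RCLike.norm_conj, RCLike.norm_conj, Complex.norm_ofNat,
      norm_inv, inv_mul_cancel₀ (norm_ne_zero_iff.2 hw0), mul_one]
  have hmain := re_conj_mul_ge hcn (by linarith) hτ0 hτ1
  rw [← hκ] at hmain
  set X₀ := 1 - c
  set Y₀ := 1 - c * τ
  have hX₀ : ‖X₀‖ ≤ 2 := by
    refine (norm_sub_le _ _).trans ?_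
    rw [norm_one]
    linarith
  have hY₀ : ‖Y₀‖ ≤ 2 := by
    refine (norm_sub_le _ _).trans ?_
    rw [norm_one, norm_mul, Complex.norm_real, Real.norm_of_nonneg hτ0]
    have := mul_le_mul hcn hτ1 hτ0 (by positivity)
    linarith
  have hη : κ ^ 2 / 5 ≤ 1 := by nlinarith
  have hX' := hX.trans hb
  have hY' := hY.trans hb
  have hYn : ‖Y‖ ≤ 3 := by
    have := norm_add_le (Y - Y₀) Y₀
    rw [sub_add_cancel] at this
    linarith
  have hdiff : (starRingEnd ℂ) X * Y = (starRingEnd ℂ) X₀ * Y₀ +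
      ((starRingEnd ℂ) (X - X₀) * Y + (starRingEnd ℂ) X₀ * (Y - Y₀)) := by
    rw [map_sub (starRingEnd ℂ) X X₀]
    ring
  have herr : ‖(starRingEnd ℂ) (X - X₀) * Y + (starRingEnd ℂ) X₀ * (Y - Y₀)‖ ≤ κ ^ 2 := by
    refine (norm_add_le _ _).trans ?_
    rw [norm_mul, norm_mul, RCLike.norm_conj, RCLike.norm_conj]
    have h1 := mul_le_mul hX' hYn (norm_nonneg _) (by positivity)
    have h2 := mul_le_mul hX₀ hY' (norm_nonneg _) zero_le_two
    linarith
  rw [hdiff, Complex.add_re]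
  have := (abs_le.1 (Complex.abs_re_le_norm ((starRingEnd ℂ) (X - X₀) * Y +
    (starRingEnd ℂ) X₀ * (Y - Y₀)))).1
  linarith

namespace PolynomialCurve

variable {γ : PolynomialCurve} {n : ℕ} {t : ℕ → ℂ} {g : Polynomial ℂ} {t₀ : ℝ}
  {b : Fin (n + 1) → ℂ}

/-- Along the ray w = s e the derivative is 2(s - 1/s) r² Re(X̄ Y), which is nonnegative near the
ellipse for 1 ≤ s ≤ ρ. -/
lemma effectivePotential_radial (hU : IsExteriorUnivalent γ.r γ.a) (ht₀ : 0 < t₀)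
    (hvol : volume γ.interiorDomain = ENNReal.ofReal (Real.pi * t₀))
    (hS : HasSchwarzPoly γ.r γ.a (momentPoly n t) g) (ha : γ.a = scaledPoly n γ.r b)
    (ht2 : ‖t 2‖ < 1 / 2) (ht : ∀ k : ℕ, n + 1 < k → t k = 0) {ρ : ℝ}
    (hb : (n + 1) ^ 2 * ρ ^ (n + 2) * ‖b - ellipseCoeff n t‖ ≤ (1 - 2 * ‖t 2‖) ^ 2 / 5)
    {w : ℂ} (hw1 : 1 ≤ ‖w‖) (hwρ : ‖w‖ ≤ ρ) :
    γ.effectivePotential n t (γ.h 1) ≤ γ.effectivePotential n t (γ.h w) := by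
  have hn0 : ‖w‖ ≠ 0 := by linarith
  set e : ℂ := w / ‖w‖ with he
  have hen : ‖e‖ = 1 := by
    rw [he, norm_div, Complex.norm_real, norm_norm, div_self hn0]
  have hwe : (‖w‖ : ℂ) * e = w := by
    rw [he, mul_div_cancel₀]
    exact_mod_cast hn0
  have hnorm : ∀ s : ℝ, 0 ≤ s → ‖(s : ℂ) * e‖ = s := fun s hs => by
    rw [norm_mul, hen, mul_one, Complex.norm_real, Real.norm_of_nonneg hs]
  have hp : ∀ s : ℝ, HasDerivAt (fun s : ℝ => (s : ℂ) * e) e s := fun s => by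
    simpa using (Complex.ofRealCLM.hasDerivAt (x := s)).mul_const e
  have hder : ∀ s ∈ interior (Icc 1 ‖w‖), 0 ≤ deriv
      (fun s : ℝ => γ.effectivePotential n t (γ.h ((s : ℂ) * e))) s ∧ DifferentiableAt ℝ
      (fun s : ℝ => γ.effectivePotential n t (γ.h ((s : ℂ) * e))) s := by
    intro s hs
    rw [interior_Icc] at hs
    have hs0 : 0 ≤ s := by linarith [hs.1]
    have h1 := hasDerivAt_effectivePotential hU ht₀ hvol hS (hp s)
      (by rw [hnorm s hs0]; exact hs.1)
    refine ⟨?_, h1.differentiableAt⟩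
    rw [h1.deriv, sub_inv_conj hen, ha, secant_scaledPoly, secant_scaledPoly]
    have h2 := re_conj_scaledSecant_mul_nonneg ht2 ht hb (w := s * e)
      (by rw [hnorm s hs0]; exact hs.1.le) (by rw [hnorm s hs0]; linarith [hs.2])
    have hee : (starRingEnd ℂ) e * e = 1 := by
      rw [Complex.conj_mul', hen]
      simp
    set X := scaledSecant n b (s * e)⁻¹ ((starRingEnd ℂ) (s * e))
    set Y := scaledSecant n b (s * e)⁻¹ (s * e)⁻¹
    have h3 : (starRingEnd ℂ) (((s - s⁻¹ : ℝ) : ℂ) * e * (γ.r * X)) * (e * (γ.r * Y)) =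
        (((s - s⁻¹) * γ.r ^ 2 : ℝ) : ℂ) * ((starRingEnd ℂ) X * Y) := by
      simp only [map_mul, Complex.conj_ofReal]
      push_cast
      linear_combination ((s : ℂ) - (s : ℂ)⁻¹) * γ.r ^ 2 * (starRingEnd ℂ) X * Y * hee
    rw [h3, Complex.re_ofReal_mul]
    have h4 : s⁻¹ ≤ 1 := inv_le_one_of_one_le₀ hs.1.le
    have h5 : 0 ≤ s - s⁻¹ := by linarith [hs.1]
    positivity
  have hcont : ContinuousOn (fun s : ℝ => γ.effectivePotential n t (γ.h ((s : ℂ) * e)))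
      (Icc 1 ‖w‖) := by
    refine (continuous_effectivePotential hU ht₀ hvol).comp_continuousOn
      ((continuousOn_curveMap γ.r γ.a).comp (by fun_prop) fun s hs => ?_)
    rw [mem_ofPred_eq, hnorm s (by linarith [hs.1])]
    exact hs.1
  have hmono := monotoneOn_of_deriv_nonneg (convex_Icc 1 ‖w‖) hcont
    (fun s hs => (hder s hs).2.differentiableWithinAt) (fun s hs => (hder s hs).1)
  have h1 := hmono (left_mem_Icc.2 hw1) (right_mem_Icc.2 hw1) hw1
  simp only [Complex.ofReal_one, one_mul, hwe] at h1
  rwa [effectivePotential_of_mem_sphere hU ht₀ hvol hS (by simpa using hen)] at h1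

lemma norm_h_sub_le (ha : γ.a = scaledPoly n γ.r b) (hb : ‖b‖ ≤ 2) {w : ℂ} (hw : 1 ≤ ‖w‖) :
    γ.r * (‖w‖ - 2 * (n + 1)) ≤ ‖γ.h w‖ ∧ ‖γ.h w‖ ≤ γ.r * (‖w‖ + 2 * (n + 1)) := by
  have hw1 : ‖w⁻¹‖ ≤ 1 := by rw [norm_inv]; exact inv_le_one_of_one_le₀ hw
  have h1 := norm_sum_mul_pow_le n b hw1
  have h2 : ((n : ℝ) + 1) * ‖b‖ ≤ (n + 1) * 2 := mul_le_mul_of_nonneg_left hb (by positivity)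
  have hr := γ.r_pos
  rw [h, ha, curveMap_scaledPoly, norm_mul, Complex.norm_real, Real.norm_of_nonneg hr.le]
  constructor
  · refine mul_le_mul_of_nonneg_left ?_ hr.le
    have := norm_sub_norm_le w (-∑ j : Fin (n + 1), b j * w⁻¹ ^ (j : ℕ))
    rw [norm_neg, sub_neg_eq_add] at this
    linarith
  · refine mul_le_mul_of_nonneg_left ?_ hr.le
    have := norm_add_le w (∑ j : Fin (n + 1), b j * w⁻¹ ^ (j : ℕ))
    linarith

lemma norm_le_of_mem_image (ha : γ.a = scaledPoly n γ.r b) (hb : ‖b‖ ≤ 2) {z : ℂ}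
    (hz : z ∈ γ.image) : ‖z‖ ≤ γ.r * (1 + 2 * (n + 1)) := by
  obtain ⟨w, hw, rfl⟩ := hz
  rw [mem_sphere_zero_iff_norm] at hw
  have := (norm_h_sub_le ha hb hw.ge).2
  rwa [hw] at this

end PolynomialCurve

/-- The Euler-Lagrange inequality for curves of small area close to the limiting ellipse. -/
lemma exists_effectivePotential_le {n : ℕ} {t : ℕ → ℂ} (ht1 : t 1 = 0) (ht2 : ‖t 2‖ < 1 / 2)
    (ht : ∀ k : ℕ, n + 1 < k → t k = 0) {D : Set ℂ} (hD : IsCompact D)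
    (hpos : ∀ z ∈ D \ {0}, 0 < scaledPotential n t z) :
    ∃ ε > 0, ∃ r₂ > 0, ∀ (γ : PolynomialCurve) (b : Fin (n + 1) → ℂ) (t₀ : ℝ) (g : Polynomial ℂ),
      IsExteriorUnivalent γ.r γ.a → γ.a = scaledPoly n γ.r b → ‖b‖ ≤ 2 →
      ‖b - ellipseCoeff n t‖ ≤ ε → γ.r < r₂ → 0 < t₀ → t₀ ≤ γ.r ^ 2 →
      volume γ.interiorDomain = ENNReal.ofReal (Real.pi * t₀) →
      HasSchwarzPoly γ.r γ.a (momentPoly n t) g →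
      ∀ z ∈ D, γ.effectivePotential n t (γ.h 1) ≤ γ.effectivePotential n t z := by
  obtain ⟨K, hK0, hK⟩ := exists_scaledPotential_le ht1 ht
  obtain ⟨c, hc0, hc⟩ := exists_le_scaledPotential ht1 ht2 ht hD hpos
  -- D₊ lies in the disc of radius r A. For |z| ≥ r X the quadratic growth of U suffices, and |w| ≥
  -- ρ = X + A - 1 forces |h(w)| ≥ r X. Below ρ the radial monotonicity applies, which fixes the
  -- size of ε.
  obtain ⟨A, hA⟩ : ∃ A : ℝ, A = 1 + 2 * (n + 1) := ⟨_, rfl⟩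
  have hA0 : 0 < A := by rw [hA]; positivity
  have hA1 : 1 ≤ A := by rw [hA]; linarith [(Nat.cast_nonneg n : (0 : ℝ) ≤ n)]
  obtain ⟨X, hX⟩ : ∃ X : ℝ, X = A + 1 + (4 + 9 * A ^ 2 * K) / c := ⟨_, rfl⟩
  have hX0 : 0 ≤ (4 + 9 * A ^ 2 * K) / c := by positivity
  obtain ⟨ρ, hρ⟩ : ∃ ρ : ℝ, ρ = X + A - 1 := ⟨_, rfl⟩
  have hρ1 : 2 * A ≤ ρ := by rw [hρ, hX]; linarith
  have hκ0 : 0 < 1 - 2 * ‖t 2‖ := by linarith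
  have hρ0 : 0 < ρ := by linarith
  refine ⟨(1 - 2 * ‖t 2‖) ^ 2 / 5 / ((n + 1) ^ 2 * ρ ^ (n + 2)), by positivity, 1 / (3 * A),
    by positivity, ?_⟩
  intro γ b t₀ g hU ha hb2 hbε hr₂ ht₀ htr hvol hS z hz
  have hr := γ.r_pos
  have hrad : ∀ w : ℂ, 1 ≤ ‖w‖ → ‖w‖ ≤ ρ →
      γ.effectivePotential n t (γ.h 1) ≤ γ.effectivePotential n t (γ.h w) := by
    intro w hw1 hwρ
    refine PolynomialCurve.effectivePotential_radial hU ht₀ hvol hS ha ht2 ht ?_ hw1 hwρ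
    rw [le_div_iff₀ (by positivity)] at hbε
    linarith
  have hmeas := (γ.isOpen_interiorDomain hU).measurableSet
  have hbdd := γ.isBounded_interiorDomain hU
  have hin : ∀ ζ ∈ γ.interiorDomain, ‖ζ‖ ≤ γ.r * A := fun ζ hζ => by
    rw [hA]
    exact PolynomialCurve.norm_le_of_mem_interiorDomain
      (fun z hz => PolynomialCurve.norm_le_of_mem_image ha hb2 hz) hζ
  by_cases hzin : z ∈ γ.interiorDomain
  · exact (PolynomialCurve.effectivePotential_of_mem_interiorDomain hU ht₀ hvol hS hzin).ge
  have hzim : z ∈ curveMap γ.r γ.a '' {w | 1 ≤ ‖w‖} := by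
    rw [γ.interiorDomain_eq hU, ← PolynomialCurve.image_curveMap_eq] at hzin
    exact not_not.1 hzin
  obtain ⟨w, hw, hwz⟩ := hzim
  rcases le_total ‖w‖ ρ with hwρ | hwρ
  · rw [← hwz]
    exact hrad w hw hwρ
  have hzl := (PolynomialCurve.norm_h_sub_le ha hb2 hw).1
  rw [PolynomialCurve.h, hwz] at hzl
  obtain ⟨y, hy⟩ : ∃ y : ℝ, y = ‖z‖ / γ.r := ⟨_, rfl⟩
  have hzy : ‖z‖ = γ.r * y := by rw [hy]; field_simp
  have hyX : X ≤ y := by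
    rw [hy, le_div_iff₀ hr]
    have : X ≤ ‖w‖ - 2 * (n + 1) := by linarith
    have := mul_le_mul_of_nonneg_left this hr.le
    linarith
  have hy1 : A + 1 ≤ y := by linarith
  have hy0 : 0 < y := by linarith
  have hupper : logPotential γ.interiorDomain z ≤
      Real.pi * t₀ * (Real.log 2 + Real.log γ.r + Real.log y) := by
    refine logPotential_le hmeas hbdd ht₀ hvol fun ζ hζ => ?_
    rw [← Real.log_mul two_ne_zero hr.ne', ← Real.log_mul (by positivity) hy0.ne']
    refine Real.log_le_log (norm_pos_iff.2 (sub_ne_zero.2 fun h => hzin (h ▸ hζ))) ?_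
    refine (norm_sub_le _ _).trans ?_
    have h1 := hin ζ hζ
    have h2 : γ.r * A ≤ γ.r * y := mul_le_mul_of_nonneg_left (by linarith) hr.le
    rw [hzy]
    linarith
  have hlow : c * (γ.r * y) ^ 2 - 2 * t₀ * (Real.log 2 + Real.log γ.r + Real.log y) ≤
      γ.effectivePotential n t z := by
    rw [PolynomialCurve.effectivePotential, ← hzy]
    have h1 := hc z hz
    have h2 := mul_le_mul_of_nonneg_left hupper (by positivity : 0 ≤ 2 / Real.pi)
    have h3 : 2 / Real.pi * (Real.pi * t₀ * (Real.log 2 + Real.log γ.r + Real.log y)) =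
        2 * t₀ * (Real.log 2 + Real.log γ.r + Real.log y) := by
      field_simp
    linarith
  -- A comparison point inside the monotone range whose image has distance at least r from D₊. The
  -- unbounded terms 2t₀ log r in the upper bound here and in the lower bound at `z` cancel. The
  -- restriction r < 1/(3A) keeps h(w₁) in the unit disc.
  obtain ⟨w₁, hw₁⟩ : ∃ w₁ : ℂ, w₁ = ((2 * A : ℝ) : ℂ) := ⟨_, rfl⟩
  have hw₁n : ‖w₁‖ = 2 * A := by
    rw [hw₁, Complex.norm_real, Real.norm_of_nonneg (by positivity)]
  have hw₁1 : 1 ≤ ‖w₁‖ := by rw [hw₁n]; linarith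
  have h0 := hrad w₁ hw₁1 (by rw [hw₁n]; exact hρ1)
  obtain ⟨hl, hu⟩ := PolynomialCurve.norm_h_sub_le ha hb2 hw₁1
  rw [hw₁n] at hl hu
  have hu3 : ‖γ.h w₁‖ ≤ γ.r * (3 * A) :=
    hu.trans (mul_le_mul_of_nonneg_left (by rw [hA]; linarith) hr.le)
  have hu1 : ‖γ.h w₁‖ ≤ 1 := by
    refine hu3.trans ?_
    rw [lt_div_iff₀ (by positivity)] at hr₂
    exact hr₂.le
  have hlogl : Real.pi * t₀ * Real.log γ.r ≤ logPotential γ.interiorDomain (γ.h w₁) := by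
    refine le_logPotential hmeas hbdd ht₀ hvol fun ζ hζ => Real.log_le_log hr ?_
    have h1 := hin ζ hζ
    have h2 := norm_sub_norm_le (γ.h w₁) ζ
    have h3 : γ.r * (2 * A - 2 * (n + 1)) = γ.r * A + γ.r := by rw [hA]; ring
    linarith
  have hE0 : γ.effectivePotential n t (γ.h w₁) ≤
      K * (γ.r * (3 * A)) ^ 2 - 2 * t₀ * Real.log γ.r := by
    rw [PolynomialCurve.effectivePotential]
    have h1 := hK _ hu1
    have h2 := mul_le_mul_of_nonneg_left hlogl (by positivity : 0 ≤ 2 / Real.pi)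
    have h3 : 2 / Real.pi * (Real.pi * t₀ * Real.log γ.r) = 2 * t₀ * Real.log γ.r := by
      field_simp
    have h4 := mul_le_mul_of_nonneg_left (pow_le_pow_left₀ (norm_nonneg _) hu3 2) hK0
    linarith
  refine h0.trans (hE0.trans (le_trans ?_ hlow))
  have hl2 : Real.log 2 ≤ 1 := by linarith [Real.log_le_sub_one_of_pos (zero_lt_two' ℝ)]
  have hly : Real.log y ≤ y := by linarith [Real.log_le_sub_one_of_pos hy0]
  have h1 : t₀ * (Real.log 2 + Real.log y) ≤ γ.r ^ 2 * (1 + y) :=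
    (mul_le_mul_of_nonneg_left (by linarith) ht₀.le).trans
      (mul_le_mul_of_nonneg_right htr (by linarith))
  have h2 : 4 + 9 * A ^ 2 * K ≤ c * y := by
    have : (4 + 9 * A ^ 2 * K) / c ≤ y := by linarith
    rwa [div_le_iff₀ hc0, mul_comm y] at this
  have h3 : 2 + 2 * y + 9 * A ^ 2 * K ≤ c * y ^ 2 := by
    have h4 := mul_le_mul_of_nonneg_right h2 hy0.le
    have h5 : 0 ≤ 9 * A ^ 2 * K * (y - 1) := mul_nonneg (by positivity) (by linarith)
    linarith
  have h4 := mul_le_mul_of_nonneg_left h3 (sq_nonneg γ.r)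
  linarith

/-! ### Positive definiteness of the Gaussian kernel -/

/-- The mutual energy of two measures with respect to the Gaussian kernel. -/
def gaussEnergy (s : ℝ) (μ ν : Measure ℂ) : ℝ :=
  ∫ x : ℂ × ℂ, Real.exp (-s * ‖x.1 - x.2‖ ^ 2) ∂(μ.prod ν)

lemma integral_gauss_inner {b : ℝ} (hb : 0 < b) (w : ℂ) :
    ∫ v : ℂ, Complex.exp (-(b : ℂ) * ‖v‖ ^ 2) * Complex.exp (inner ℝ w v * Complex.I) =
      (Real.pi / b : ℝ) * (Real.exp (-(4 * b)⁻¹ * ‖w‖ ^ 2) : ℝ) := by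
  have h1 := GaussianFourier.integral_cexp_neg_mul_sq_norm_add (V := ℂ) (b := (b : ℂ)) (by simpa using hb)
    Complex.I w
  simp only [Complex.finrank_real_complex] at h1
  simp only [← Complex.exp_add]
  rw [Complex.ofReal_exp]
  convert h1 using 2
  · ext v
    rw [mul_comm Complex.I]
  · norm_num
  · push_cast
    rw [Complex.I_sq]
    congr 1
    field_simp

section

variable (μ ν : Measure ℂ) [IsProbabilityMeasure μ] [IsProbabilityMeasure ν]

lemma integral_prod_exp_inner (v : ℂ) :
    ∫ x : ℂ × ℂ, Complex.exp (inner ℝ (x.1 - x.2) v * Complex.I) ∂(μ.prod ν) =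
      charFun μ v * (starRingEnd ℂ) (charFun ν v) := by
  rw [← charFun_neg, charFun_apply, charFun_apply, ← integral_prod_mul]
  refine integral_congr_ae (Eventually.of_forall fun x => ?_)
  simp only
  rw [← Complex.exp_add, inner_sub_left, inner_neg_right]
  congr 1
  push_cast
  ring

lemma integrable_gauss {b : ℝ} (hb : 0 < b) :
    Integrable fun v : ℂ => Complex.exp (-(b : ℂ) * ‖v‖ ^ 2) := by
  have := GaussianFourier.integrable_cexp_neg_mul_sq_norm_add (V := ℂ) (b := (b : ℂ))
    (by simpa using hb) 0 0
  simpa using this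

lemma gaussEnergy_eq_integral_charFun {b : ℝ} (hb : 0 < b) :
    ((Real.pi / b * gaussEnergy (4 * b)⁻¹ μ ν : ℝ) : ℂ) =
      ∫ v : ℂ, Complex.exp (-(b : ℂ) * ‖v‖ ^ 2) *
        (charFun μ v * (starRingEnd ℂ) (charFun ν v)) := by
  have h1 : ∀ v : ℂ, Complex.exp (-(b : ℂ) * ‖v‖ ^ 2) *
      (charFun μ v * (starRingEnd ℂ) (charFun ν v)) = ∫ x : ℂ × ℂ, Complex.exp (-(b : ℂ) * ‖v‖ ^ 2) *
        Complex.exp (inner ℝ (x.1 - x.2) v * Complex.I) ∂(μ.prod ν) := by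
    intro v
    rw [integral_const_mul, integral_prod_exp_inner]
  simp only [h1]
  have hint : Integrable (fun y : ℂ × (ℂ × ℂ) => Complex.exp (-(b : ℂ) * ‖y.1‖ ^ 2) *
      Complex.exp (inner ℝ (y.2.1 - y.2.2) y.1 * Complex.I)) (volume.prod (μ.prod ν)) := by
    have h2 := (integrable_gauss hb).comp_fst (μ.prod ν)
    refine h2.mono (Continuous.aestronglyMeasurable (by fun_prop)) (Eventually.of_forall fun y => ?_)
    rw [norm_mul, Complex.norm_exp_ofReal_mul_I, mul_one]
  rw [integral_integral_swap hint]
  simp only [integral_gauss_inner hb]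
  rw [integral_const_mul, integral_complex_ofReal, gaussEnergy]
  push_cast
  rfl

lemma gaussEnergy_comm (s : ℝ) : gaussEnergy s μ ν = gaussEnergy s ν μ := by
  rw [gaussEnergy, ← integral_prod_swap]
  simp only [Prod.fst_swap, Prod.snd_swap, norm_sub_rev, gaussEnergy]

lemma integrable_gauss_charFun {b : ℝ} (hb : 0 < b) :
    Integrable fun v : ℂ => Complex.exp (-(b : ℂ) * ‖v‖ ^ 2) *
        (charFun μ v * (starRingEnd ℂ) (charFun ν v)) := by
  refine (integrable_gauss hb).mul_bdd (c := 1) ?_ (Eventually.of_forall fun v => ?_)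
  · exact (measurable_charFun.mul (Complex.continuous_conj.measurable.comp measurable_charFun)
      ).aestronglyMeasurable
  · rw [norm_mul, RCLike.norm_conj]
    exact mul_le_one₀ (norm_charFun_le_one v) (norm_nonneg _) (norm_charFun_le_one v)

/-- A Gaussian is the Fourier transform of a Gaussian, so the energy of μ - ν is a weighted square
norm of the difference of the characteristic functions. It is nonnegative and vanishes only if the
measures agree. -/
lemma gaussEnergy_sub_eq {b : ℝ} (hb : 0 < b) :
    Real.pi / b * (gaussEnergy (4 * b)⁻¹ μ μ + gaussEnergy (4 * b)⁻¹ ν ν -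
      2 * gaussEnergy (4 * b)⁻¹ μ ν) =
      ∫ v : ℂ, Real.exp (-b * ‖v‖ ^ 2) * ‖charFun μ v - charFun ν v‖ ^ 2 := by
  rw [two_mul]
  nth_rw 4 [gaussEnergy_comm]
  have h1 := gaussEnergy_eq_integral_charFun μ μ hb
  have h2 := gaussEnergy_eq_integral_charFun ν ν hb
  have h3 := gaussEnergy_eq_integral_charFun μ ν hb
  have h4 := gaussEnergy_eq_integral_charFun ν μ hb
  have i1 := integrable_gauss_charFun μ μ hb
  have i2 := integrable_gauss_charFun ν ν hb
  have i3 := integrable_gauss_charFun μ ν hb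
  have i4 := integrable_gauss_charFun ν μ hb
  have h5 := integral_sub (i1.add i2) (i3.add i4)
  rw [integral_add' i1 i2, integral_add' i3 i4, ← h1, ← h2, ← h3, ← h4] at h5
  rw [← Complex.ofReal_inj, ← integral_complex_ofReal]
  have h6 : ((Real.pi / b * (gaussEnergy (4 * b)⁻¹ μ μ + gaussEnergy (4 * b)⁻¹ ν ν -
      (gaussEnergy (4 * b)⁻¹ μ ν + gaussEnergy (4 * b)⁻¹ ν μ)) : ℝ) : ℂ) =
      ((Real.pi / b * gaussEnergy (4 * b)⁻¹ μ μ : ℝ) : ℂ) +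
      ((Real.pi / b * gaussEnergy (4 * b)⁻¹ ν ν : ℝ) : ℂ) -
      (((Real.pi / b * gaussEnergy (4 * b)⁻¹ μ ν : ℝ) : ℂ) +
      ((Real.pi / b * gaussEnergy (4 * b)⁻¹ ν μ : ℝ) : ℂ)) := by
    push_cast
    ring
  rw [h6, ← h5]
  refine integral_congr_ae (Eventually.of_forall fun v => ?_)
  simp only [Pi.add_apply]
  push_cast
  rw [← Complex.mul_conj' (charFun μ v - charFun ν v), map_sub]
  ring

lemma two_mul_gaussEnergy_le {s : ℝ} (hs : 0 < s) :
    2 * gaussEnergy s μ ν ≤ gaussEnergy s μ μ + gaussEnergy s ν ν := by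
  have h1 := gaussEnergy_sub_eq μ ν (b := (4 * s)⁻¹) (by positivity)
  have h2 : (4 * (4 * s)⁻¹)⁻¹ = s := by field_simp
  rw [h2] at h1
  have h3 : 0 ≤ ∫ v : ℂ, Real.exp (-(4 * s)⁻¹ * ‖v‖ ^ 2) * ‖charFun μ v - charFun ν v‖ ^ 2 :=
    integral_nonneg fun v => by positivity
  rw [← h1] at h3
  have h4 := nonneg_of_mul_nonneg_right h3 (by positivity)
  linarith

variable {μ ν} in
lemma eq_of_two_mul_gaussEnergy_eq {s : ℝ} (hs : 0 < s)
    (h : 2 * gaussEnergy s μ ν = gaussEnergy s μ μ + gaussEnergy s ν ν) : μ = ν := by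
  have hb : 0 < (4 * s)⁻¹ := by positivity
  have h1 := gaussEnergy_sub_eq μ ν hb
  have h2 : (4 * (4 * s)⁻¹)⁻¹ = s := by field_simp
  rw [h2, ← h, sub_self, mul_zero] at h1
  have hcont : Continuous fun v : ℂ =>
      Real.exp (-(4 * s)⁻¹ * ‖v‖ ^ 2) * ‖charFun μ v - charFun ν v‖ ^ 2 := by
    have h3 : Continuous (charFun μ) := continuous_charFun
    have h4 : Continuous (charFun ν) := continuous_charFun
    fun_prop
  have hint : Integrable fun v : ℂ =>
      Real.exp (-(4 * s)⁻¹ * ‖v‖ ^ 2) * ‖charFun μ v - charFun ν v‖ ^ 2 := by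
    have hg : Integrable fun v : ℂ => Real.exp (-(4 * s)⁻¹ * ‖v‖ ^ 2) := by
      refine (integrable_gauss hb).norm.congr (Eventually.of_forall fun v => ?_)
      simp only
      rw [Complex.norm_exp]
      congr 1
      norm_cast
    refine hg.mul_bdd (c := 4) ?_ (Eventually.of_forall fun v => ?_)
    · exact ((measurable_charFun.sub measurable_charFun).norm.pow_const 2).aestronglyMeasurable
    · have h3 := (norm_sub_le (charFun μ v) (charFun ν v)).trans
        (add_le_add (norm_charFun_le_one v) (norm_charFun_le_one v))
      rw [norm_pow, norm_norm]
      nlinarith [norm_nonneg (charFun μ v - charFun ν v)]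
  have h3 := (integral_eq_zero_iff_of_nonneg (fun v => by positivity) hint).1 h1.symm
  have h4 := (Continuous.ae_eq_iff_eq volume hcont continuous_zero).1 h3
  refine Measure.ext_of_charFun (funext fun v => ?_)
  have h5 := congrFun h4 v
  simp only [Pi.zero_apply, mul_eq_zero, Real.exp_ne_zero, false_or] at h5
  exact sub_eq_zero.1 (norm_eq_zero.1 (pow_eq_zero_iff two_ne_zero |>.1 h5))

end

/-! ### The logarithmic kernel as a superposition of Gaussian kernels -/

/-- Frullani's integral: the difference of exponentials is an integral of s exp(-sτ) over τ between
a and b, and Tonelli's theorem exchanges the order. -/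
lemma lintegral_exp_sub_exp_div {a b : ℝ} (ha : 0 < a) (hab : a ≤ b) :
    ∫⁻ s in Ioi (0 : ℝ), ENNReal.ofReal ((Real.exp (-s * a) - Real.exp (-s * b)) / s) =
      ENNReal.ofReal (Real.log (b / a)) := by
  have hmeas : Measurable fun x : ℝ × ℝ => ENNReal.ofReal (Real.exp (-x.1 * x.2)) := by fun_prop
  have h1 : ∀ s ∈ Ioi (0 : ℝ), ENNReal.ofReal ((Real.exp (-s * a) - Real.exp (-s * b)) / s) =
      ∫⁻ τ in Ioc a b, ENNReal.ofReal (Real.exp (-s * τ)) := by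
    intro s hs
    rw [mem_Ioi] at hs
    rw [← ofReal_integral_eq_lintegral_ofReal]
    · rw [← intervalIntegral.integral_of_le hab]
      have hd : ∀ τ ∈ uIcc a b, HasDerivAt (fun τ => -Real.exp (-s * τ) / s)
          (Real.exp (-s * τ)) τ := by
        intro τ _
        have := ((((hasDerivAt_id τ).const_mul (-s)).exp).neg).div_const s
        refine this.congr_deriv ?_
        simp only [id]
        field_simp
      rw [intervalIntegral.integral_eq_sub_of_hasDerivAt hd
        (Continuous.intervalIntegrable (by fun_prop) _ _)]
      congr 1
      ring
    · exact (Continuous.integrableOn_Icc (by fun_prop)).mono_set Ioc_subset_Icc_self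
    · exact Eventually.of_forall fun τ => (Real.exp_pos _).le
  have h2 : ∀ τ ∈ Ioc a b, ∫⁻ s in Ioi (0 : ℝ), ENNReal.ofReal (Real.exp (-s * τ)) =
      ENNReal.ofReal τ⁻¹ := by
    intro τ hτ
    have hτ0 : 0 < τ := ha.trans hτ.1
    have h3 : ∀ s : ℝ, Real.exp (-s * τ) = Real.exp (-τ * s) := fun s => by
      congr 1
      ring
    simp only [h3]
    rw [← ofReal_integral_eq_lintegral_ofReal, integral_exp_mul_Ioi (by linarith)]
    · simp
    · exact exp_neg_integrableOn_Ioi 0 hτ0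
    · exact Eventually.of_forall fun τ => (Real.exp_pos _).le
  rw [setLIntegral_congr_fun measurableSet_Ioi h1, lintegral_lintegral_swap hmeas.aemeasurable,
    setLIntegral_congr_fun measurableSet_Ioc h2, ← ofReal_integral_eq_lintegral_ofReal]
  · rw [← intervalIntegral.integral_of_le hab, integral_inv_of_pos ha (ha.trans_le hab)]
  · have : ContinuousOn (fun τ : ℝ => τ⁻¹) (Icc a b) :=
      continuousOn_id.inv₀ fun τ hτ => (ha.trans_le hτ.1).ne'
    exact this.integrableOn_Icc.mono_set Ioc_subset_Icc_self
  · filter_upwards [ae_restrict_mem measurableSet_Ioc] with τ hτ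
    exact inv_nonneg.2 (ha.trans hτ.1).le

/-! ### Energy of admissible measures -/

/-- The mutual energy of two measures with respect to the kernel `log (R / |z - ζ|)`. -/
def mutualEnergy (R : ℝ) (μ ν : Measure ℂ) : ℝ≥0∞ :=
  ∫⁻ x : ℂ × ℂ, ENNReal.ofReal (Real.log (R / ‖x.1 - x.2‖)) ∂(μ.prod ν)

lemma measurable_logKernel (R : ℝ) :
    Measurable fun x : ℂ × ℂ => ENNReal.ofReal (Real.log (R / ‖x.1 - x.2‖)) := by
  refine (Real.measurable_log.comp ?_).ennreal_ofReal
  fun_prop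

section

variable {D : Set ℂ} {μ ν : Measure ℂ} {R : ℝ}

lemma ae_mem_of_admissible (hμ : μ ∈ admissibleMeasures D) : ∀ᵐ z ∂μ, z ∈ D := by
  have := measure_eq_zero_iff_ae_notMem.1 hμ.2.2
  filter_upwards [this] with z hz
  exact not_not.1 hz

lemma ae_prod_of_admissible (hμ : μ ∈ admissibleMeasures D) (hν : ν ∈ admissibleMeasures D) :
    ∀ᵐ x ∂(μ.prod ν), x.1 ∈ D ∧ x.2 ∈ D ∧ x.1 ≠ x.2 := by
  have := hμ.1
  have := hν.1
  have h1 : ∀ᵐ x ∂(μ.prod ν), x.1 ∈ D :=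
    Measure.quasiMeasurePreserving_fst.ae (ae_mem_of_admissible hμ)
  have h2 : ∀ᵐ x ∂(μ.prod ν), x.2 ∈ D :=
    Measure.quasiMeasurePreserving_snd.ae (ae_mem_of_admissible hν)
  have h3 : ∀ᵐ x ∂(μ.prod ν), x.1 ≠ x.2 := by
    refine (Measure.ae_prod_iff_ae_ae (p := fun x : ℂ × ℂ => x.1 ≠ x.2)
      (measurableSet_eq_fun measurable_fst measurable_snd).compl).2
      (Eventually.of_forall fun z => ?_)
    have h4 := measure_eq_zero_iff_ae_notMem.1 (hν.2.1 z)
    filter_upwards [h4] with ζ hζ h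
    exact hζ h.symm
  filter_upwards [h1, h2, h3] with x a b c
  exact ⟨a, b, c⟩

lemma integrable_gaussKernel [IsProbabilityMeasure μ] [IsProbabilityMeasure ν] {s : ℝ}
    (hs : 0 ≤ s) :
    Integrable (fun x : ℂ × ℂ => Real.exp (-s * ‖x.1 - x.2‖ ^ 2)) (μ.prod ν) := by
  refine Integrable.of_bound (C := 1) (Continuous.aestronglyMeasurable (by fun_prop))
    (Eventually.of_forall fun x => ?_)
  rw [Real.norm_of_nonneg (Real.exp_pos _).le, Real.exp_le_one_iff]
  have : 0 ≤ s * ‖x.1 - x.2‖ ^ 2 := by positivity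
  linarith

lemma exp_le_gaussEnergy (hμ : μ ∈ admissibleMeasures D) (hν : ν ∈ admissibleMeasures D)
    (hR : ∀ z ∈ D, ∀ ζ ∈ D, ‖z - ζ‖ ≤ R) {s : ℝ} (hs : 0 ≤ s) :
    Real.exp (-s * R ^ 2) ≤ gaussEnergy s μ ν := by
  have := hμ.1
  have := hν.1
  have h1 : ∫ _ : ℂ × ℂ, Real.exp (-s * R ^ 2) ∂(μ.prod ν) = Real.exp (-s * R ^ 2) := by simp
  rw [← h1]
  refine integral_mono_ae (integrable_const _) (integrable_gaussKernel hs) ?_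
  filter_upwards [ae_prod_of_admissible hμ hν] with x hx
  have h2 := pow_le_pow_left₀ (norm_nonneg _) (hR _ hx.1 _ hx.2.1) 2
  have h3 := mul_le_mul_of_nonneg_left h2 hs
  exact Real.exp_le_exp.2 (by linarith)

/-- Frullani's formula with |z - ζ|² and R²; the squares produce the factor 2. Since R bounds the
distances in D, all integrands are nonnegative and infinite energies need no separate treatment. -/
lemma two_mul_mutualEnergy_eq (hμ : μ ∈ admissibleMeasures D) (hν : ν ∈ admissibleMeasures D)
    (hR : ∀ z ∈ D, ∀ ζ ∈ D, ‖z - ζ‖ ≤ R) :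
    2 * mutualEnergy R μ ν = ∫⁻ s in Ioi (0 : ℝ),
      ENNReal.ofReal ((gaussEnergy s μ ν - Real.exp (-s * R ^ 2)) / s) := by
  have := hμ.1
  have := hν.1
  rw [mutualEnergy, ← lintegral_const_mul _ (measurable_logKernel R)]
  have h1 : ∀ᵐ x ∂(μ.prod ν), 2 * ENNReal.ofReal (Real.log (R / ‖x.1 - x.2‖)) =
      ∫⁻ s in Ioi (0 : ℝ), ENNReal.ofReal
        ((Real.exp (-s * ‖x.1 - x.2‖ ^ 2) - Real.exp (-s * R ^ 2)) / s) := by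
    filter_upwards [ae_prod_of_admissible hμ hν] with x hx
    have hd : 0 < ‖x.1 - x.2‖ := norm_pos_iff.2 (sub_ne_zero.2 hx.2.2)
    have hdR := hR _ hx.1 _ hx.2.1
    rw [lintegral_exp_sub_exp_div (by positivity) (pow_le_pow_left₀ hd.le hdR 2), ← div_pow,
      Real.log_pow, ENNReal.ofReal_mul (by positivity)]
    simp
  rw [lintegral_congr_ae h1, lintegral_lintegral_swap]
  · refine setLIntegral_congr_fun measurableSet_Ioi fun s hs => ?_
    rw [mem_Ioi] at hs
    have hint := integrable_gaussKernel (μ := μ) (ν := ν) hs.le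
    have hint2 : Integrable (fun x : ℂ × ℂ =>
        (Real.exp (-s * ‖x.1 - x.2‖ ^ 2) - Real.exp (-s * R ^ 2)) / s) (μ.prod ν) :=
      (hint.sub (integrable_const _)).div_const s
    rw [← ofReal_integral_eq_lintegral_ofReal hint2]
    · rw [integral_div, integral_sub hint (integrable_const _)]
      simp [gaussEnergy]
    · filter_upwards [ae_prod_of_admissible hμ hν] with x hx
      have h2 := pow_le_pow_left₀ (norm_nonneg _) (hR _ hx.1 _ hx.2.1) 2
      have h3 := mul_le_mul_of_nonneg_left h2 hs.le
      have h4 : Real.exp (-s * R ^ 2) ≤ Real.exp (-s * ‖x.1 - x.2‖ ^ 2) :=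
        Real.exp_le_exp.2 (by linarith)
      exact div_nonneg (by linarith) hs.le
  · refine Measurable.aemeasurable ?_
    unfold Function.uncurry
    fun_prop

lemma measurable_gaussEnergy (μ ν : Measure ℂ) [IsProbabilityMeasure μ] [IsProbabilityMeasure ν] :
    Measurable fun s => gaussEnergy s μ ν := by
  have h : StronglyMeasurable fun y : ℝ × (ℂ × ℂ) => Real.exp (-y.1 * ‖y.2.1 - y.2.2‖ ^ 2) :=
    Continuous.stronglyMeasurable (by fun_prop)
  exact (h.integral_prod_right' (ν := μ.prod ν)).measurable

/-- Positive definiteness of the Gaussians is integrated over s. If equality holds with finite cross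
energy, it holds for almost every s > 0, and a single such s already gives μ = ν. -/
lemma two_mul_mutualEnergy_le (hμ : μ ∈ admissibleMeasures D) (hν : ν ∈ admissibleMeasures D)
    (hR : ∀ z ∈ D, ∀ ζ ∈ D, ‖z - ζ‖ ≤ R) :
    2 * mutualEnergy R μ ν ≤ mutualEnergy R μ μ + mutualEnergy R ν ν ∧
      (mutualEnergy R μ ν ≠ ∞ →
        mutualEnergy R μ μ + mutualEnergy R ν ν ≤ 2 * mutualEnergy R μ ν → μ = ν) := by
  have := hμ.1
  have := hν.1
  set f : ℝ → ℝ := fun s => (gaussEnergy s μ ν - Real.exp (-s * R ^ 2)) / s with hf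
  set f₁ : ℝ → ℝ := fun s => (gaussEnergy s μ μ - Real.exp (-s * R ^ 2)) / s with hf₁
  set f₂ : ℝ → ℝ := fun s => (gaussEnergy s ν ν - Real.exp (-s * R ^ 2)) / s with hf₂
  have hmf : Measurable f := by
    have := measurable_gaussEnergy μ ν
    fun_prop
  have hmf₁ : Measurable f₁ := by
    have := measurable_gaussEnergy μ μ
    fun_prop
  have hmf₂ : Measurable f₂ := by
    have := measurable_gaussEnergy ν ν
    fun_prop
  have h0 : 2 * (2 * mutualEnergy R μ ν) =
      ∫⁻ s in Ioi (0 : ℝ), 2 * ENNReal.ofReal (f s) := by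
    rw [two_mul_mutualEnergy_eq hμ hν hR, lintegral_const_mul _ hmf.ennreal_ofReal]
  have h12 : 2 * (mutualEnergy R μ μ + mutualEnergy R ν ν) =
      ∫⁻ s in Ioi (0 : ℝ), (ENNReal.ofReal (f₁ s) + ENNReal.ofReal (f₂ s)) := by
    rw [mul_add, two_mul_mutualEnergy_eq hμ hμ hR, two_mul_mutualEnergy_eq hν hν hR,
      lintegral_add_left hmf₁.ennreal_ofReal]
  have hle : ∀ s ∈ Ioi (0 : ℝ), 2 * ENNReal.ofReal (f s) ≤
      ENNReal.ofReal (f₁ s) + ENNReal.ofReal (f₂ s) := by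
    intro s hs
    refine le_trans (le_of_eq ?_) ((ENNReal.ofReal_le_ofReal (p := 2 * f s) ?_).trans
      ENNReal.ofReal_add_le)
    · rw [ENNReal.ofReal_mul zero_le_two]
      simp
    · have h1 := two_mul_gaussEnergy_le μ ν hs
      rw [hf, hf₁, hf₂]
      simp only
      rw [← add_div, ← mul_div_assoc]
      exact div_le_div_of_nonneg_right (by linarith) (le_of_lt hs)
  constructor
  · have h1 : 2 * (2 * mutualEnergy R μ ν) ≤ 2 * (mutualEnergy R μ μ + mutualEnergy R ν ν) := by
      rw [h0, h12]
      exact setLIntegral_mono' measurableSet_Ioi hle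
    exact (ENNReal.mul_le_mul_iff_right two_ne_zero ENNReal.ofNat_ne_top).1 h1
  · intro hfin hge
    have h1 : ∫⁻ s in Ioi (0 : ℝ), (ENNReal.ofReal (f₁ s) + ENNReal.ofReal (f₂ s)) ≤
        ∫⁻ s in Ioi (0 : ℝ), 2 * ENNReal.ofReal (f s) := by
      rw [← h0, ← h12]
      exact mul_le_mul_right hge 2
    have hne : ∫⁻ s in Ioi (0 : ℝ), 2 * ENNReal.ofReal (f s) ≠ ∞ := by
      rw [← h0]
      exact ENNReal.mul_ne_top ENNReal.ofNat_ne_top (ENNReal.mul_ne_top ENNReal.ofNat_ne_top hfin)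
    have h2 := ae_eq_of_ae_le_of_lintegral_le
      ((ae_restrict_iff' measurableSet_Ioi).2 (Eventually.of_forall hle)) hne
      (hmf₁.ennreal_ofReal.add hmf₂.ennreal_ofReal).aemeasurable h1
    have hnz : (volume.restrict (Ioi (0 : ℝ))) ≠ 0 := by
      rw [Ne, Measure.restrict_eq_zero, Real.volume_Ioi]
      exact ENNReal.top_ne_zero
    have : (ae (volume.restrict (Ioi (0 : ℝ)))).NeBot := ae_neBot.2 hnz
    obtain ⟨s, hs, hs0⟩ := (h2.and (ae_restrict_mem measurableSet_Ioi)).exists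
    rw [mem_Ioi] at hs0
    refine eq_of_two_mul_gaussEnergy_eq hs0 ?_
    have k0 : 0 ≤ f s := div_nonneg (sub_nonneg.2 (exp_le_gaussEnergy hμ hν hR hs0.le)) hs0.le
    have k1 : 0 ≤ f₁ s := div_nonneg (sub_nonneg.2 (exp_le_gaussEnergy hμ hμ hR hs0.le)) hs0.le
    have k2 : 0 ≤ f₂ s := div_nonneg (sub_nonneg.2 (exp_le_gaussEnergy hν hν hR hs0.le)) hs0.le
    have h3 : 2 * f s = f₁ s + f₂ s := by
      have h4 := congrArg ENNReal.toReal hs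
      rwa [ENNReal.toReal_mul, ENNReal.toReal_ofReal k0, ENNReal.toReal_add ENNReal.ofReal_ne_top
        ENNReal.ofReal_ne_top, ENNReal.toReal_ofReal k1, ENNReal.toReal_ofReal k2,
        ENNReal.toReal_ofNat] at h4
    rw [hf, hf₁, hf₂] at h3
    simp only at h3
    field_simp at h3
    linarith

/-- The negative part of the kernel is at most log R and thus has finite integral; the diagonal is
null because there are no atoms. Adding log R is then legitimate also when the energy is infinite.
-/
lemma logEnergy_eq (hν : ν ∈ admissibleMeasures D) (hR1 : 1 ≤ R)
    (hR : ∀ z ∈ D, ∀ ζ ∈ D, ‖z - ζ‖ ≤ R) :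
    logEnergy ν = (mutualEnergy R ν ν : EReal) - (Real.log R : ℝ) := by
  have := hν.1
  have : NullSingletonClass ν := ⟨hν.2.1⟩
  have hlogR : 0 ≤ Real.log R := Real.log_nonneg hR1
  have hm1 : Measurable fun x : ℂ × ℂ => ENNReal.ofReal (Real.log ‖x.1 - x.2‖⁻¹) :=
    (Real.measurable_log.comp (by fun_prop)).ennreal_ofReal
  have hm2 : Measurable fun x : ℂ × ℂ => ENNReal.ofReal (-Real.log ‖x.1 - x.2‖⁻¹) :=
    (Real.measurable_log.comp (by fun_prop : Measurable fun x : ℂ × ℂ => ‖x.1 - x.2‖⁻¹)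
      ).neg.ennreal_ofReal
  rw [logEnergy]
  simp only [restrict_compl_singleton]
  rw [← lintegral_prod (μ := ν) (ν := ν)
      (fun x : ℂ × ℂ => ENNReal.ofReal (Real.log ‖x.1 - x.2‖⁻¹)) hm1.aemeasurable,
    ← lintegral_prod (μ := ν) (ν := ν)
      (fun x : ℂ × ℂ => ENNReal.ofReal (-Real.log ‖x.1 - x.2‖⁻¹)) hm2.aemeasurable]
  set A := ∫⁻ x : ℂ × ℂ, ENNReal.ofReal (Real.log ‖x.1 - x.2‖⁻¹) ∂(ν.prod ν) with hA
  set B := ∫⁻ x : ℂ × ℂ, ENNReal.ofReal (-Real.log ‖x.1 - x.2‖⁻¹) ∂(ν.prod ν) with hB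
  have hbd : ∀ᵐ x ∂(ν.prod ν), 0 < ‖x.1 - x.2‖ ∧ -Real.log ‖x.1 - x.2‖⁻¹ ≤ Real.log R := by
    filter_upwards [ae_prod_of_admissible hν hν] with x hx
    have hd : 0 < ‖x.1 - x.2‖ := norm_pos_iff.2 (sub_ne_zero.2 hx.2.2)
    rw [Real.log_inv, neg_neg]
    exact ⟨hd, Real.log_le_log hd (hR _ hx.1 _ hx.2.1)⟩
  have hBle : B ≤ ENNReal.ofReal (Real.log R) := by
    rw [hB]
    refine (lintegral_mono_ae (g := fun _ => ENNReal.ofReal (Real.log R)) ?_).trans (by simp)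
    filter_upwards [hbd] with x hx
    exact ENNReal.ofReal_le_ofReal hx.2
  have hBfin : B ≠ ∞ := ne_top_of_le_ne_top ENNReal.ofReal_ne_top hBle
  have hsum : mutualEnergy R ν ν + B = A + ENNReal.ofReal (Real.log R) := by
    have h1 : ENNReal.ofReal (Real.log R) = ∫⁻ _ : ℂ × ℂ, ENNReal.ofReal (Real.log R) ∂(ν.prod ν) := by
      simp
    rw [h1, hA, hB, mutualEnergy, ← lintegral_add_left (measurable_logKernel R),
      ← lintegral_add_left hm1]
    refine lintegral_congr_ae ?_
    filter_upwards [hbd] with x hx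
    obtain ⟨hd, hle⟩ := hx
    have h2 : Real.log (R / ‖x.1 - x.2‖) = Real.log R + Real.log ‖x.1 - x.2‖⁻¹ := by
      rw [div_eq_mul_inv, Real.log_mul (by positivity) (by positivity)]
    rw [h2]
    rcases le_total 0 (Real.log ‖x.1 - x.2‖⁻¹) with h3 | h3
    · rw [ENNReal.ofReal_of_nonpos (p := -_) (by linarith), add_zero, ENNReal.ofReal_add hlogR h3,
        add_comm]
    · rw [ENNReal.ofReal_of_nonpos h3, zero_add, ← ENNReal.ofReal_add (by linarith) (by linarith)]
      congr 1
      ring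
  by_cases hAt : A = ∞
  · have hKt : mutualEnergy R ν ν = ∞ := by
      rw [hAt, top_add] at hsum
      exact (ENNReal.add_eq_top.1 hsum).resolve_right hBfin
    rw [hAt, hKt, ← EReal.coe_ennreal_toReal hBfin, EReal.coe_ennreal_top, EReal.top_sub_coe,
      EReal.top_sub_coe]
  · have hKt : mutualEnergy R ν ν ≠ ∞ := fun h => by
      rw [h, top_add] at hsum
      exact ENNReal.add_ne_top.2 ⟨hAt, ENNReal.ofReal_ne_top⟩ hsum.symm
    have h2 := congrArg ENNReal.toReal hsum
    rw [ENNReal.toReal_add hKt hBfin, ENNReal.toReal_add hAt ENNReal.ofReal_ne_top,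
      ENNReal.toReal_ofReal hlogR] at h2
    rw [← EReal.coe_ennreal_toReal hAt, ← EReal.coe_ennreal_toReal hBfin,
      ← EReal.coe_ennreal_toReal hKt, ← EReal.coe_sub, ← EReal.coe_sub]
    congr 1
    linarith

lemma integrable_of_admissible (hD : IsCompact D) (hν : ν ∈ admissibleMeasures D) {f : ℂ → ℝ}
    (hf : Continuous f) : Integrable f ν := by
  have := hν.1
  obtain ⟨M, hM⟩ := hD.exists_bound_of_continuousOn hf.continuousOn
  refine Integrable.of_bound hf.aestronglyMeasurable M ?_
  filter_upwards [ae_mem_of_admissible hν] with z hz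
  exact hM z hz

/-- A measure that satisfies the Euler-Lagrange conditions is the unique equilibrium measure. -/
lemma isEquilibriumMeasure_iff {V : ℂ → ℝ} (hV : Continuous V) (hD : IsCompact D) (hR1 : 1 ≤ R)
    (hR : ∀ z ∈ D, ∀ ζ ∈ D, ‖z - ζ‖ ≤ R) (hμ : μ ∈ admissibleMeasures D) {p : ℂ → ℝ}
    (hp : Continuous p) (hp0 : ∀ z ∈ D, 0 ≤ p z)
    (hpot : ∀ z ∈ D, ∫⁻ ζ, ENNReal.ofReal (Real.log (R / ‖z - ζ‖)) ∂μ = ENNReal.ofReal (p z))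
    {c : ℝ} (hc : ∀ z ∈ D, c ≤ V z + 2 * p z) (hcμ : ∀ᵐ z ∂μ, V z + 2 * p z = c) (ν : Measure ℂ) :
    IsEquilibriumMeasure V D ν ↔ ν = μ := by
  have := hμ.1
  have hK : ∀ ν ∈ admissibleMeasures D, mutualEnergy R ν μ = ENNReal.ofReal (∫ z, p z ∂ν) := by
    intro ν hν
    have := hν.1
    rw [mutualEnergy, lintegral_prod _ (measurable_logKernel R).aemeasurable,
      ofReal_integral_eq_lintegral_ofReal (integrable_of_admissible hD hν hp)]
    · refine lintegral_congr_ae ?_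
      filter_upwards [ae_mem_of_admissible hν] with z hz
      exact hpot z hz
    · filter_upwards [ae_mem_of_admissible hν] with z hz
      exact hp0 z hz
  have hint : ∀ ν ∈ admissibleMeasures D, 0 ≤ ∫ z, p z ∂ν := by
    intro ν hν
    refine integral_nonneg_of_ae ?_
    filter_upwards [ae_mem_of_admissible hν] with z hz
    exact hp0 z hz
  have hEL : ∀ ν ∈ admissibleMeasures D, c ≤ ∫ z, V z ∂ν + 2 * ∫ z, p z ∂ν := by
    intro ν hν
    have := hν.1
    have i1 := integrable_of_admissible hD hν hV
    have i2 := (integrable_of_admissible hD hν hp).const_mul 2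
    have h1 : ∫ _, c ∂ν ≤ ∫ z, (V z + 2 * p z) ∂ν := by
      refine integral_mono_ae (integrable_const c) (i1.add i2) ?_
      filter_upwards [ae_mem_of_admissible hν] with z hz
      exact hc z hz
    rw [integral_add i1 i2, integral_const_mul] at h1
    simpa using h1
  have hELμ : ∫ z, V z ∂μ + 2 * ∫ z, p z ∂μ = c := by
    have i1 := integrable_of_admissible hD hμ hV
    have i2 := (integrable_of_admissible hD hμ hp).const_mul 2
    have h1 : ∫ z, (V z + 2 * p z) ∂μ = ∫ _, c ∂μ := integral_congr_ae hcμ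
    rw [integral_add i1 i2, integral_const_mul] at h1
    simpa using h1
  have hEμ : weightedEnergy V μ = ((∫ z, V z ∂μ + (∫ z, p z ∂μ - Real.log R) : ℝ) : EReal) := by
    rw [weightedEnergy, logEnergy_eq hμ hR1 hR, hK μ hμ, EReal.coe_ennreal_ofReal,
      max_eq_left (hint μ hμ)]
    push_cast
    rfl
  -- For finite energy, positive definiteness bounds the energy of ν below by 2∫p dν - ∫p dμ. With
  -- the integrated Euler-Lagrange inequality this gives I(ν) ≥ c - ∫p dμ - log R = I(μ), and
  -- equality in the end forces equality in the first bound.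
  have hmain : ∀ ν ∈ admissibleMeasures D, weightedEnergy V μ ≤ weightedEnergy V ν ∧
      (weightedEnergy V ν ≤ weightedEnergy V μ → ν = μ) := by
    intro ν hν
    have hEν : weightedEnergy V ν = (∫ z, V z ∂ν : ℝ) +
        ((mutualEnergy R ν ν : EReal) - (Real.log R : ℝ)) := by
      rw [weightedEnergy, logEnergy_eq hν hR1 hR]
    by_cases hfin : mutualEnergy R ν ν = ∞
    · have : weightedEnergy V ν = ⊤ := by
        rw [hEν, hfin, EReal.coe_ennreal_top, EReal.top_sub_coe, EReal.coe_add_top]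
      rw [this]
      refine ⟨le_top, fun h => ?_⟩
      rw [hEμ] at h
      exact absurd (top_le_iff.1 h) (EReal.coe_ne_top _)
    · have hEν' : weightedEnergy V ν =
          ((∫ z, V z ∂ν + ((mutualEnergy R ν ν).toReal - Real.log R) : ℝ) : EReal) := by
        rw [hEν, ← EReal.coe_ennreal_toReal hfin]
        push_cast
        rfl
      obtain ⟨hle, heq⟩ := two_mul_mutualEnergy_le hν hμ hR
      rw [hK ν hν, hK μ hμ] at hle heq
      have h1 := ENNReal.toReal_mono (ENNReal.add_ne_top.2 ⟨hfin, ENNReal.ofReal_ne_top⟩) hle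
      rw [ENNReal.toReal_mul, ENNReal.toReal_ofNat, ENNReal.toReal_ofReal (hint ν hν),
        ENNReal.toReal_add hfin ENNReal.ofReal_ne_top, ENNReal.toReal_ofReal (hint μ hμ)] at h1
      have h2 := hEL ν hν
      rw [hEμ, hEν', EReal.coe_le_coe_iff, EReal.coe_le_coe_iff]
      refine ⟨by linarith, fun h => heq ENNReal.ofReal_ne_top ?_⟩
      rw [← ENNReal.ofReal_toReal hfin, ← ENNReal.ofReal_add ENNReal.toReal_nonneg (hint μ hμ)]
      have h3 : 2 * ENNReal.ofReal (∫ z, p z ∂ν) = ENNReal.ofReal (2 * ∫ z, p z ∂ν) := by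
        rw [ENNReal.ofReal_mul zero_le_two]
        simp
      rw [h3]
      exact ENNReal.ofReal_le_ofReal (by linarith)
  have hinf : ⨅ ν ∈ admissibleMeasures D, weightedEnergy V ν = weightedEnergy V μ :=
    le_antisymm (iInf₂_le μ hμ) (le_iInf₂ fun ν hν => (hmain ν hν).1)
  constructor
  · rintro ⟨hν, h⟩
    rw [hinf] at h
    exact (hmain ν hν).2 h.le
  · rintro rfl
    exact ⟨hμ, hinf.symm⟩

end

/-! ### The normalized area measure of the interior domain -/

namespace PolynomialCurve

variable {γ : PolynomialCurve} {t₀ : ℝ} {D : Set ℂ}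

lemma uniformMeasure_mem_admissibleMeasures (ht₀ : 0 < t₀)
    (hvol : volume γ.interiorDomain = ENNReal.ofReal (Real.pi * t₀)) (hD : MeasurableSet D)
    (hsub : γ.interiorDomain ⊆ D) : γ.uniformMeasure t₀ ∈ admissibleMeasures D := by
  refine ⟨⟨?_⟩, fun z => ?_, ?_⟩
  · rw [uniformMeasure, Measure.smul_apply, Measure.restrict_apply_univ, hvol, smul_eq_mul,
      ← ENNReal.ofReal_mul (by positivity), one_div, inv_mul_cancel₀ (by positivity),
      ENNReal.ofReal_one]
  · rw [uniformMeasure, Measure.smul_apply, measure_singleton, smul_zero]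
  · rw [uniformMeasure, Measure.smul_apply, Measure.restrict_apply hD.compl,
      disjoint_iff_inter_eq_empty.1 (disjoint_compl_left_iff_subset.2 hsub), measure_empty,
      smul_zero]

lemma integral_log_sub_log (hU : IsExteriorUnivalent γ.r γ.a) (ht₀ : 0 < t₀)
    (hvol : volume γ.interiorDomain = ENNReal.ofReal (Real.pi * t₀)) (R : ℝ) (z : ℂ) :
    ∫ ζ in γ.interiorDomain, (Real.log R - Real.log ‖z - ζ‖) =
      Real.pi * t₀ * (Real.log R - 1 / (Real.pi * t₀) * logPotential γ.interiorDomain z) := by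
  have hc : IntegrableOn (fun _ : ℂ => Real.log R) γ.interiorDomain :=
    integrableOn_const (by rw [hvol]; exact ENNReal.ofReal_ne_top)
  rw [integral_sub hc
    (integrableOn_log_norm_sub (γ.isOpen_interiorDomain hU).measurableSet
      (γ.isBounded_interiorDomain hU) z), setIntegral_const, Measure.real, hvol,
    ENNReal.toReal_ofReal (by positivity), smul_eq_mul, logPotential]
  field_simp

lemma ae_log_sub_log_nonneg (hU : IsExteriorUnivalent γ.r γ.a) {R : ℝ}
    (hsub : γ.interiorDomain ⊆ D) (hR : ∀ z ∈ D, ∀ ζ ∈ D, ‖z - ζ‖ ≤ R) {z : ℂ} (hz : z ∈ D) :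
    ∀ᵐ ζ ∂(volume.restrict γ.interiorDomain), 0 ≤ Real.log R - Real.log ‖z - ζ‖ ∧
      Real.log (R / ‖z - ζ‖) = Real.log R - Real.log ‖z - ζ‖ := by
  filter_upwards [ae_restrict_mem (γ.isOpen_interiorDomain hU).measurableSet,
    ae_restrict_of_ae (Measure.ae_ne volume z)] with ζ hζ hne
  have hd : 0 < ‖z - ζ‖ := norm_pos_iff.2 (sub_ne_zero.2 hne.symm)
  have hdR := hR z hz ζ (hsub hζ)
  exact ⟨sub_nonneg.2 (Real.log_le_log hd hdR), Real.log_div (hd.trans_le hdR).ne' hd.ne'⟩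

/-- The Euler-Lagrange conditions characterize the equilibrium measure. -/
lemma isEquilibriumMeasure_iff_eq_uniformMeasure (hU : IsExteriorUnivalent γ.r γ.a) (ht₀ : 0 < t₀)
    (hvol : volume γ.interiorDomain = ENNReal.ofReal (Real.pi * t₀)) (hD : IsCompact D)
    (hsub : γ.interiorDomain ⊆ D) {n : ℕ} {t : ℕ → ℂ} {E : ℝ}
    (hin : ∀ z ∈ γ.interiorDomain, γ.effectivePotential n t z = E)
    (hE : ∀ z ∈ D, E ≤ γ.effectivePotential n t z) (μ : Measure ℂ) :
    IsEquilibriumMeasure (potential n t₀ t) D μ ↔ μ = γ.uniformMeasure t₀ := by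
  have hmeas := (γ.isOpen_interiorDomain hU).measurableSet
  have hbdd := γ.isBounded_interiorDomain hU
  obtain ⟨L, hL0, hL⟩ := hD.isBounded.exists_pos_norm_le
  set R := 2 * L + 1
  have hR : ∀ z ∈ D, ∀ ζ ∈ D, ‖z - ζ‖ ≤ R := fun z hz ζ hζ => by
    have h1 := norm_sub_le z ζ
    have h2 := hL z hz
    have h3 := hL ζ hζ
    linarith
  -- The potential of the uniform measure for the kernel log(R/|z - ζ|); V + 2p is the effective
  -- potential over t₀ up to a constant.
  set p : ℂ → ℝ := fun z => Real.log R - 1 / (Real.pi * t₀) * logPotential γ.interiorDomain z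
    with hp
  have hVp : ∀ z, potential n t₀ t z + 2 * p z =
      1 / t₀ * γ.effectivePotential n t z + 2 * Real.log R := by
    intro z
    rw [potential, effectivePotential, hp]
    field_simp
    ring
  have hp0 : ∀ z ∈ D, 0 ≤ Real.pi * t₀ * p z := by
    intro z hz
    rw [hp, ← integral_log_sub_log hU ht₀ hvol]
    refine integral_nonneg_of_ae ?_
    filter_upwards [ae_log_sub_log_nonneg hU hsub hR hz] with ζ hζ
    exact hζ.1
  refine isEquilibriumMeasure_iff (V := potential n t₀ t) (R := R) (p := p) (c := 1 / t₀ * E + 2 * Real.log R)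
    (continuous_const.mul (continuous_scaledPotential n t)) hD (by linarith) hR
    (uniformMeasure_mem_admissibleMeasures ht₀ hvol hD.measurableSet hsub) ?_ ?_ ?_ ?_ ?_ μ
  · exact continuous_const.sub (continuous_const.mul (continuous_logPotential hmeas hbdd ht₀ hvol))
  · exact fun z hz => nonneg_of_mul_nonneg_right (hp0 z hz) (by positivity)
  · intro z hz
    have h1 : ∫⁻ ζ in γ.interiorDomain, ENNReal.ofReal (Real.log (R / ‖z - ζ‖)) =
        ENNReal.ofReal (∫ ζ in γ.interiorDomain, (Real.log R - Real.log ‖z - ζ‖)) := by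
      rw [ofReal_integral_eq_lintegral_ofReal]
      · refine lintegral_congr_ae ?_
        filter_upwards [ae_log_sub_log_nonneg hU hsub hR hz] with ζ hζ
        rw [hζ.2]
      · exact (integrableOn_const (by rw [hvol]; exact ENNReal.ofReal_ne_top)).sub
          (integrableOn_log_norm_sub hmeas hbdd z)
      · filter_upwards [ae_log_sub_log_nonneg hU hsub hR hz] with ζ hζ
        exact hζ.1
    rw [uniformMeasure, lintegral_smul_measure, h1, integral_log_sub_log hU ht₀ hvol, smul_eq_mul,
      ← ENNReal.ofReal_mul (by positivity)]
    congr 1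
    rw [hp]
    field_simp
  · intro z hz
    rw [hVp]
    have := mul_le_mul_of_nonneg_left (hE z hz) (by positivity : 0 ≤ 1 / t₀)
    linarith
  · refine Measure.ae_smul_measure ?_ _
    filter_upwards [ae_restrict_mem hmeas] with z hz
    rw [hVp, hin z hz]

end PolynomialCurve

end

end

/-! ### Choice of the constants and conclusion -/

theorem theorem6p1 (n : ℕ) (t : ℕ → ℂ) (ht1 : t 1 = 0) (ht2 : ‖t 2‖ < 1 / 2)
    (ht : ∀ k : ℕ, n + 1 < k → t k = 0)
    (D : Set ℂ) (hD : IsCompact D) (h0 : (0 : ℂ) ∈ interior D)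
    (hpos : ∀ z ∈ D \ {0}, 0 < scaledPotential n t z) :
    ∃ δ : ℝ, 0 < δ ∧ ∀ t₀ : ℝ, 0 < t₀ → t₀ < δ →
      ∃ γ : PolynomialCurve, γ.a.natDegree ≤ n ∧ γ.HasMoments t₀ t ∧
        (∀ γ' : PolynomialCurve, γ'.HasMoments t₀ t → γ' = γ) ∧
        (∀ μ : Measure ℂ,
          IsEquilibriumMeasure (potential n t₀ t) D μ ↔ μ = γ.uniformMeasure t₀) := by
  obtain ⟨ε₁, hε₁, r₂, hr₂, hEL⟩ := exists_effectivePotential_le ht1 ht2 ht hD hpos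
  obtain ⟨B, hB, δ₁, hδ₁, hsmall⟩ := exists_norm_curveMap_le ht1 ht2 ht
  have hκ : 0 < 1 - 2 * ‖t 2‖ := by linarith
  -- The three bounds serve the Euler-Lagrange inequality, the estimate ‖b‖ ≤ 2 and univalence, in
  -- this order.
  obtain ⟨ε, hε⟩ : ∃ ε : ℝ, ε = min ε₁ (min 1 ((1 - 2 * ‖t 2‖) / (2 * (n + 1) ^ 2))) := ⟨_, rfl⟩
  have hε0 : 0 < ε := by rw [hε]; positivity
  have hεε₁ : ε ≤ ε₁ := by rw [hε]; exact min_le_left _ _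
  have hε1 : ε ≤ 1 := by rw [hε]; exact (min_le_right _ _).trans (min_le_left _ _)
  have hεκ : ε * (2 * (n + 1) ^ 2) ≤ 1 - 2 * ‖t 2‖ := by
    rw [← le_div_iff₀ (by positivity), hε]
    exact (min_le_right _ _).trans (min_le_right _ _)
  -- The radius `max 2 B` contains both the constructed coefficients and those of any competing
  -- curve.
  obtain ⟨r₁, hr₁, K, hK, δ₂, hδ₂, hex, huniq⟩ :=
    exists_parameters ht2 ht (R := max 2 B) (le_max_left _ _) hε0
  obtain ⟨d, hd, hball⟩ := Metric.mem_nhds_iff.1 (mem_interior_iff_mem_nhds.1 h0)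
  obtain ⟨A, hA⟩ : ∃ A : ℝ, A = 1 + 2 * (n + 1) := ⟨_, rfl⟩
  have hA0 : 0 < A := by rw [hA]; positivity
  -- δ₁ and δ₂ give the a priori bound and existence. The third bound yields r < r₂ and r A < d, so
  -- that D₊ lies in a ball inside D. The last gives B√t₀ < r₁, so that every competing curve falls
  -- into the range of uniqueness.
  refine ⟨min (min δ₁ δ₂) (min (min r₂ (d / A) ^ 2 / K) ((r₁ / B) ^ 2)), by positivity,
    fun t₀ ht₀ hδ => ?_⟩
  have htδ₁ : t₀ < δ₁ := hδ.trans_le ((min_le_left _ _).trans (min_le_left _ _))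
  have htδ₂ : t₀ < δ₂ := hδ.trans_le ((min_le_left _ _).trans (min_le_right _ _))
  have htK : t₀ < min r₂ (d / A) ^ 2 / K :=
    hδ.trans_le ((min_le_right _ _).trans (min_le_left _ _))
  have htB : t₀ < (r₁ / B) ^ 2 := hδ.trans_le ((min_le_right _ _).trans (min_le_right _ _))
  obtain ⟨r, b, hr, hrr₁, hrK, hbε, hbR, hfix, harea⟩ := hex t₀ ht₀ htδ₂
  have hb2 : ‖b‖ ≤ 2 := by
    have h1 := norm_add_le (b - ellipseCoeff n t) (ellipseCoeff n t)
    rw [sub_add_cancel] at h1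
    have h2 := norm_ellipseCoeff_le n t
    linarith
  have hnear : IsNearEllipse n t b := by
    have h1 : 0 < ε * (n + 1) ^ 2 := by positivity
    have h2 := mul_le_mul_of_nonneg_left hbε (by positivity : (0 : ℝ) ≤ (n + 1) ^ 2)
    unfold IsNearEllipse
    linarith
  have hrmin : r < min r₂ (d / A) := by
    refine lt_of_pow_lt_pow_left₀ 2 (by positivity) (hrK.trans_lt ?_)
    rwa [lt_div_iff₀ hK, mul_comm] at htK
  have htr : t₀ ≤ r ^ 2 := by
    have h1 : 0 ≤ areaDeficit n b := by
      unfold areaDeficit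
      positivity
    have h2 := mul_nonneg (sq_nonneg r) h1
    linarith
  have hmom := hasMoments_scaledCurve ht1 ht hnear hr hfix harea
  obtain ⟨γ, hγ⟩ : ∃ γ, γ = scaledCurve ht hnear hr := ⟨_, rfl⟩
  have hγr : γ.r = r := by rw [hγ]; rfl
  have hγa : γ.a = scaledPoly n r b := by rw [hγ]; rfl
  rw [← hγ] at hmom
  have hU := γ.isExteriorUnivalent hmom.1
  obtain ⟨g, hg⟩ := γ.exists_hasSchwarzPoly_of_forall_harmonicMoment hU hmom.2.1 ht hmom.2.2.2
  refine ⟨γ, ?_, hmom, fun γ' hγ' => ?_, fun μ => ?_⟩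
  · rw [hγa]
    exact natDegree_scaledPoly_le n r b
  · obtain ⟨b', ha', hr', hb', hfix', harea'⟩ :=
      parameters_of_hasMoments ht1 ht ht₀ hγ' hB (hsmall t₀ ht₀ htδ₁ γ' hγ')
    have hlt : B * √t₀ < r₁ := by
      have h1 : √t₀ < r₁ / B := (Real.sqrt_lt' (by positivity)).2 htB
      rwa [lt_div_iff₀ hB, mul_comm] at h1
    obtain ⟨h1, h2⟩ := huniq γ'.r r b' b γ'.r_pos (hr'.trans_lt hlt) hr hrr₁
      (hb'.trans (le_max_right _ _)) hbR hfix' hfix (harea'.trans harea.symm)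
    refine PolynomialCurve.ext_of_eq (h1.trans hγr.symm) ?_
    rw [ha', hγa, h1, h2]
  · have hsub : γ.interiorDomain ⊆ D := by
      intro z hz
      refine hball (mem_ball_zero_iff.2 (lt_of_le_of_lt
        (PolynomialCurve.norm_le_of_mem_interiorDomain (fun z hz =>
          PolynomialCurve.norm_le_of_mem_image (hγa.trans (by rw [hγr])) hb2 hz) hz) ?_))
      have h1 := hrmin.trans_le (min_le_right _ _)
      rw [lt_div_iff₀ hA0, hA] at h1
      rwa [hγr]
    refine PolynomialCurve.isEquilibriumMeasure_iff_eq_uniformMeasure hU ht₀ hmom.2.2.1 hD hsub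
      (fun z hz => PolynomialCurve.effectivePotential_of_mem_interiorDomain hU ht₀ hmom.2.2.1 hg hz)
      (hEL γ b t₀ g hU (hγa.trans (by rw [hγr])) hb2 (hbε.trans hεε₁) ?_ ht₀ ?_ hmom.2.2.1 hg) μ
    · rw [hγr]
      exact hrmin.trans_le (min_le_left _ _)
    · rw [hγr]
      exact htr
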